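/- **Proposition 3.3.** Let $K$ be a noetherian commutative ring and let $X$ be an affine scheme which is smooth over $K$. Write $X^2 = X\times_K X$, let $\Delta : X \to X^2$ be the diagonal, let $\mathcal I = \ker(\mathcal O_{X^2}\to\Delta_*\mathcal O_X)$, let $\Omega^1_{X/K} = \Delta^*\mathcal I$ (that is, $\mathcal I/\mathcal I^2$), and let $\mathcal T_X = \mathcal Hom_{\mathcal O_X}(\Omega^1_{X/K},\mathcal O_X)$. Regard $\mathcal O_X$-modules as $\mathcal O_{X^2}$-modules by means of $\Delta_*$, and write $\bigoplus_q(\bigwedge^q_{\mathcal O_X}\mathcal T_X)[-q]$ for the complex with zero differential and with $\bigwedge^q_{\mathcal O_X}\mathcal T_X$ in degree $q$. Then, with no restriction on the characteristic, there is a canonical isomorphism $$\mathrm R\mathcal Hom_{\mathcal O_{X^2}}(\mathcal O_X,\mathcal O_X)\;\cong\;\bigoplus_q\Bigl(\textstyle\bigwedge^q_{\mathcal O_X}\mathcal T_X\Bigr)[-q]\qquad\text{in } \mathsf D(\mathsf{Mod}\,\mathcal O_{X^2}).$$ Here "canonical" has the following meaning. A global section $v$ of $\mathcal T_X$ is the same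 as an $\mathcal O_{X^2}$-linear morphism $\mathcal I\to\Delta_*\mathcal O_X$; let $\mathrm{at}(v)\in\mathrm{Ext}^1_{\mathcal O_{X^2}}(\Delta_*\mathcal O_X,\Delta_*\mathcal O_X)$ be the image under this morphism of the class of the extension $0\to\mathcal I\to\mathcal O_{X^2}\to\Delta_*\mathcal O_X\to 0$. Call a morphism $\Theta:\bigoplus_q\Delta_*(\bigwedge^q\mathcal T_X)[-q]\to\Delta_*\mathcal O_X$ in $\mathsf D(\mathsf{Mod}\,\mathcal O_{X^2})$ an HKR morphism if for all $q\ge 0$ and all $v_1,\dots,v_q\in\Gamma(X,\mathcal T_X)$ the component of $\Theta$ in $\mathrm{Ext}^q_{\mathcal O_{X^2}}(\Delta_*\bigwedge^q\mathcal T_X,\Delta_*\mathcal O_X)$ restricts along $v_1\wedge\dots\wedge v_q:\mathcal O_X\to\bigwedge^q\mathcal T_X$ to the Yoneda product of $\mathrm{at}(v_1),\dots,\mathrm{at}(v_q)$ (in this order, the arrow $\mathrm{at}(v_1)$ being applied first). Then there is exactly one isomorphism as above whose inverse is a composition $$\bigoplus_q\Delta_*\bigl(\textstyle\bigwedge^q\mathcal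 T_X\bigr)[-q]\longrightarrow \mathrm R\mathcal Hom_{\mathcal O_{X^2}}\Bigl(\Delta_*\mathcal O_X,\bigoplus_q\Delta_*\bigl(\textstyle\bigwedge^q\mathcal T_X\bigr)[-q]\Bigr)\xrightarrow{\ \Theta\ }\mathrm R\mathcal Hom_{\mathcal O_{X^2}}(\Delta_*\mathcal O_X,\Delta_*\mathcal O_X)$$ with $\Theta$ an HKR morphism, where the first arrow is induced by multiplication, $n\mapsto(a\mapsto a n)$. In particular, on the cohomology sheaf in degree $q$ this inverse is the map $\bigwedge^q\mathcal T_X\to\mathcal Ext^q_{\mathcal O_{X^2}}(\mathcal O_X,\mathcal O_X)$ that sends $v_1\wedge\dots\wedge v_q$ to the Yoneda product of the classes attached to the $v_i$ (up to a sign that depends only on $q$ and on the sign conventions for shifts). -/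

import Mathlib

open CategoryTheory Limits AlgebraicGeometry TopologicalSpace

open scoped ZeroObject

universe u w

namespace AlgebraicGeometry.Scheme.Modules

noncomputable section

section Grothendieck

theorem hasExactColimitsOfShape (X : Scheme.{u}) (J : Type u) [SmallCategory J] [IsFiltered J] :
    HasExactColimitsOfShape J X.Modules := by
  have : HasExactColimitsOfShape J X.PresheafOfModules :=
    HasExactColimitsOfShape.domain_of_functor J
      (PresheafOfModules.toPresheaf.{u} X.ringCatSheaf.obj)
  exact (PresheafOfModules.sheafificationAdjunction.{u}
    (𝟙 X.ringCatSheaf.obj)).hasExactColimitsOfShape J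

theorem hasSeparator (X : Scheme.{u}) : HasSeparator X.Modules := by
  let adj := PresheafOfModules.sheafificationAdjunction.{u} (𝟙 X.ringCatSheaf.obj)
  let f : X.Opens → X.Modules := fun U =>
    (PresheafOfModules.sheafification (𝟙 X.ringCatSheaf.obj)).obj
      ((PresheafOfModules.free X.ringCatSheaf.obj).obj (yoneda.obj U))
  have hf : ObjectProperty.IsSeparating (.ofObj f) := by
    intro M N g h hgh
    apply (SheafOfModules.forget X.ringCatSheaf).map_injective
    apply PresheafOfModules.freeYoneda.isSeparating X.ringCatSheaf.obj
    rintro _ ⟨U⟩ k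
    have h1 := hgh _ (ObjectProperty.ofObj_apply f U) ((adj.homEquiv _ _).symm k)
    have h2 := congrArg (adj.homEquiv _ _) h1
    have e1 := adj.homEquiv_naturality_right ((adj.homEquiv _ _).symm k) g
    have e2 := adj.homEquiv_naturality_right ((adj.homEquiv _ _).symm k) h
    erw [Equiv.apply_symm_apply] at e1 e2
    exact e1.symm.trans (h2.trans e2)
  exact ⟨⟨_, hf.isSeparator_coproduct⟩⟩

instance isGrothendieckAbelian (X : Scheme.{u}) : IsGrothendieckAbelian.{u} X.Modules where
  ab5OfSize := ⟨fun J _ _ => hasExactColimitsOfShape X J⟩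
  hasSeparator := hasSeparator X

end Grothendieck

section SheafHom

variable {X : Scheme.{u}}

/-- Sections over `U` of the sheaf `ℋom(M, N)`: morphisms of `𝒪_U`-modules `M|_U ⟶ N|_U`, i.e.
families of `𝒪(V)`-linear maps `M(V) → N(V)` for `V ⊆ U` commuting with restriction. -/
def sheafHomSections (M N : X.Modules) (U : X.Opens) :
    AddSubgroup (∀ V : {V : X.Opens // V ≤ U}, Γ(M, V.1) →ₗ[Γ(X, V.1)] Γ(N, V.1)) where
  carrier := {φ | ∀ (V W : {V : X.Opens // V ≤ U}) (h : W.1 ≤ V.1) (m : Γ(M, V.1)),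
    φ W (M.presheaf.map (homOfLE h).op m) = N.presheaf.map (homOfLE h).op (φ V m)}
  add_mem' {a b} ha hb V W h m := by
    simp only [Pi.add_apply, LinearMap.add_apply, ha V W h, hb V W h, map_add]
  zero_mem' V W h m := by simp
  neg_mem' {a} ha V W h m := by
    simp only [Pi.neg_apply, LinearMap.neg_apply, ha V W h, map_neg]

variable {M N : X.Modules}

@[ext]
theorem sheafHomSections_ext {U : X.Opens} {φ ψ : sheafHomSections M N U}
    (h : ∀ V m, φ.1 V m = ψ.1 V m) : φ = ψ :=
  Subtype.ext (funext fun V => LinearMap.ext (h V))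

/-- `(r • φ)_V = r|_V • φ_V`. -/
instance (U : X.Opens) : SMul Γ(X, U) (sheafHomSections M N U) where
  smul r φ := ⟨fun V => X.presheaf.map (homOfLE V.2).op r • φ.1 V, fun V W h m => by
    simp only [LinearMap.smul_apply]
    rw [φ.2 V W h m, map_smul, ← CommRingCat.comp_apply, ← Functor.map_comp]
    rfl⟩

theorem sheafHomSections_smul_apply {U : X.Opens} (r : Γ(X, U)) (φ : sheafHomSections M N U)
    (V : {V : X.Opens // V ≤ U}) (m : Γ(M, V.1)) :
    (r • φ).1 V m = X.presheaf.map (homOfLE V.2).op r • φ.1 V m := rfl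

theorem sheafHomSections_add_apply {U : X.Opens} (φ ψ : sheafHomSections M N U)
    (V : {V : X.Opens // V ≤ U}) (m : Γ(M, V.1)) :
    (φ + ψ).1 V m = φ.1 V m + ψ.1 V m := rfl

instance (U : X.Opens) : Module Γ(X, U) (sheafHomSections M N U) where
  one_smul φ := by ext V m; simp [sheafHomSections_smul_apply]
  mul_smul r s φ := by ext V m; simp [sheafHomSections_smul_apply, mul_smul]
  smul_zero r := by ext V m; rw [sheafHomSections_smul_apply]; exact smul_zero _
  smul_add r φ ψ := by
    ext V m
    simp only [sheafHomSections_smul_apply, sheafHomSections_add_apply, smul_add]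
  add_smul r s φ := by
    ext V m
    simp only [sheafHomSections_smul_apply, sheafHomSections_add_apply, map_add, add_smul]
  zero_smul φ := by
    ext V m
    rw [sheafHomSections_smul_apply, map_zero, zero_smul]; rfl

/-- Restriction of sections of `ℋom(M, N)`. -/
def sheafHomRestrict (M N : X.Modules) {U V : X.Opens} (h : V ≤ U) :
    sheafHomSections M N U →+ sheafHomSections M N V where
  toFun φ := ⟨fun W => φ.1 ⟨W.1, W.2.trans h⟩, fun W W' hW m => φ.2 ⟨W.1, _⟩ ⟨W'.1, _⟩ hW m⟩
  map_zero' := rfl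
  map_add' _ _ := rfl

/-- The presheaf of abelian groups underlying `ℋom(M, N)`. -/
def sheafHomPresheaf (M N : X.Modules) : TopCat.Presheaf Ab.{u} X where
  obj U := AddCommGrpCat.of (sheafHomSections M N U.unop)
  map i := AddCommGrpCat.ofHom (sheafHomRestrict M N i.unop.le)

theorem presheaf_map_map (M : X.Modules) {U V W : X.Opens} (h : W ≤ V) (h' : V ≤ U) (m : Γ(M, U)) :
    M.presheaf.map (homOfLE h).op (M.presheaf.map (homOfLE h').op m) =
      M.presheaf.map (homOfLE (h.trans h')).op m := by
  rw [← AddCommGrpCat.comp_apply, ← Functor.map_comp]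
  rfl

theorem sheafHomPresheaf_isSheaf (M N : X.Modules) : (sheafHomPresheaf M N).IsSheaf := by
  rw [TopCat.Presheaf.isSheaf_iff_isSheafUniqueGluing]
  intro ι U sf hsf
  replace hsf : ∀ i j (W : X.Opens) (hi : W ≤ U i) (hj : W ≤ U j) (m : Γ(M, W)),
      Subtype.val (sf i) ⟨W, hi⟩ m = Subtype.val (sf j) ⟨W, hj⟩ m := fun i j W hi hj m =>
    congrArg (fun (φ : sheafHomSections M N (U i ⊓ U j)) => φ.1 ⟨W, le_inf hi hj⟩ m) (hsf i j)
  have hN : ∀ (V : X.Opens) (_ : V ≤ iSup U) (s t : Γ(N, V)),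
      (∀ i, N.presheaf.map (homOfLE (inf_le_left : V ⊓ U i ≤ V)).op s =
        N.presheaf.map (homOfLE (inf_le_left : V ⊓ U i ≤ V)).op t) → s = t := by
    intro V hV s t hst
    refine TopCat.Sheaf.eq_of_locally_eq' ⟨_, N.isSheaf⟩ (fun i => V ⊓ U i) V
      (fun i => homOfLE inf_le_left) ?_ s t hst
    rw [← inf_iSup_eq]; exact le_inf le_rfl hV
  have hglue : ∀ (V : X.Opens) (_ : V ≤ iSup U) (m : Γ(M, V)),
      ∃ s : Γ(N, V), ∀ i, N.presheaf.map (homOfLE (inf_le_left : V ⊓ U i ≤ V)).op s =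
        Subtype.val (sf i) ⟨V ⊓ U i, inf_le_right⟩
          (M.presheaf.map (homOfLE (inf_le_left : V ⊓ U i ≤ V)).op m) := by
    intro V hV m
    obtain ⟨s, hs, -⟩ := TopCat.Sheaf.existsUnique_gluing' ⟨_, N.isSheaf⟩ (fun i => V ⊓ U i) V
      (fun i => homOfLE inf_le_left) (by rw [← inf_iSup_eq]; exact le_inf le_rfl hV)
      (fun i => Subtype.val (sf i) ⟨V ⊓ U i, inf_le_right⟩
          (M.presheaf.map (homOfLE (inf_le_left : V ⊓ U i ≤ V)).op m)) (by
        intro i j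
        have h1 := (sf i).2 ⟨V ⊓ U i, inf_le_right⟩ ⟨(V ⊓ U i) ⊓ (V ⊓ U j),
          inf_le_left.trans inf_le_right⟩ inf_le_left
          (M.presheaf.map (homOfLE (inf_le_left : V ⊓ U i ≤ V)).op m)
        have h2 := (sf j).2 ⟨V ⊓ U j, inf_le_right⟩ ⟨(V ⊓ U i) ⊓ (V ⊓ U j),
          inf_le_right.trans inf_le_right⟩ inf_le_right
          (M.presheaf.map (homOfLE (inf_le_left : V ⊓ U j ≤ V)).op m)
        refine h1.symm.trans (Eq.trans ?_ h2)
        rw [presheaf_map_map, presheaf_map_map]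
        exact hsf _ _ _ _ _ _)
    exact ⟨s, hs⟩
  choose g hg using hglue
  refine ⟨⟨fun V =>
    { toFun := g V.1 V.2
      map_add' := fun a b => hN _ V.2 _ _ fun i => by
        rw [map_add, hg, hg, hg, map_add, map_add]
      map_smul' := fun r a => hN _ V.2 _ _ fun i => by
        rw [RingHom.id_apply, Modules.map_smul, hg, hg, Modules.map_smul, _root_.map_smul] }, ?_⟩,
    ?_, ?_⟩
  · intro V W h m
    refine hN _ W.2 _ _ fun i => ?_
    change N.presheaf.map (homOfLE _).op (g W.1 W.2 _) =
      N.presheaf.map (homOfLE _).op (N.presheaf.map (homOfLE _).op (g V.1 V.2 m))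
    rw [hg, presheaf_map_map, presheaf_map_map,
      ← presheaf_map_map N (inf_le_inf_right (U i) h) inf_le_left, hg,
      ← presheaf_map_map M (inf_le_inf_right (U i) h) inf_le_left]
    exact (sf i).2 ⟨V.1 ⊓ U i, inf_le_right⟩ ⟨W.1 ⊓ U i, inf_le_right⟩ (inf_le_inf_right (U i) h) _
  · intro i
    refine sheafHomSections_ext fun V m => ?_
    change g V.1 (V.2.trans (le_iSup U i)) m = Subtype.val (sf i) V m
    refine hN _ (V.2.trans (le_iSup U i)) _ _ fun j => ?_
    rw [hg, hsf j i _ _ (inf_le_left.trans V.2)]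
    exact (sf i).2 V ⟨V.1 ⊓ U j, inf_le_left.trans V.2⟩ inf_le_left m
  · intro φ hφ
    refine sheafHomSections_ext fun V m => ?_
    change Subtype.val φ V m = g V.1 V.2 m
    refine hN _ V.2 _ _ fun j => ?_
    have h1 := φ.2 V ⟨V.1 ⊓ U j, inf_le_left.trans V.2⟩ inf_le_left m
    rw [hg, ← hφ j]
    exact h1.symm

/-- The sheaf `ℋom_{𝒪_X}(M, N)` of `𝒪_X`-linear morphisms. -/
def sheafHomObj (M N : X.Modules) : X.Modules where
  val :=
    letI : ∀ U : X.Opensᵒᵖ, Module (X.ringCatSheaf.obj.obj U) ((sheafHomPresheaf M N).obj U) :=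
      fun U => inferInstanceAs (Module Γ(X, U.unop) (sheafHomSections M N U.unop))
    PresheafOfModules.ofPresheaf (sheafHomPresheaf M N) (by
      intro U V i r φ
      refine sheafHomSections_ext fun W m => ?_
      have e : ∀ r : Γ(X, U.unop), X.presheaf.map (homOfLE (W.2.trans i.unop.le)).op r =
          X.presheaf.map (homOfLE W.2).op (X.presheaf.map i r) := fun r => by
        rw [← CommRingCat.comp_apply, ← Functor.map_comp]
        rfl
      exact congrArg (fun t : Γ(X, W.1) =>
        t • Subtype.val φ ⟨W.1, W.2.trans i.unop.le⟩ m) (e r))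
  isSheaf := sheafHomPresheaf_isSheaf M N

/-- The functor `N ↦ ℋom_{𝒪_X}(M, N)`. -/
def sheafHom (M : X.Modules) : X.Modules ⥤ X.Modules where
  obj N := sheafHomObj M N
  map {N N'} f := ⟨PresheafOfModules.homMk
    { app := fun U => AddCommGrpCat.ofHom
        (X := sheafHomSections M N U.unop) (Y := sheafHomSections M N' U.unop)
        { toFun := fun φ => ⟨fun V =>
            { toFun := fun m => f.app V.1 (φ.1 V m)
              map_add' := fun a b => by rw [map_add, map_add]
              map_smul' := fun r a => by
                rw [_root_.map_smul, Hom.app_smul]; rfl }, fun V W h m => by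
            change f.app W.1 (φ.1 W _) = N'.presheaf.map _ (f.app V.1 (φ.1 V m))
            rw [φ.2 V W h m]
            exact ConcreteCategory.congr_hom (f.mapPresheaf.naturality (homOfLE h).op) (φ.1 V m)⟩
          map_zero' := sheafHomSections_ext fun V m => map_zero (f.app V.1).hom
          map_add' := fun φ ψ => sheafHomSections_ext fun V m =>
            map_add (f.app V.1).hom _ _ }
      naturality := fun U V i => rfl }
    (fun U r φ => sheafHomSections_ext fun V m =>
      Hom.app_smul f (X.presheaf.map (homOfLE V.2).op r) (Subtype.val φ V m))⟩
  map_id N := rfl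
  map_comp f g := rfl

instance (M : X.Modules) : (sheafHom M).Additive where
  map_add := rfl

end SheafHom

section Sections

variable {X Y : Scheme.{u}}

/-- The structure sheaf `𝒪_X` as an `𝒪_X`-module. -/
abbrev structureSheaf (X : Scheme.{u}) : X.Modules := SheafOfModules.unit X.ringCatSheaf

/-- The morphism `𝒪_X ⟶ M` sending `1` to a given global section of `M`. -/
def homOfSection {M : X.Modules} (s : Γ(M, ⊤)) : structureSheaf X ⟶ M :=
  (SheafOfModules.unitHomEquiv (R := X.ringCatSheaf) M).symm
    (PresheafOfModules.sectionsMk (M := M.val)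
      (fun U => M.presheaf.map (homOfLE (le_top : U.unop ≤ ⊤)).op s)
      (fun _ _ i => presheaf_map_map M i.unop.le le_top s))

theorem homOfSection_app {M : X.Modules} (s : Γ(M, ⊤)) (U : X.Opens) (a : Γ(X, U)) :
    (homOfSection s).app U a = a • M.presheaf.map (homOfLE (le_top : U ≤ ⊤)).op s := rfl

/-- The morphism of `𝒪_X`-modules `M ⟶ N` given by a global section of `ℋom(M, N)`. -/
def homOfSheafHomSection {M N : X.Modules} (φ : Γ((sheafHom M).obj N, ⊤)) : M ⟶ N :=
  letI φ' : sheafHomSections M N ⊤ := φ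
  ⟨PresheafOfModules.homMk (M₁ := M.val) (M₂ := N.val)
    { app := fun U => AddCommGrpCat.ofHom (φ'.1 ⟨U.unop, le_top⟩).toAddMonoidHom
      naturality := fun U V i => by
        ext m
        exact φ'.2 ⟨U.unop, le_top⟩ ⟨V.unop, le_top⟩ i.unop.le m }
    (fun U r m => (φ'.1 ⟨U.unop, le_top⟩).map_smul r m)⟩

/-- The canonical morphism `𝒪_Y ⟶ f_* 𝒪_X`. -/
def toPushforward (f : X ⟶ Y) : structureSheaf Y ⟶ (pushforward f).obj (structureSheaf X) :=
  SheafOfModules.unitToPushforwardObjUnit f.toRingCatSheafHom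

/-- Multiplication `a ↦ a • n|_V` by the restriction of a section `n` of `N` over `f⁻¹ U`. -/
def smulRestrict (f : X ⟶ Y) (N : X.Modules) {U V : Y.Opens} (h : V ≤ U) (n : Γ(N, f ⁻¹ᵁ U)) :
    Γ(X, f ⁻¹ᵁ V) →ₗ[Γ(X, f ⁻¹ᵁ V)] Γ(N, f ⁻¹ᵁ V) :=
  LinearMap.toSpanSingleton _ _ (N.presheaf.map (homOfLE (f.preimage_mono h)).op n)

theorem smulRestrict_apply (f : X ⟶ Y) (N : X.Modules) {U V : Y.Opens} (h : V ≤ U)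
    (n : Γ(N, f ⁻¹ᵁ U)) (a : Γ(X, f ⁻¹ᵁ V)) :
    smulRestrict f N h n a = a • N.presheaf.map (homOfLE (f.preimage_mono h)).op n := rfl

theorem smulRestrict_zero (f : X ⟶ Y) (N : X.Modules) {U V : Y.Opens} (h : V ≤ U) :
    smulRestrict f N h 0 = 0 := by
  ext; simp [smulRestrict_apply]

theorem smulRestrict_add (f : X ⟶ Y) (N : X.Modules) {U V : Y.Opens} (h : V ≤ U)
    (m n : Γ(N, f ⁻¹ᵁ U)) :
    smulRestrict f N h (m + n) = smulRestrict f N h m + smulRestrict f N h n := by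
  ext; simp [smulRestrict_apply]

theorem smulRestrict_smul (f : X ⟶ Y) (N : X.Modules) {U V : Y.Opens} (h : V ≤ U)
    (r : Γ(Y, U)) (n : Γ(N, f ⁻¹ᵁ U)) (a : Γ(X, f ⁻¹ᵁ V)) :
    smulRestrict f N h (f.app U r • n) a =
      f.app V (Y.presheaf.map (homOfLE h).op r) • smulRestrict f N h n a := by
  rw [smulRestrict_apply, smulRestrict_apply, Modules.map_smul, smul_comm]
  congr 1
  exact (ConcreteCategory.congr_hom (f.naturality (homOfLE h).op) r).symm

theorem smulRestrict_hom (f : X ⟶ Y) {N N' : X.Modules} (g : N ⟶ N') {U V : Y.Opens} (h : V ≤ U)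
    (n : Γ(N, f ⁻¹ᵁ U)) (a : Γ(X, f ⁻¹ᵁ V)) :
    smulRestrict f N' h (g.app _ n) a = g.app _ (smulRestrict f N h n a) := by
  rw [smulRestrict_apply, smulRestrict_apply, Hom.app_smul]
  congr 1
  exact (ConcreteCategory.congr_hom
    (g.mapPresheaf.naturality (homOfLE (f.preimage_mono h)).op) n).symm

/-- The map `Γ(U, f_* N) → Γ(U, ℋom(f_* 𝒪_X, f_* N))`, `n ↦ (a ↦ a • n)`. -/
def pushforwardToSheafHomSections (f : X ⟶ Y) (N : X.Modules) (U : Y.Opens) :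
    Γ(N, f ⁻¹ᵁ U) →+ sheafHomSections ((pushforward f).obj (structureSheaf X))
      ((pushforward f).obj N) U where
  toFun n := ⟨fun V =>
    { toFun := smulRestrict f N V.2 n
      map_add' := (smulRestrict f N V.2 n).map_add
      map_smul' := fun r => (smulRestrict f N V.2 n).map_smul (f.app V.1 r) },
    fun V W h a => by
      refine Eq.trans ?_ (Modules.map_smul N (homOfLE (f.preimage_mono h))
        (show Γ(X, f ⁻¹ᵁ V.1) from a) _).symm
      exact congrArg (fun t => X.presheaf.map (homOfLE (f.preimage_mono h)).op
        (show Γ(X, f ⁻¹ᵁ V.1) from a) • t)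
        (presheaf_map_map N (f.preimage_mono h) (f.preimage_mono V.2) n).symm⟩
  map_zero' := sheafHomSections_ext fun V a => by
    exact LinearMap.congr_fun (smulRestrict_zero f N V.2) a
  map_add' m n := sheafHomSections_ext fun V a => by
    exact LinearMap.congr_fun (smulRestrict_add f N V.2 m n) a

/-- The canonical morphism `f_* N ⟶ ℋom_{𝒪_Y}(f_* 𝒪_X, f_* N)`, sending a section `n` to the
morphism `a ↦ a • n`. -/
def pushforwardToSheafHom (f : X ⟶ Y) :
    pushforward f ⟶ pushforward f ⋙ sheafHom ((pushforward f).obj (structureSheaf X)) where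
  app N := ⟨PresheafOfModules.homMk (M₁ := ((pushforward f).obj N).val)
    (M₂ := ((sheafHom ((pushforward f).obj (structureSheaf X))).obj ((pushforward f).obj N)).val)
    { app := fun U => AddCommGrpCat.ofHom (pushforwardToSheafHomSections f N U.unop)
      naturality := fun U V i => by
        ext n
        refine sheafHomSections_ext fun W a => ?_
        exact congrArg (fun t => (show Γ(X, f ⁻¹ᵁ W.1) from a) • t)
          (presheaf_map_map N (f.preimage_mono W.2) (f.preimage_mono i.unop.le) n) }
    (fun U r n => sheafHomSections_ext fun V a => smulRestrict_smul f N V.2 r n a)⟩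
  naturality N N' g := by
    ext U n
    exact sheafHomSections_ext fun V a => smulRestrict_hom f g V.2 n a

end Sections

section ExteriorPower

variable {R S : Type u} [CommRing R] [CommRing S] {M N : Type u} [AddCommGroup M] [AddCommGroup N]
  [Module R M] [Module S N] (σ : R →+* S) (g : M →ₛₗ[σ] N)

/-- The semilinear map `⋀^q M → ⋀^q N`, `m₁ ∧ ⋯ ∧ m_q ↦ g m₁ ∧ ⋯ ∧ g m_q`, induced by a
semilinear map `g : M → N`. -/
def exteriorPowerMap (q : ℕ) : ⋀[R]^q M →ₛₗ[σ] ⋀[S]^q N :=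
  letI : Module R (⋀[S]^q N) := Module.compHom _ σ
  let φ : M [⋀^Fin q]→ₗ[R] ⋀[S]^q N :=
    { toFun := fun m => _root_.exteriorPower.ιMulti S q (g ∘ m)
      map_update_add' := fun m i x y => by
        simp only [Function.comp_update, map_add, AlternatingMap.map_update_add]
      map_update_smul' := fun m i r x => by
        simp only [Function.comp_update, LinearMap.map_smulₛₗ, AlternatingMap.map_update_smul]
        rfl
      map_eq_zero_of_eq' := fun m i j h hij =>
        (_root_.exteriorPower.ιMulti S q).map_eq_zero_of_eq _ (congrArg g h) hij }
  let ψ : ⋀[R]^q M →ₗ[R] ⋀[S]^q N := _root_.exteriorPower.alternatingMapLinearEquiv φ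
  { toFun := ψ, map_add' := map_add ψ, map_smul' := ψ.map_smul }

theorem exteriorPowerMap_ιMulti (q : ℕ) (m : Fin q → M) :
    exteriorPowerMap σ g q (_root_.exteriorPower.ιMulti R q m) =
      _root_.exteriorPower.ιMulti S q (g ∘ m) := by
  let : Module R (⋀[S]^q N) := Module.compHom _ σ
  exact _root_.exteriorPower.alternatingMapLinearEquiv_apply_ιMulti _ _

theorem exteriorPower_addHom_ext {q : ℕ} {P : Type u} [AddCommGroup P]
    (φ ψ : ⋀[R]^q M →+ P)
    (h : ∀ m, φ (_root_.exteriorPower.ιMulti R q m) = ψ (_root_.exteriorPower.ιMulti R q m))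
    (h' : ∀ (r : R) x, φ x = ψ x → φ (r • x) = ψ (r • x)) : φ = ψ := by
  ext1 x
  have hx : x ∈ Submodule.span R (Set.range (_root_.exteriorPower.ιMulti R q (M := M))) := by
    rw [_root_.exteriorPower.ιMulti_span]; trivial
  induction hx using Submodule.span_induction with
  | mem x hx => obtain ⟨m, rfl⟩ := hx; exact h m
  | zero => simp
  | add x y _ _ hx hy => simp [hx, hy]
  | smul a x _ hx => exact h' a x hx

end ExteriorPower

section ExteriorPowerSheaf
variable {X : Scheme.{u}}

/-- Restriction maps of a sheaf of modules, as semilinear maps. -/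
def restrictionMap (M : X.Modules) {U V : X.Opens} (i : V ⟶ U) :
    Γ(M, U) →ₛₗ[(X.presheaf.map i.op).hom] Γ(M, V) where
  toFun m := M.presheaf.map i.op m
  map_add' := map_add _
  map_smul' r m := Modules.map_smul M i r m

/-- Restriction on exterior powers of sections. -/
def exteriorPowerRestrict (M : X.Modules) (q : ℕ) {U V : X.Opens} (i : V ⟶ U) :
    ⋀[Γ(X, U)]^q Γ(M, U) →ₛₗ[(X.presheaf.map i.op).hom] ⋀[Γ(X, V)]^q Γ(M, V) :=
  exteriorPowerMap _ (restrictionMap M i) q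

/-- The presheaf of abelian groups `U ↦ ⋀^q_{𝒪(U)} M(U)`. -/
def exteriorPowerAbPresheaf (M : X.Modules) (q : ℕ) : X.Opensᵒᵖ ⥤ Ab.{u} where
  obj U := AddCommGrpCat.of (⋀[Γ(X, U.unop)]^q Γ(M, U.unop))
  map i := AddCommGrpCat.ofHom (exteriorPowerRestrict M q i.unop).toAddMonoidHom
  map_id U := by
    ext1
    refine exteriorPower_addHom_ext _ _ (fun m => ?_) (fun r x h => ?_)
    · refine (exteriorPowerMap_ιMulti _ _ _ _).trans (congrArg _ (funext fun j => ?_))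
      exact ConcreteCategory.congr_hom (M.presheaf.map_id U) (m j)
    · refine ((exteriorPowerRestrict M q (𝟙 U.unop)).map_smulₛₗ r x).trans ?_
      refine congrArg₂ (fun (a : Γ(X, U.unop)) (b : ⋀[Γ(X, U.unop)]^q Γ(M, U.unop)) => a • b) ?_ h
      exact ConcreteCategory.congr_hom (X.presheaf.map_id U) r
  map_comp {U V W} i j := by
    ext1
    refine exteriorPower_addHom_ext _ _ (fun m => ?_) (fun r x h => ?_)
    · refine (exteriorPowerMap_ιMulti _ _ _ _).trans ?_
      refine Eq.trans ?_ (congrArg (exteriorPowerRestrict M q j.unop)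
        (exteriorPowerMap_ιMulti _ (restrictionMap M i.unop) q m)).symm
      refine Eq.trans (congrArg _ (funext fun k => ?_)) (exteriorPowerMap_ιMulti _ _ _ _).symm
      exact ConcreteCategory.congr_hom (M.presheaf.map_comp i j) (m k)
    · refine ((exteriorPowerRestrict M q (j.unop ≫ i.unop)).map_smulₛₗ r x).trans ?_
      refine Eq.trans ?_ (congrArg (exteriorPowerRestrict M q j.unop)
        ((exteriorPowerRestrict M q i.unop).map_smulₛₗ r x)).symm
      refine Eq.trans ?_ ((exteriorPowerRestrict M q j.unop).map_smulₛₗ _ _).symm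
      refine congrArg₂ (fun (a : Γ(X, W.unop)) (b : ⋀[Γ(X, W.unop)]^q Γ(M, W.unop)) => a • b) ?_ h
      exact ConcreteCategory.congr_hom (X.presheaf.map_comp i j) r

instance (M : X.Modules) (q : ℕ) (U : X.Opensᵒᵖ) :
    Module (X.ringCatSheaf.obj.obj U) ((exteriorPowerAbPresheaf M q).obj U) :=
  inferInstanceAs (Module Γ(X, U.unop) (⋀[Γ(X, U.unop)]^q Γ(M, U.unop)))

/-- The presheaf of modules `U ↦ ⋀^q_{𝒪(U)} M(U)`. -/
def exteriorPowerPresheaf (M : X.Modules) (q : ℕ) : X.PresheafOfModules :=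
  PresheafOfModules.ofPresheaf (exteriorPowerAbPresheaf M q)
    (fun _ _ i r m => (exteriorPowerRestrict M q i.unop).map_smulₛₗ r m)

/-- The exterior power `⋀^q_{𝒪_X} M`: the sheaf associated to `U ↦ ⋀^q_{𝒪(U)} M(U)`. -/
def exteriorPower (M : X.Modules) (q : ℕ) : X.Modules :=
  (PresheafOfModules.sheafification (𝟙 X.ringCatSheaf.obj)).obj (exteriorPowerPresheaf M q)

/-- The global section `s₁ ∧ ⋯ ∧ s_q` of `⋀^q M`. -/
def wedge (M : X.Modules) {q : ℕ} (s : Fin q → Γ(M, ⊤)) : Γ(exteriorPower M q, ⊤) :=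
  ((PresheafOfModules.sheafificationAdjunction (𝟙 X.ringCatSheaf.obj)).unit.app
    (exteriorPowerPresheaf M q)).app (.op ⊤) (_root_.exteriorPower.ιMulti Γ(X, ⊤) q s)

end ExteriorPowerSheaf

section Diagonal
variable {X Y : Scheme.{u}}

/-- The ideal sheaf of a morphism `i : X ⟶ Y`, the kernel of `𝒪_Y ⟶ i_* 𝒪_X`. -/
def idealSheaf (i : X ⟶ Y) : Y.Modules := kernel (toPushforward i)

/-- The sequence `0 ⟶ I ⟶ 𝒪_Y ⟶ i_* 𝒪_X ⟶ 0`. -/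
def idealSequence (i : X ⟶ Y) : ShortComplex Y.Modules :=
  ShortComplex.mk (kernel.ι (toPushforward i)) (toPushforward i) (kernel.condition _)

instance epi_toPushforward (i : X ⟶ Y) [IsClosedImmersion i] : Epi (toPushforward i) where
  left_cancellation {N} g h e := by
    ext U s
    refine TopCat.Sheaf.eq_of_locally_eq' ⟨_, N.isSheaf⟩
      (fun V : {V : Y.affineOpens // V.1 ≤ U} => V.1.1) U (fun V => homOfLE V.2) ?_ _ _ fun V => ?_
    · intro x hx
      obtain ⟨V, hV, hxV, hVU⟩ := (Opens.isBasis_iff_nbhd.mp Y.isBasis_affineOpens) hx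
      exact Opens.mem_iSup.mpr ⟨⟨⟨V, hV⟩, hVU⟩, hxV⟩
    · obtain ⟨t, ht⟩ := i.app_surjective V.1.1 V.1.2
        (X.presheaf.map (homOfLE (i.preimage_mono V.2)).op s)
      have hg := ConcreteCategory.congr_hom (g.mapPresheaf.naturality (homOfLE V.2).op) s
      have hh := ConcreteCategory.congr_hom (h.mapPresheaf.naturality (homOfLE V.2).op) s
      refine hg.symm.trans (Eq.trans ?_ hh)
      have e' : g.app V.1.1 (i.app V.1.1 t) = h.app V.1.1 (i.app V.1.1 t) :=
        congrArg (fun k : structureSheaf Y ⟶ N => k.app V.1.1 t) e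
      rw [ht] at e'
      exact e'

theorem idealSequence_shortExact (i : X ⟶ Y) [IsClosedImmersion i] :
    (idealSequence i).ShortExact where
  exact := ShortComplex.exact_kernel _
  mono_f := by unfold idealSequence; dsimp only; infer_instance
  epi_g := epi_toPushforward i

end Diagonal

section Tangent
variable {X Y S : Scheme.{u}}

/-- The conormal sheaf `i^* I` (which is `I / I²` when `i` is a closed immersion with ideal sheaf
`I`). -/
def conormalSheaf (i : X ⟶ Y) : X.Modules := (pullback i).obj (idealSheaf i)

/-- The normal sheaf `ℋom_{𝒪_X}(i^* I, 𝒪_X)`. -/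
abbrev normalSheaf (i : X ⟶ Y) : X.Modules := (sheafHom (conormalSheaf i)).obj (structureSheaf X)

/-- The sheaf of differentials `Ω¹_{X/S}`: the conormal sheaf of the diagonal `X ⟶ X ×_S X`. -/
abbrev cotangentSheaf (f : X ⟶ S) : X.Modules := conormalSheaf (Limits.pullback.diagonal f)

/-- The tangent sheaf `T_{X/S} = ℋom_{𝒪_X}(Ω¹_{X/S}, 𝒪_X)`. -/
abbrev tangentSheaf (f : X ⟶ S) : X.Modules := (sheafHom (cotangentSheaf f)).obj (structureSheaf X)

/-- The morphism `I ⟶ i_* 𝒪_X` adjoint to the morphism `i^* I ⟶ 𝒪_X` given by a global section of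
`ℋom(i^* I, 𝒪_X)`. -/
def idealToPushforward (i : X ⟶ Y) (v : Γ(normalSheaf i, ⊤)) :
    idealSheaf i ⟶ (pushforward i).obj (structureSheaf X) :=
  (pullbackPushforwardAdjunction i).homEquiv _ _ (homOfSheafHomSection v)

/-- The graded `𝒪_X`-module `⨁_q (⋀^q M)[-q]`, as a complex with zero differential which has
`⋀^q M` in degree `q`. -/
def exteriorComplex (M : X.Modules) : CochainComplex.Plus X.Modules where
  obj :=
    { X := fun
        | Int.ofNat q => exteriorPower M q
        | Int.negSucc _ => 0
      d := fun _ _ => 0 }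
  property := ⟨0, by
    rw [CochainComplex.isStrictlyGE_iff]
    rintro (q | q) h
    · exact absurd h (by simp)
    · exact isZero_zero _⟩

end Tangent

section Derived
variable {X Y S : Scheme.{u}} (i : X ⟶ Y)

/-- The complex `⨁_q i_* (⋀^q M)[-q]`. -/
def pushforwardExteriorComplex (M : X.Modules) : CochainComplex.Plus Y.Modules :=
  (pushforward i).mapCochainComplexPlus.obj (exteriorComplex M)

variable [HasDerivedCategory.{w} Y.Modules]

/-- `RℋHom(M, -)`, the right derived functor of `ℋom(M, -)`. -/
def RSheafHom (M : Y.Modules) : DerivedCategory.Plus Y.Modules ⥤ DerivedCategory.Plus Y.Modules :=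
  (sheafHom M).rightDerivedFunctorPlus

/-- `RℋHom(M, N)` in the derived category. -/
def RSheafHomObj (M N : Y.Modules) : DerivedCategory Y.Modules :=
  DerivedCategory.Plus.ι.obj
    ((RSheafHom M).obj ((DerivedCategory.Plus.singleFunctor Y.Modules 0).obj N))

/-- For `v₁, …, v_q ∈ Γ(X, M)`, the morphism `i_* 𝒪_X[-q] ⟶ i_* (⋀^q M)[-q] ⟶ ⨁_q i_* (⋀^q M)[-q]`
sending `1` to `v₁ ∧ ⋯ ∧ v_q`. -/
def inclusionOfWedge (M : X.Modules) {q : ℕ} (v : Fin q → Γ(M, ⊤)) :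
    (DerivedCategory.singleFunctor Y.Modules q).obj ((pushforward i).obj (structureSheaf X)) ⟶
      DerivedCategory.Plus.ι.obj (DerivedCategory.Plus.Q.obj (pushforwardExteriorComplex i M)) :=
  DerivedCategory.Q.map (HomologicalComplex.mkHomFromSingle
      (K := (pushforwardExteriorComplex i M).obj) (j := (q : ℤ))
      ((pushforward i).map (homOfSection (wedge M v))) (fun k _ => by
        change _ ≫ (pushforward i).map (0 : _ ⟶ _) = 0
        rw [Functor.map_zero, comp_zero]))

/-- For `Θ : ⨁_q i_* (⋀^q M)[-q] ⟶ i_* 𝒪_X` in the derived category, the composition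
`⨁_q i_* (⋀^q M)[-q] ⟶ RℋHom(i_* 𝒪_X, ⨁_q i_* (⋀^q M)[-q]) ⟶ RℋHom(i_* 𝒪_X, i_* 𝒪_X)`,
where the first map is given by multiplication (a section `n` goes to `a ↦ a • n`), and the
second one by `Θ`. -/
def canonicalMap (M : X.Modules)
    (Θ : DerivedCategory.Plus.Q.obj (pushforwardExteriorComplex i M) ⟶
      (DerivedCategory.Plus.singleFunctor Y.Modules 0).obj
        ((pushforward i).obj (structureSheaf X))) :
    DerivedCategory.Plus.Q.obj (pushforwardExteriorComplex i M) ⟶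
      (RSheafHom ((pushforward i).obj (structureSheaf X))).obj
        ((DerivedCategory.Plus.singleFunctor Y.Modules 0).obj
          ((pushforward i).obj (structureSheaf X))) :=
  letI F := sheafHom ((pushforward i).obj (structureSheaf X))
  DerivedCategory.Plus.Q.map
    (Y := F.mapCochainComplexPlus.obj (pushforwardExteriorComplex i M))
    ⟨(NatTrans.mapHomologicalComplex (pushforwardToSheafHom i) (ComplexShape.up ℤ)).app
      (exteriorComplex M).obj⟩ ≫
  F.rightDerivedFunctorPlusUnit.app
    ((HomotopyCategory.Plus.quotient Y.Modules).obj (pushforwardExteriorComplex i M)) ≫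
  F.rightDerivedFunctorPlus.map Θ

variable [IsClosedImmersion i]

/-- The class in `Ext¹(i_* 𝒪_X, i_* 𝒪_X)` attached to `v : i^* I ⟶ 𝒪_X`: the pushout along
`I ⟶ i_* 𝒪_X` of the extension `0 ⟶ I ⟶ 𝒪_Y ⟶ i_* 𝒪_X ⟶ 0`. -/
def extClass (v : Γ(normalSheaf i, ⊤)) :
    ShiftedHom
      ((DerivedCategory.singleFunctor Y.Modules 0).obj ((pushforward i).obj (structureSheaf X)))
      ((DerivedCategory.singleFunctor Y.Modules 0).obj ((pushforward i).obj (structureSheaf X)))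
      (1 : ℤ) :=
  (idealSequence_shortExact i).singleδ ≫
    ((DerivedCategory.singleFunctor Y.Modules 0).map (idealToPushforward i v))⟦(1 : ℤ)⟧'

/-- The Yoneda product in `Ext^q(i_* 𝒪_X, i_* 𝒪_X)` of the classes in `Ext¹` attached to
`v₁, …, v_q`. -/
def extProduct : ∀ (q : ℕ)
    (_ : Fin q → Γ(normalSheaf i, ⊤)),
    ShiftedHom
      ((DerivedCategory.singleFunctor Y.Modules 0).obj ((pushforward i).obj (structureSheaf X)))
      ((DerivedCategory.singleFunctor Y.Modules 0).obj ((pushforward i).obj (structureSheaf X)))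
      (q : ℤ)
  | 0, _ => ShiftedHom.mk₀ _ rfl (𝟙 _)
  | q + 1, v => (extClass i (v 0)).comp (extProduct q (Fin.tail v)) (by push_cast; rfl)

/-- `Θ : ⨁_q i_* (⋀^q 𝒩)[-q] ⟶ i_* 𝒪_X`, where `𝒩` is the normal sheaf, is the morphism whose
component in `Ext^q(i_* ⋀^q 𝒩, i_* 𝒪_X)` restricts along `v₁ ∧ ⋯ ∧ v_q : 𝒪_X ⟶ ⋀^q 𝒩` to the
Yoneda product of the classes in `Ext¹(i_* 𝒪_X, i_* 𝒪_X)` attached to `v₁, …, v_q`. -/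
def IsHKR
    (Θ : DerivedCategory.Plus.Q.obj (pushforwardExteriorComplex i
        (normalSheaf i)) ⟶
      (DerivedCategory.Plus.singleFunctor Y.Modules 0).obj
        ((pushforward i).obj (structureSheaf X))) : Prop :=
  ∀ (q : ℕ) (v : Fin q → Γ(normalSheaf i, ⊤)),
    extProduct i q v =
      ((DerivedCategory.singleFunctors Y.Modules).shiftIso (q : ℤ) 0 (q : ℤ) (add_zero _)).inv.app
        ((pushforward i).obj (structureSheaf X)) ≫
      (inclusionOfWedge i _ v ≫ DerivedCategory.Plus.ι.map Θ)⟦(q : ℤ)⟧'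

/-- `⨁_q (⋀^q T_{X/S})[-q]`, as an object of `D(Mod 𝒪_{X ×_S X})` (by push-forward along the
diagonal). -/
def polyvectorSum (f : X ⟶ S) [HasDerivedCategory.{w} (Limits.pullback f f).Modules] :
    DerivedCategory (Limits.pullback f f).Modules :=
  DerivedCategory.Plus.ι.obj (DerivedCategory.Plus.Q.obj
    (pushforwardExteriorComplex (Limits.pullback.diagonal f) (tangentSheaf f)))

/-- `RℋHom_{𝒪_{X ×_S X}}(𝒪_X, 𝒪_X)`, where `𝒪_X` is regarded as an `𝒪_{X ×_S X}`-module by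
push-forward along the diagonal. -/
def RSheafHomDiagonal (f : X ⟶ S) [HasDerivedCategory.{w} (Limits.pullback f f).Modules] :
    DerivedCategory (Limits.pullback f f).Modules :=
  RSheafHomObj ((pushforward (Limits.pullback.diagonal f)).obj (structureSheaf X))
    ((pushforward (Limits.pullback.diagonal f)).obj (structureSheaf X))

/-- The canonical decompositions: the isomorphisms
`e : RℋHom(𝒪_X, 𝒪_X) ≅ ⨁_q (⋀^q T)[-q]` whose inverse is the map
`⨁_q (⋀^q T)[-q] ⟶ RℋHom(𝒪_X, 𝒪_X)` lifting (on cohomology, `𝒪_X`-linearly) the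
Hochschild-Kostant-Rosenberg maps `⋀^q T ⟶ ℰxt^q(𝒪_X, 𝒪_X)`, `v₁ ∧ ⋯ ∧ v_q ↦ v₁ ⋯ v_q`. -/
def IsHKRDecomposition (f : X ⟶ S) [IsSeparated f]
    [HasDerivedCategory.{w} (Limits.pullback f f).Modules]
    (e : RSheafHomDiagonal f ≅ polyvectorSum f) : Prop :=
  ∃ Θ, IsHKR (Limits.pullback.diagonal f) Θ ∧
    e.inv = DerivedCategory.Plus.ι.map
      (canonicalMap (Limits.pullback.diagonal f) (tangentSheaf f) Θ)

end Derived

end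

end AlgebraicGeometry.Scheme.Modules

/-! The diagonal is a closed immersion `i : X ⟶ Y` of affine schemes with a smooth retraction `π : Y
⟶ X`, and the argument is carried out for any such pair. Write F = i_*𝒪_X, I for its ideal sheaf, N
for the normal sheaf (here the tangent sheaf), and let F → J be an injective resolution. Then
RℋHom(F, F) is ℋom(F, J), a morphism Θ is a chain map θ from ⨁ i_*⋀^q N[-q] to J up to homotopy, and
Ext classes are cocycles F → J^q up to coboundaries.

Products. To multiply a cocycle z' by at(v), extend v ≫ z' from I to 𝒪_Y by injectivity; the
coboundary of the extension descends to a cocycle on F (`IsYonedaProduct`). The square of at(v)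
vanishes without any division by 2: formal smoothness lifts the ring map b ↦ ρ(b) + v(b)ε from dual
numbers to A[x]/(x³), and the coefficient of x² plays the role of v²/2 (`exists_secondOrder`,
`exists_comp_d_eq_of_isYonedaProduct`). Hence products factor through the exterior powers of Γ(N)
(`productHom`).

Existence and uniqueness of Θ. The module Γ(N) is finite projective, so N and ⋀^q N have finite dual
bases. A chain map with the right values on wedges can be written down by means of such a basis, and
a chain map which is a coboundary along every wedge is null-homotopic (`exists_isHKR`, `IsHKR.eq`).
The cocycles represent the Yoneda products up to the sign (-1)^(q(q+1)/2) (`extProduct_comp_map`).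

Isomorphism. It suffices that n ↦ (a ↦ θ(an)), from ⨁ i_*⋀^q N[-q] to ℋom(F, J), is a
quasi-isomorphism, which is a local question on Y. Off X both sides vanish. Near a point of X,
elements t_k of the ideal whose differentials form a basis are étale coordinates, so they form a
regular sequence, and by Nakayama they generate I (`exists_regularCoordinates`). Now divide out the
t_k one at a time. Since t_k kills F, the long exact Ext sequence of 0 → Q → Q → Q/t_kQ → 0 breaks
into short ones, and Ext^q is found to be free over F on the products of q of the dual vectors
(`LocallyGenerates.step`, `IndependentModulo.step`). -/

namespace AlgebraicGeometry.Scheme.Modules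
noncomputable section

/-! ### Sections of sheaves of modules and their local behaviour. -/

section LocalSections

variable {X : Scheme.{u}}

/-- Restriction of sections of a sheaf of modules. -/
def res (M : X.Modules) {U V : X.Opens} (h : V ≤ U) : Γ(M, U) →+ Γ(M, V) :=
  (M.presheaf.map (homOfLE h).op).hom

theorem res_res (M : X.Modules) {U V W : X.Opens} (h : W ≤ V) (h' : V ≤ U) (m : Γ(M, U)) :
    res M h (res M h' m) = res M (h.trans h') m :=
  presheaf_map_map M h h' m

theorem res_self (M : X.Modules) {U : X.Opens} (m : Γ(M, U)) : res M le_rfl m = m :=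
  ConcreteCategory.congr_hom (M.presheaf.map_id (.op U)) m

/-- Restriction of functions. -/
def resFun {U V : X.Opens} (h : V ≤ U) : Γ(X, U) →+* Γ(X, V) :=
  (X.presheaf.map (homOfLE h).op).hom

theorem resFun_resFun {U V W : X.Opens} (h : W ≤ V) (h' : V ≤ U) (r : Γ(X, U)) :
    resFun h (resFun h' r) = resFun (h.trans h') r := by
  change (X.presheaf.map (homOfLE h').op ≫ X.presheaf.map (homOfLE h).op) r = _
  rw [← Functor.map_comp]
  rfl

theorem resFun_self {U : X.Opens} (r : Γ(X, U)) : resFun le_rfl r = r :=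
  ConcreteCategory.congr_hom (X.presheaf.map_id (.op U)) r

theorem res_smul (M : X.Modules) {U V : X.Opens} (h : V ≤ U) (r : Γ(X, U)) (m : Γ(M, U)) :
    res M h (r • m) = resFun h r • res M h m :=
  Modules.map_smul M (homOfLE h) r m

theorem app_res {M N : X.Modules} (g : M ⟶ N) {U V : X.Opens} (h : V ≤ U) (m : Γ(M, U)) :
    g.app V (res M h m) = res N h (g.app U m) :=
  ConcreteCategory.congr_hom (g.mapPresheaf.naturality (homOfLE h).op) m

theorem eq_of_locally_eq (M : X.Modules) {U : X.Opens} (s t : Γ(M, U))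
    (hst : ∀ x ∈ U, ∃ (V : X.Opens) (h : V ≤ U), x ∈ V ∧ res M h s = res M h t) : s = t := by
  choose V h hx e using hst
  refine TopCat.Sheaf.eq_of_locally_eq' ⟨_, M.isSheaf⟩ (fun x : U => V x x.2) U
    (fun x => homOfLE (h x x.2)) ?_ _ _ fun x => e x x.2
  intro x hxU
  exact Opens.mem_iSup.mpr ⟨⟨x, hxU⟩, hx x hxU⟩

theorem eq_zero_of_locally_eq_zero (M : X.Modules) {U : X.Opens} (s : Γ(M, U))
    (hs : ∀ x ∈ U, ∃ (V : X.Opens) (h : V ≤ U), x ∈ V ∧ res M h s = 0) : s = 0 :=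
  eq_of_locally_eq M s 0 fun x hx => by
    obtain ⟨V, h, hxV, e⟩ := hs x hx
    exact ⟨V, h, hxV, by rw [e, map_zero]⟩

/-- Gluing of sections which are characterised by a local property. -/
theorem exists_glue (M : X.Modules) {U : X.Opens} (P : ∀ V : X.Opens, V ≤ U → Γ(M, V) → Prop)
    (hres : ∀ V W (hV : V ≤ U) (h : W ≤ V) s, P V hV s → P W (h.trans hV) (res M h s))
    (huniq : ∀ V (hV : V ≤ U) s t, P V hV s → P V hV t → s = t)
    (hex : ∀ x ∈ U, ∃ (V : X.Opens) (h : V ≤ U), x ∈ V ∧ ∃ s, P V h s) :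
    ∃ s : Γ(M, U), ∀ x ∈ U, ∃ (V : X.Opens) (h : V ≤ U), x ∈ V ∧ P V h (res M h s) := by
  choose V h hx s hs using hex
  obtain ⟨t, ht, -⟩ := TopCat.Sheaf.existsUnique_gluing' ⟨_, M.isSheaf⟩ (fun x : U => V x x.2) U
    (fun x => homOfLE (h x x.2)) (fun x hxU => Opens.mem_iSup.mpr ⟨⟨x, hxU⟩, hx x hxU⟩)
    (fun x => s x x.2) (fun x y => by
      exact huniq _ (inf_le_left.trans (h x x.2)) _ _ (hres _ _ _ inf_le_left _ (hs x x.2))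
        (hres _ _ _ inf_le_right _ (hs y y.2)))
  refine ⟨t, fun x hxU => ⟨V x hxU, h x hxU, hx x hxU, ?_⟩⟩
  have e : res M (h x hxU) t = s x hxU := ht ⟨x, hxU⟩
  rw [e]
  exact hs x hxU

theorem epi_of_locally_surjective {M N : X.Modules} (p : M ⟶ N)
    (hp : ∀ (V : X.Opens) (s : Γ(N, V)), ∀ x ∈ V, ∃ (W : X.Opens) (h : W ≤ V), x ∈ W ∧
      ∃ t : Γ(M, W), p.app W t = res N h s) : Epi p where
  left_cancellation {K} g g' e := by
    ext U s
    refine eq_of_locally_eq K _ _ fun x hx => ?_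
    obtain ⟨W, h, hxW, t, ht⟩ := hp U s x hx
    refine ⟨W, h, hxW, ?_⟩
    rw [← app_res, ← app_res, ← ht]
    exact congrArg (fun k : M ⟶ K => k.app W t) e

/-- The associated sheaf of modules. -/
abbrev assocSheaf (P : X.PresheafOfModules) : X.Modules :=
  (PresheafOfModules.sheafification (𝟙 X.ringCatSheaf.obj)).obj P

/-- The canonical morphism from a presheaf of modules to the associated sheaf. -/
def toAssocSheaf (P : X.PresheafOfModules) : P ⟶ (assocSheaf P).val :=
  (PresheafOfModules.sheafificationAdjunction (𝟙 X.ringCatSheaf.obj)).unit.app P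

theorem exists_local_eq_of_toAssocSheaf_eq (P : X.PresheafOfModules) {V : X.Opens}
    (s t : P.obj (.op V)) (hst : (toAssocSheaf P).app (.op V) s = (toAssocSheaf P).app (.op V) t)
    {x : X} (hx : x ∈ V) : ∃ (W : X.Opens) (h : W ≤ V), x ∈ W ∧
      P.map (homOfLE h).op s = P.map (homOfLE h).op t := by
  obtain ⟨W, i, h, hxW⟩ := Presheaf.equalizerSieve_mem (Opens.grothendieckTopology X)
    (toSheafify (Opens.grothendieckTopology X) P.presheaf) (X := .op V) s t hst x hx
  exact ⟨W, i.le, hxW, h⟩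

theorem exists_local_toAssocSheaf_eq (P : X.PresheafOfModules) {V : X.Opens}
    (s : Γ(assocSheaf P, V)) {x : X} (hx : x ∈ V) : ∃ (W : X.Opens) (h : W ≤ V), x ∈ W ∧
      ∃ t : P.obj (.op W), (toAssocSheaf P).app (.op W) t = res (assocSheaf P) h s := by
  obtain ⟨W, i, ⟨t, ht⟩, hxW⟩ := Presheaf.imageSieve_mem (Opens.grothendieckTopology X)
    (toSheafify (Opens.grothendieckTopology X) P.presheaf) (U := .op V) s x hx
  exact ⟨W, i.le, hxW, t, ht⟩

/-- The map from N to the sheaf associated to the presheaf cokernel of `p` is killed by the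
epimorphism `p`, so it is zero. Thus a section of N dies locally in the presheaf cokernel, which is
computed open set by open set. -/
theorem exists_local_preimage {M N : X.Modules} (p : M ⟶ N) [hp : Epi p] {V : X.Opens}
    (s : Γ(N, V)) {x : X} (hx : x ∈ V) : ∃ (W : X.Opens) (h : W ≤ V), x ∈ W ∧
      ∃ t : Γ(M, W), p.app W t = res N h s := by
  let Q := cokernel p.val
  let q : N ⟶ assocSheaf Q := ⟨cokernel.π p.val ≫ toAssocSheaf Q⟩
  have hq : q = 0 := by
    rw [← cancel_epi p, comp_zero]
    apply (toPresheafOfModules X).map_injective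
    change p.val ≫ cokernel.π p.val ≫ toAssocSheaf Q = 0
    rw [cokernel.condition_assoc, zero_comp]
  have h0 : (toAssocSheaf Q).app (.op V) ((cokernel.π p.val).app (.op V) s) =
      (toAssocSheaf Q).app (.op V) 0 := by
    rw [map_zero]
    exact congrArg (fun k : N ⟶ assocSheaf Q => k.app V s) hq
  obtain ⟨W, h, hxW, e⟩ := exists_local_eq_of_toAssocSheaf_eq Q _ _ h0 hx
  have e' : (cokernel.π p.val).app (.op W) (res N h s) = 0 := by
    exact (PresheafOfModules.naturality_apply (cokernel.π p.val) (homOfLE h).op s).trans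
      (e.trans (map_zero (Q.map (homOfLE h).op).hom))
  refine ⟨W, h, hxW, ?_⟩
  have hex := (ShortComplex.exact_cokernel p.val).map
    (PresheafOfModules.evaluation X.ringCatSheaf.obj (.op W))
  rw [ShortComplex.moduleCat_exact_iff] at hex
  exact hex (res N h s) e'

theorem injective_app_of_mono {M N : X.Modules} (p : M ⟶ N) [Mono p] (V : X.Opens) :
    Function.Injective (p.app V) := by
  have h1 : Mono ((toPresheaf X).map p) := inferInstance
  have h2 : Mono (((toPresheaf X).map p).app (.op V)) := inferInstance
  exact (AddCommGrpCat.mono_iff_injective _).mp h2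

theorem exists_kernel_ι_app_eq {M N : X.Modules} (p : M ⟶ N) {V : X.Opens} (s : Γ(M, V))
    (hs : p.app V s = 0) : ∃ k : Γ(kernel p, V), (kernel.ι p).app V k = s := by
  let F : X.Modules ⥤ ModuleCat (X.ringCatSheaf.obj.obj (.op V)) :=
    SheafOfModules.evaluation X.ringCatSheaf (.op V)
  have hF : PreservesFiniteLimits F := SheafOfModules.Finite.evaluationPreservesFiniteLimits _ _
  have hadd : F.PreservesZeroMorphisms := ⟨fun _ _ => rfl⟩
  have hex := (ShortComplex.exact_and_mono_f_iff_f_is_kernel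
    ((ShortComplex.mk (kernel.ι p) p (kernel.condition p)).map F)).mpr
      ⟨KernelFork.mapIsLimit _ (kernelIsKernel p) F⟩
  exact (ShortComplex.moduleCat_exact_iff _).mp hex.1 s hs

theorem exists_local_preimage_of_exact {S : ShortComplex X.Modules} (hS : S.Exact) {V : X.Opens}
    (s : Γ(S.X₂, V)) (hs : S.g.app V s = 0) {x : X} (hx : x ∈ V) :
    ∃ (W : X.Opens) (h : W ≤ V), x ∈ W ∧ ∃ t : Γ(S.X₁, W), S.f.app W t = res S.X₂ h s := by
  have h1 := hS.epi_kernelLift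
  obtain ⟨k, hk⟩ := exists_kernel_ι_app_eq S.g s hs
  obtain ⟨W, h, hxW, t, ht⟩ := exists_local_preimage (kernel.lift S.g S.f S.zero) k hx
  refine ⟨W, h, hxW, t, ?_⟩
  rw [← hk, ← app_res, ← ht]
  exact (congrArg (fun k : S.X₁ ⟶ S.X₂ => k.app W t) (kernel.lift_ι S.g S.f S.zero)).symm

end LocalSections

/-! ### Sections of sheaf Hom: functoriality and factorization. -/

section SheafHomTools

variable {X : Scheme.{u}} {M M' N N' : X.Modules}

/-- Sections of `ℋom(M, N)` evaluated on sections of `M`. -/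
def sheafHomEval {U : X.Opens} (φ : sheafHomSections M N U) {V : X.Opens} (h : V ≤ U) :
    Γ(M, V) →ₗ[Γ(X, V)] Γ(N, V) :=
  φ.1 ⟨V, h⟩

theorem sheafHomEval_res {U : X.Opens} (φ : sheafHomSections M N U) {V W : X.Opens} (h : V ≤ U)
    (h' : W ≤ V) (m : Γ(M, V)) :
    sheafHomEval φ (h'.trans h) (res M h' m) = res N h' (sheafHomEval φ h m) :=
  φ.2 ⟨V, h⟩ ⟨W, h'.trans h⟩ h' m

theorem sheafHomSections_ext' {U : X.Opens} {φ ψ : sheafHomSections M N U}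
    (h : ∀ V (hV : V ≤ U) m, sheafHomEval φ hV m = sheafHomEval ψ hV m) : φ = ψ :=
  sheafHomSections_ext fun V m => h V.1 V.2 m

theorem sheafHomEval_restrict {U V : X.Opens} (φ : sheafHomSections M N U) (h : V ≤ U)
    {W : X.Opens} (h' : W ≤ V) (m : Γ(M, W)) :
    sheafHomEval (sheafHomRestrict M N h φ) h' m = sheafHomEval φ (h'.trans h) m := rfl

/-- Constructor for sections of `ℋom(M, N)`. -/
def sheafHomMk {U : X.Opens} (f : ∀ V (_ : V ≤ U), Γ(M, V) →ₗ[Γ(X, V)] Γ(N, V))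
    (hf : ∀ V W (hV : V ≤ U) (h : W ≤ V) m, f W (h.trans hV) (res M h m) = res N h (f V hV m)) :
    sheafHomSections M N U :=
  ⟨fun V => f V.1 V.2, fun V W h m => hf V.1 W.1 V.2 h m⟩

/-- Composition of sections of `ℋom(M, N)` with a morphism `N ⟶ N'`. -/
def sheafHomPostcomp (M : X.Modules) (g : N ⟶ N') (U : X.Opens) :
    sheafHomSections M N U →+ sheafHomSections M N' U :=
  (((sheafHom M).map g).app U).hom

theorem sheafHomEval_postcomp (g : N ⟶ N') {U : X.Opens} (φ : sheafHomSections M N U)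
    {V : X.Opens} (h : V ≤ U) (m : Γ(M, V)) :
    sheafHomEval (sheafHomPostcomp M g U φ) h m = g.app V (sheafHomEval φ h m) := rfl

/-- Composition of sections of `ℋom(M', N)` with a morphism `M ⟶ M'`. -/
def sheafHomPrecomp (p : M ⟶ M') (N : X.Modules) (U : X.Opens) :
    sheafHomSections M' N U →+ sheafHomSections M N U where
  toFun φ := sheafHomMk (fun V hV =>
    { toFun := fun m => sheafHomEval φ hV (p.app V m)
      map_add' := fun a b => by rw [map_add, map_add]
      map_smul' := fun r a => by rw [Hom.app_smul, _root_.map_smul]; rfl }) fun V W hV h m => by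
        change sheafHomEval φ _ (p.app W _) = res N h (sheafHomEval φ _ (p.app V m))
        rw [app_res, sheafHomEval_res]
  map_zero' := rfl
  map_add' _ _ := rfl

theorem sheafHomEval_precomp (p : M ⟶ M') {U : X.Opens} (φ : sheafHomSections M' N U)
    {V : X.Opens} (h : V ≤ U) (m : Γ(M, V)) :
    sheafHomEval (sheafHomPrecomp p N U φ) h m = sheafHomEval φ h (p.app V m) := rfl

/-- The section of `ℋom(M, N)` given by a morphism. -/
def sheafHomOfHom (g : M ⟶ N) (U : X.Opens) : sheafHomSections M N U :=
  sheafHomMk (fun V _ =>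
    { toFun := fun m => g.app V m
      map_add' := fun a b => by rw [map_add]
      map_smul' := fun r a => by rw [Hom.app_smul]; rfl }) fun V W hV h m => app_res g h m

theorem sheafHomPrecomp_injective (p : M ⟶ M') [Epi p] (U : X.Opens) :
    Function.Injective (sheafHomPrecomp p N U) := by
  intro φ ψ e
  refine sheafHomSections_ext' fun V hV m => eq_of_locally_eq N _ _ fun x hx => ?_
  obtain ⟨W, h, hxW, t, ht⟩ := exists_local_preimage p m hx
  refine ⟨W, h, hxW, ?_⟩
  rw [← sheafHomEval_res φ, ← sheafHomEval_res ψ, ← ht, ← sheafHomEval_precomp,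
    ← sheafHomEval_precomp, e]

/-- A section of `ℋom(M, N)` which vanishes on the kernel of an epimorphism `p : M ⟶ M'` factors
through `p`. -/
theorem exists_sheafHomPrecomp_eq (p : M ⟶ M') [Epi p] {U : X.Opens} (χ : sheafHomSections M N U)
    (hχ : ∀ V (hV : V ≤ U) (m : Γ(M, V)), p.app V m = 0 → sheafHomEval χ hV m = 0) :
    ∃ χ' : sheafHomSections M' N U, sheafHomPrecomp p N U χ' = χ := by
  -- The graph of the desired map: n is the value at m' if it agrees with χ on every local lift of
  -- m'. Values are unique and restrict, so those found on small open subsets glue.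
  let P : ∀ (V : X.Opens) (_ : V ≤ U), Γ(M', V) → Γ(N, V) → Prop := fun V hV m' n =>
    ∀ W (h : W ≤ V) (m : Γ(M, W)), p.app W m = res M' h m' →
      sheafHomEval χ (h.trans hV) m = res N h n
  have huniq : ∀ V (hV : V ≤ U) m' n n', P V hV m' n → P V hV m' n' → n = n' := by
    intro V hV m' n n' hn hn'
    refine eq_of_locally_eq N _ _ fun x hx => ?_
    obtain ⟨W, h, hxW, t, ht⟩ := exists_local_preimage p m' hx
    exact ⟨W, h, hxW, (hn W h t ht).symm.trans (hn' W h t ht)⟩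
  have hbase : ∀ V (hV : V ≤ U) (m : Γ(M, V)), P V hV (p.app V m) (sheafHomEval χ hV m) := by
    intro V hV m W h m₁ e
    rw [← sheafHomEval_res χ, ← sub_eq_zero, ← map_sub]
    refine hχ _ _ _ ?_
    rw [map_sub, e, app_res, sub_self]
  have hres : ∀ V W (hV : V ≤ U) (h : W ≤ V) m' n, P V hV m' n →
      P W (h.trans hV) (res M' h m') (res N h n) := by
    intro V W hV h m' n hn W' h' m e
    rw [res_res] at e ⊢
    exact hn W' _ m e
  have hex : ∀ V (hV : V ≤ U) m', ∃ n, P V hV m' n := by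
    intro V hV m'
    obtain ⟨n, hn⟩ := exists_glue N (U := V) (fun W h n => P W (h.trans hV) (res M' h m') n)
      (fun W W' hW h n hn => by
        have := hres _ _ (hW.trans hV) h _ _ hn
        rwa [res_res] at this)
      (fun W hW n n' => huniq W (hW.trans hV) _ _ _)
      (fun x hx => by
        obtain ⟨W, h, hxW, t, ht⟩ := exists_local_preimage p m' hx
        refine ⟨W, h, hxW, sheafHomEval χ (h.trans hV) t, ?_⟩
        rw [← ht]
        exact hbase _ _ _)
    refine ⟨n, fun W h m e => eq_of_locally_eq N _ _ fun x hx => ?_⟩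
    obtain ⟨W', h', hxW', hP⟩ := hn x (h hx)
    refine ⟨W ⊓ W', inf_le_left, ⟨hx, hxW'⟩, ?_⟩
    have h2 := hP (W ⊓ W') inf_le_right (res M inf_le_left m) (by
      rw [app_res, e, res_res, res_res])
    rw [← sheafHomEval_res χ, h2, res_res, res_res]
  choose g hg using hex
  refine ⟨sheafHomMk (fun V hV =>
    { toFun := g V hV
      map_add' := fun a b => eq_of_locally_eq N _ _ fun x hx => ?_
      map_smul' := fun r a => eq_of_locally_eq N _ _ fun x hx => ?_ }) fun V W hV h m => ?_, ?_⟩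
  · obtain ⟨W, h, hxW, s, hs⟩ := exists_local_preimage p a hx
    obtain ⟨W', h', hxW', t, ht⟩ := exists_local_preimage p b hx
    refine ⟨W ⊓ W', inf_le_left.trans h, ⟨hxW, hxW'⟩, ?_⟩
    have hs' : p.app (W ⊓ W') (res M inf_le_left s) = res M' (inf_le_left.trans h) a := by
      rw [app_res, hs, res_res]
    have ht' : p.app (W ⊓ W') (res M inf_le_right t) = res M' (inf_le_left.trans h) b := by
      rw [app_res, ht, res_res]
    rw [map_add, ← hg V hV a _ _ _ hs', ← hg V hV b _ _ _ ht', ← map_add]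
    refine (hg V hV (a + b) _ _ _ ?_).symm
    rw [map_add, map_add, hs', ht']
  · obtain ⟨W, h, hxW, s, hs⟩ := exists_local_preimage p a hx
    refine ⟨W, h, hxW, ?_⟩
    rw [RingHom.id_apply, res_smul, ← hg V hV a _ _ _ hs, ← _root_.map_smul]
    refine (hg V hV (r • a) _ _ _ ?_).symm
    rw [Hom.app_smul, hs, res_smul]
  · exact huniq W (h.trans hV) _ _ _ (hg W _ _) (hres _ _ hV h _ _ (hg V hV m))
  · refine sheafHomSections_ext' fun V hV m => ?_
    exact huniq V hV _ _ _ (hg V hV _) (hbase V hV m)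

end SheafHomTools

/-! ### Extension of local homomorphisms into an injective module. -/

section Extension

variable {X : Scheme.{u}}

/-- The sub-presheaf of `M` of sections which vanish over open subsets not contained in `V`. -/
def zeroOutside (M : X.Modules) (V : X.Opens) : PresheafOfModules.Submodule M.val where
  obj W :=
    { carrier := {s | W.unop ≤ V ∨ s = 0}
      add_mem' := by
        rintro a b (h | rfl) (h' | rfl)
        · exact Or.inl h
        · exact Or.inl h
        · exact Or.inl h'
        · exact Or.inr (add_zero _)
      zero_mem' := Or.inr rfl
      smul_mem' := by
        rintro r a (h | rfl)
        · exact Or.inl h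
        · exact Or.inr (smul_zero _) }
  map {W W'} i := by
    rintro s (h | h)
    · exact Or.inl (i.unop.le.trans h)
    · exact Or.inr (by rw [h]; exact map_zero _)

variable {M M' N : X.Modules}

open Classical in
/-- The extension by zero of a section of `ℋom(M, N)` over `V`. -/
def zeroExtend {V : X.Opens} (χ : sheafHomSections M N V) (W : X.Opens) :
    Γ(M, W) →ₗ[Γ(X, W)] Γ(N, W) :=
  if h : W ≤ V then sheafHomEval χ h else 0

theorem zeroExtend_of_le {V : X.Opens} (χ : sheafHomSections M N V) {W : X.Opens} (h : W ≤ V) :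
    zeroExtend χ W = sheafHomEval χ h := dif_pos h

theorem zeroExtend_res_of_eq_zero {V : X.Opens} (χ : sheafHomSections M N V) {W W' : X.Opens}
    (h : W' ≤ W) (s : Γ(M, W)) (hs : s = 0) :
    zeroExtend χ W' (res M h s) = res N h (zeroExtend χ W s) := by
  rw [hs, map_zero, map_zero, map_zero, map_zero]

/-- The morphism from the sub-presheaf `zeroOutside M V` given by a section of `ℋom(M, N)`
over `V`. -/
def zeroOutsideDesc {V : X.Opens} (χ : sheafHomSections M N V) :
    (zeroOutside M V).toPresheafOfModules ⟶ N.val :=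
  PresheafOfModules.homMk
    { app := fun W => AddCommGrpCat.ofHom
        ((zeroExtend χ W.unop).toAddMonoidHom.comp
          ((zeroOutside M V).obj W).subtype.toAddMonoidHom)
      naturality := fun W W' i => by
        ext s
        change zeroExtend χ W'.unop (res M i.unop.le s.1) =
          res N i.unop.le (zeroExtend χ W.unop s.1)
        rcases s.2 with h | h
        · rw [zeroExtend_of_le χ h, zeroExtend_of_le χ (i.unop.le.trans h)]
          exact sheafHomEval_res χ h i.unop.le s.1
        · exact zeroExtend_res_of_eq_zero χ i.unop.le s.1 h }
    (fun W r s => (zeroExtend χ W.unop).map_smul r s.1)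

theorem zeroOutsideDesc_app {V : X.Opens} (χ : sheafHomSections M N V) {W : X.Opens} (h : W ≤ V)
    (s : Γ(M, W)) : (zeroOutsideDesc χ).app (.op W) ⟨s, Or.inl h⟩ = sheafHomEval χ h s :=
  LinearMap.congr_fun (zeroExtend_of_le χ h) s

/-- The morphism `zeroOutside M V ⟶ zeroOutside M' V` induced by `m : M ⟶ M'`. -/
def zeroOutsideMap (m : M ⟶ M') (V : X.Opens) :
    (zeroOutside M V).toPresheafOfModules ⟶ (zeroOutside M' V).toPresheafOfModules :=
  PresheafOfModules.homMk
    { app := fun W => AddCommGrpCat.ofHom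
        { toFun := fun s => ⟨m.app W.unop s.1, s.2.imp id fun e => by
            rw [e]; exact map_zero (m.app W.unop).hom⟩
          map_zero' := Subtype.ext (map_zero (m.app W.unop).hom)
          map_add' := fun a b => Subtype.ext (map_add (m.app W.unop).hom _ _) }
      naturality := fun W W' i => by
        ext s
        exact Subtype.ext (app_res m i.unop.le s.1) }
    (fun W r s => Subtype.ext (Hom.app_smul m r s.1))

/-- Sections of `ℋom(-, J)` over `V` extend along a morphism which is injective on sections over
the open subsets of `V`, when `J` is injective. -/
theorem exists_sheafHomPrecomp_eq_of_injective (m : M ⟶ M') (J : X.Modules)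
    [CategoryTheory.Injective J] {V : X.Opens} (hm : ∀ W ≤ V, Function.Injective (m.app W)) (χ : sheafHomSections M J V) :
    ∃ χ' : sheafHomSections M' J V, sheafHomPrecomp m J V χ' = χ := by
  -- The morphism `m` is injective only over the open subsets of V. The sub-presheaves `zeroOutside`
  -- have nonzero sections only there, so on them it becomes a monomorphism; sheafification
  -- preserves this, and injectivity of J applies.
  have hmono : Mono (zeroOutsideMap m V) := by
    refine PresheafOfModules.mono_of_injective fun W => ?_
    rintro ⟨s, hs⟩ ⟨t, ht⟩ e
    replace e : m.app W.unop s = m.app W.unop t := congrArg Subtype.val e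
    refine Subtype.ext ?_
    rcases hs with h | rfl
    · exact hm _ h e
    · rcases ht with h | rfl
      · exact hm _ h e
      · rfl
  let a := PresheafOfModules.sheafification (𝟙 X.ringCatSheaf.obj)
  let adj := PresheafOfModules.sheafificationAdjunction (𝟙 X.ringCatSheaf.obj)
  let k : assocSheaf (zeroOutside M V).toPresheafOfModules ⟶
    assocSheaf (zeroOutside M' V).toPresheafOfModules := a.map (zeroOutsideMap m V)
  have : Mono k := inferInstanceAs (Mono (a.map (zeroOutsideMap m V)))
  let f : assocSheaf (zeroOutside M V).toPresheafOfModules ⟶ J :=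
    (adj.homEquiv _ J).symm (zeroOutsideDesc χ)
  let g : assocSheaf (zeroOutside M' V).toPresheafOfModules ⟶ J :=
    CategoryTheory.Injective.factorThru f k
  have hg : k ≫ g = f := CategoryTheory.Injective.comp_factorThru _ _
  let g' : (zeroOutside M' V).toPresheafOfModules ⟶ J.val := adj.homEquiv _ J g
  have hg' : zeroOutsideMap m V ≫ g' = zeroOutsideDesc χ := by
    refine (adj.homEquiv_naturality_left (zeroOutsideMap m V) g).symm.trans ?_
    exact (congrArg (adj.homEquiv _ J) hg).trans ((adj.homEquiv _ J).apply_symm_apply _)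
  refine ⟨sheafHomMk (fun W hW =>
    { toFun := fun s => g'.app (.op W) ⟨s, Or.inl hW⟩
      map_add' := fun s t => map_add (g'.app (.op W)).hom
        (⟨s, Or.inl hW⟩ : (zeroOutside M' V).obj (.op W)) ⟨t, Or.inl hW⟩
      map_smul' := fun r s => (g'.app (.op W)).hom.map_smul r
        (⟨s, Or.inl hW⟩ : (zeroOutside M' V).obj (.op W)) }) fun W W' hW h s => ?_, ?_⟩
  · exact PresheafOfModules.naturality_apply g' (homOfLE h).op
      (⟨s, Or.inl hW⟩ : (zeroOutside M' V).obj (.op W))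
  · refine sheafHomSections_ext' fun W hW s => ?_
    refine Eq.trans ?_ (zeroOutsideDesc_app χ hW s)
    exact congrArg (fun k : (zeroOutside M V).toPresheafOfModules ⟶ J.val => k.app (.op W)
      (⟨s, Or.inl hW⟩ : (zeroOutside M V).obj (.op W))) hg'

end Extension

/-! ### Multiplication by functions. -/

section Scalars

variable {X : Scheme.{u}} {M M' N N' : X.Modules}

/-- The morphism of sheaves of modules given by a compatible family of linear maps. -/
def homMk (f : ∀ V : X.Opens, Γ(M, V) →ₗ[Γ(X, V)] Γ(N, V))
    (hf : ∀ V W (h : W ≤ V) m, f W (res M h m) = res N h (f V m)) : M ⟶ N :=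
  homOfSheafHomSection (show sheafHomSections M N ⊤ from
    sheafHomMk (fun V _ => f V) fun V W _ h m => hf V W h m)

theorem hom_ext' {g g' : M ⟶ N} (h : ∀ (V : X.Opens) (m : Γ(M, V)), g.app V m = g'.app V m) :
    g = g' := by
  refine Modules.hom_ext _ _ fun V => ?_
  ext m
  exact h V m

/-- Multiplication by a global function. -/
def smulEnd (r : Γ(X, ⊤)) (M : X.Modules) : M ⟶ M :=
  homMk (fun V => resFun (le_top : V ≤ ⊤) r • LinearMap.id) fun V W h m => by
    change resFun (le_top : W ≤ ⊤) r • res M h m = res M h (resFun (le_top : V ≤ ⊤) r • m)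
    rw [res_smul, resFun_resFun]

theorem smulEnd_app (r : Γ(X, ⊤)) (M : X.Modules) (V : X.Opens) (m : Γ(M, V)) :
    (smulEnd r M).app V m = resFun (le_top : V ≤ ⊤) r • m := rfl

theorem smulEnd_comp (r : Γ(X, ⊤)) (g : M ⟶ N) : smulEnd r M ≫ g = g ≫ smulEnd r N :=
  hom_ext' fun V m => Hom.app_smul g (resFun (le_top : V ≤ ⊤) r) m

theorem sheafHomEval_smul {U : X.Opens} (r : Γ(X, U)) (φ : sheafHomSections M N U) {V : X.Opens}
    (h : V ≤ U) (m : Γ(M, V)) : sheafHomEval (r • φ) h m = resFun h r • sheafHomEval φ h m := rfl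

theorem sheafHomPrecomp_smul (p : M ⟶ M') {U : X.Opens} (r : Γ(X, U))
    (φ : sheafHomSections M' N U) :
    sheafHomPrecomp p N U (r • φ) = r • sheafHomPrecomp p N U φ := rfl

theorem sheafHomPostcomp_smul (g : N ⟶ N') {U : X.Opens} (r : Γ(X, U))
    (φ : sheafHomSections M N U) :
    sheafHomPostcomp M g U (r • φ) = r • sheafHomPostcomp M g U φ :=
  sheafHomSections_ext' fun _ h _ => Hom.app_smul g (resFun h r) _

theorem sheafHomRestrict_smul {U V : X.Opens} (h : V ≤ U) (r : Γ(X, U))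
    (φ : sheafHomSections M N U) :
    sheafHomRestrict M N h (r • φ) = resFun h r • sheafHomRestrict M N h φ :=
  sheafHomSections_ext' fun W h' m => by
    rw [sheafHomEval_restrict, sheafHomEval_smul, sheafHomEval_smul, resFun_resFun]; rfl

theorem sheafHomPostcomp_precomp (p : M ⟶ M') (g : N ⟶ N') {U : X.Opens}
    (φ : sheafHomSections M' N U) :
    sheafHomPostcomp M g U (sheafHomPrecomp p N U φ) =
      sheafHomPrecomp p N' U (sheafHomPostcomp M' g U φ) := rfl

theorem sheafHomPrecomp_precomp {M'' : X.Modules} (p : M ⟶ M') (p' : M' ⟶ M'') {U : X.Opens}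
    (φ : sheafHomSections M'' N U) :
    sheafHomPrecomp p N U (sheafHomPrecomp p' N U φ) = sheafHomPrecomp (p ≫ p') N U φ := rfl

theorem sheafHomPrecomp_ofHom (p : M ⟶ M') (g : M' ⟶ N) (U : X.Opens) :
    sheafHomPrecomp p N U (sheafHomOfHom g U) = sheafHomOfHom (p ≫ g) U := rfl

theorem sheafHomPostcomp_postcomp {N'' : X.Modules} (g : N ⟶ N') (g' : N' ⟶ N'') {U : X.Opens}
    (φ : sheafHomSections M N U) :
    sheafHomPostcomp M g' U (sheafHomPostcomp M g U φ) = sheafHomPostcomp M (g ≫ g') U φ := rfl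

theorem sheafHomRestrict_precomp (p : M ⟶ M') {U V : X.Opens} (h : V ≤ U)
    (φ : sheafHomSections M' N U) :
    sheafHomRestrict M N h (sheafHomPrecomp p N U φ) =
      sheafHomPrecomp p N V (sheafHomRestrict M' N h φ) := rfl

theorem sheafHomRestrict_postcomp (g : N ⟶ N') {U V : X.Opens} (h : V ≤ U)
    (φ : sheafHomSections M N U) :
    sheafHomRestrict M N' h (sheafHomPostcomp M g U φ) =
      sheafHomPostcomp M g V (sheafHomRestrict M N h φ) := rfl

theorem sheafHomOfHom_zero (U : X.Opens) : sheafHomOfHom (0 : M ⟶ N) U = 0 := rfl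

theorem sheafHomOfHom_neg (g : M ⟶ N) (U : X.Opens) : sheafHomOfHom (-g) U = -sheafHomOfHom g U :=
  rfl

theorem sheafHomPrecomp_smulEnd (r : Γ(X, ⊤)) {U : X.Opens} (φ : sheafHomSections M N U) :
    sheafHomPrecomp (smulEnd r M) N U φ = resFun (le_top : U ≤ ⊤) r • φ :=
  sheafHomSections_ext' fun V h m => by
    rw [sheafHomEval_precomp, sheafHomEval_smul, smulEnd_app, _root_.map_smul, resFun_resFun]

theorem smul_sheafHomOfHom (r : Γ(X, ⊤)) (g : M ⟶ N) (U : X.Opens) :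
    resFun (le_top : U ≤ ⊤) r • sheafHomOfHom g U = sheafHomOfHom (smulEnd r M ≫ g) U := by
  rw [← sheafHomPrecomp_smulEnd, sheafHomPrecomp_ofHom]

/-- A function as a section of the structure sheaf. -/
def ofFun {U : X.Opens} (r : Γ(X, U)) : Γ(structureSheaf X, U) := r

/-- A section of the structure sheaf as a function. -/
def toFun {U : X.Opens} (r : Γ(structureSheaf X, U)) : Γ(X, U) := r

theorem res_ofFun {U V : X.Opens} (h : V ≤ U) (r : Γ(X, U)) :
    res (structureSheaf X) h (ofFun r) = ofFun (resFun h r) := rfl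

theorem smul_ofFun {U : X.Opens} (a r : Γ(X, U)) : a • ofFun r = ofFun (a * r) := rfl

theorem ofFun_add {U : X.Opens} (a r : Γ(X, U)) : ofFun (a + r) = ofFun a + ofFun r := rfl

theorem ofFun_sub {U : X.Opens} (a r : Γ(X, U)) : ofFun (a - r) = ofFun a - ofFun r := rfl

theorem ofFun_toFun {U : X.Opens} (r : Γ(structureSheaf X, U)) : ofFun (toFun r) = r := rfl

/-- The section of `ℋom(𝒪, N)` given by a section of `N`. -/
def sheafHomOfSection {U : X.Opens} (n : Γ(N, U)) : sheafHomSections (structureSheaf X) N U :=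
  sheafHomMk (fun V h =>
    { toFun := fun r => toFun r • res N h n
      map_add' := fun a b => add_smul (toFun a) (toFun b) _
      map_smul' := fun a b => mul_smul a (toFun b) _ }) fun V W hV h m => by
        change resFun h (toFun m) • res N _ n = res N h (toFun m • res N hV n)
        rw [res_smul, res_res]

theorem sheafHomEval_ofFun {U V : X.Opens} (φ : sheafHomSections (structureSheaf X) N U)
    (h : V ≤ U) (r : Γ(X, V)) :
    sheafHomEval φ h (ofFun r) = r • res N h (sheafHomEval φ le_rfl (ofFun 1)) := by
  rw [← sheafHomEval_res φ le_rfl h, ← _root_.map_smul, res_ofFun, smul_ofFun, map_one, mul_one]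

theorem sheafHomSections_structureSheaf_ext {U : X.Opens}
    {φ ψ : sheafHomSections (structureSheaf X) N U}
    (e : sheafHomEval φ le_rfl (ofFun 1) = sheafHomEval ψ le_rfl (ofFun 1)) : φ = ψ := by
  refine sheafHomSections_ext' fun V h r => ?_
  rw [← ofFun_toFun r, sheafHomEval_ofFun φ, sheafHomEval_ofFun ψ, e]

end Scalars

/-! ### Quotients of the structure sheaf by finitely many functions. -/

section Quotients

variable {X : Scheme.{u}}

/-- The quotient of the structure sheaf by the ideal generated by a list of global functions. -/
def quotObj : List Γ(X, ⊤) → X.Modules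
  | [] => structureSheaf X
  | t :: l => cokernel (smulEnd t (quotObj l))

/-- The projection from the structure sheaf to `quotObj l`. -/
def quotMap : ∀ l : List Γ(X, ⊤), structureSheaf X ⟶ quotObj l
  | [] => 𝟙 _
  | t :: l => quotMap l ≫ cokernel.π (smulEnd t (quotObj l))

instance quotMap_epi : ∀ l : List Γ(X, ⊤), Epi (quotMap l)
  | [] => inferInstanceAs (Epi (𝟙 _))
  | t :: l => by
    have := quotMap_epi l
    exact inferInstanceAs (Epi (quotMap l ≫ cokernel.π (smulEnd t (quotObj l))))

theorem exists_quotMap_comp_eq {G : X.Modules} (g : structureSheaf X ⟶ G) :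
    ∀ l : List Γ(X, ⊤), (∀ t ∈ l, smulEnd t _ ≫ g = 0) → ∃ k : quotObj l ⟶ G, quotMap l ≫ k = g
  | [], _ => ⟨g, Category.id_comp g⟩
  | t :: l, h => by
    obtain ⟨k, hk⟩ := exists_quotMap_comp_eq g l fun s hs => h s (List.mem_cons_of_mem _ hs)
    have hk' : smulEnd t (quotObj l) ≫ k = 0 := by
      rw [← cancel_epi (quotMap l), ← Category.assoc, ← smulEnd_comp, Category.assoc, hk,
        h t List.mem_cons_self, comp_zero]
    refine ⟨cokernel.desc _ k hk', (Category.assoc _ _ _).trans (Eq.trans ?_ hk)⟩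
    exact congrArg (quotMap l ≫ ·) (cokernel.π_desc _ k hk')

open Classical in
/-- The morphism `quotObj l ⟶ G` induced by a morphism from the structure sheaf which vanishes on
the functions in `l`. -/
def quotDesc {G : X.Modules} (g : structureSheaf X ⟶ G) (l : List Γ(X, ⊤)) : quotObj l ⟶ G :=
  if h : ∀ t ∈ l, smulEnd t _ ≫ g = 0 then (exists_quotMap_comp_eq g l h).choose else 0

theorem quotMap_desc {G : X.Modules} (g : structureSheaf X ⟶ G) (l : List Γ(X, ⊤))
    (h : ∀ t ∈ l, smulEnd t _ ≫ g = 0) : quotMap l ≫ quotDesc g l = g := by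
  rw [quotDesc, dif_pos h]
  exact (exists_quotMap_comp_eq g l h).choose_spec

theorem quotDesc_cons {G : X.Modules} (g : structureSheaf X ⟶ G) (t : Γ(X, ⊤)) (l : List Γ(X, ⊤))
    (h : ∀ s ∈ t :: l, smulEnd s _ ≫ g = 0) :
    cokernel.π (smulEnd t (quotObj l)) ≫ quotDesc g (t :: l) = quotDesc g l := by
  rw [← cancel_epi (quotMap l), quotMap_desc g l fun s hs => h s (List.mem_cons_of_mem _ hs)]
  exact (Category.assoc _ _ _).symm.trans (quotMap_desc g (t :: l) h)

/-- A function vanishes in `quotObj l` if and only if it is locally in the ideal generated by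
the functions in `l`. -/
theorem quotMap_app_eq_zero_iff : ∀ (l : List Γ(X, ⊤)) {V : X.Opens} (r : Γ(X, V)),
    (quotMap l).app V (ofFun r) = 0 ↔ ∀ x ∈ V, ∃ (W : X.Opens) (h : W ≤ V), x ∈ W ∧
      resFun h r ∈ Ideal.ofList (l.map (resFun (le_top : W ≤ ⊤)))
  | [], V, r => by
    simp only [List.map_nil, Ideal.ofList_nil, Ideal.mem_bot]
    constructor
    · intro h x hx
      refine ⟨V, le_rfl, hx, ?_⟩
      rw [resFun_self]
      exact h
    · intro h
      exact eq_zero_of_locally_eq_zero (structureSheaf X) _ h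
  | t :: l, V, r => by
    have ih : ∀ {V : X.Opens} (r : Γ(X, V)), _ ↔ _ := fun r => quotMap_app_eq_zero_iff l r
    simp only [List.map_cons, Ideal.ofList_cons]
    let Q := quotObj l
    let c : Q ⟶ quotObj (t :: l) := cokernel.π (smulEnd t Q)
    have hc : ∀ W s, (quotMap (t :: l)).app W s = c.app W ((quotMap l).app W s) :=
      fun W s => rfl
    have hcond : ∀ W s, c.app W ((smulEnd t Q).app W s) = 0 := fun W s =>
      congrArg (fun k : Q ⟶ cokernel (smulEnd t Q) => k.app W s) (cokernel.condition (smulEnd t Q))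
    constructor
    · intro h x hx
      obtain ⟨W, hW, hxW, s, hs⟩ := exists_local_preimage_of_exact
        (ShortComplex.exact_cokernel (smulEnd t Q)) ((quotMap l).app V (ofFun r)) h hx
      replace hs : resFun (le_top : W ≤ ⊤) t • s = res Q hW ((quotMap l).app V (ofFun r)) := hs
      obtain ⟨W', hW', hxW', s', hs'⟩ := exists_local_preimage (quotMap l) s hxW
      rw [← ofFun_toFun s'] at hs'
      -- Modulo the remaining functions r is t times a section, which lifts locally to a function
      -- s'. The induction hypothesis applies to r - t s'.
      have h0 : (quotMap l).app W' (ofFun (resFun (hW'.trans hW) r -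
          resFun le_top t * toFun s')) = 0 := by
        rw [ofFun_sub, map_sub, ← smul_ofFun, Hom.app_smul, hs', ← res_ofFun, app_res,
          ← resFun_resFun hW' le_top t, ← res_smul, hs, res_res, sub_self]
      obtain ⟨W'', hW'', hxW'', e⟩ := (ih _).mp h0 x hxW'
      refine ⟨W'', hW''.trans (hW'.trans hW), hxW'', ?_⟩
      rw [map_sub, map_mul, resFun_resFun, resFun_resFun] at e
      rw [← sub_add_cancel (resFun (hW''.trans (hW'.trans hW)) r)
        (resFun le_top t * resFun hW'' (toFun s'))]
      exact add_mem (Ideal.mem_sup_right e)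
        (Ideal.mem_sup_left (Ideal.mul_mem_right _ _ (Ideal.mem_span_singleton_self _)))
    · intro h
      refine eq_zero_of_locally_eq_zero _ _ fun x hx => ?_
      obtain ⟨W, hW, hxW, e⟩ := h x hx
      refine ⟨W, hW, hxW, ?_⟩
      obtain ⟨a, ha, b, hb, hab⟩ := Submodule.mem_sup.mp e
      obtain ⟨s, rfl⟩ := Ideal.mem_span_singleton'.mp ha
      have hb0 : (quotMap l).app W (ofFun b) = 0 := (ih b).mpr fun y hy => ⟨W, le_rfl, hy, by
        rwa [resFun_self]⟩
      rw [← app_res, res_ofFun, ← hab, hc, ofFun_add, map_add, hb0, add_zero, mul_comm s,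
        ← smul_ofFun, Hom.app_smul]
      exact hcond W _

end Quotients

theorem _root_.AddMonoidHom.map_eq_add_of_eq_sub_sub {A B : Type*} [AddCommGroup A] [AddCommGroup B]
    (f : A →+ B) {a x y z : A} (h : a = x - y - z) (hy : f y = 0) : f x = f a + f z := by
  rw [h, map_sub, map_sub, hy, sub_zero, sub_add_cancel]

theorem _root_.AddMonoidHom.map_sub_sub_eq_zero {A B : Type*} [AddCommGroup A] [AddCommGroup B]
    (f : A →+ B) {x y z : A} (h : f x = f z + f y) : f (x - y - z) = 0 := by
  rw [map_sub, map_sub, h, add_sub_cancel_right, sub_self]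

theorem _root_.AddMonoidHom.map_eq_zero_of_add_eq {A B : Type*} [AddCommGroup A] [AddCommGroup B]
    (f : A →+ B) {x y z : A} (h : x = y + z) (hx : f x = 0) (hy : f y = 0) : f z = 0 := by
  rw [h, map_add, hy, zero_add] at hx
  exact hx

theorem _root_.AddMonoidHom.map_eq_of_add_eq {A A' B : Type*} [AddCommGroup A] [AddCommGroup A']
    [AddCommGroup B] (f : A →+ A') (p : B →+ A') {x y z : A} {a b : B} {c : A'}
    (h : x = y + z) (h' : f z = p b + c) (h'' : p a = f y + c) : f x = p (a + b) := by
  rw [h, map_add, h', map_add, h'']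
  abel

/-! ### The inductive step of the Koszul computation of Ext. -/

section LinearCombinations

variable {X : Scheme.{u}} {M M' N N' : X.Modules} {ι : Type*} [Fintype ι]

/-- The linear combination of morphisms `θ j : M ⟶ N` with coefficients in the functions on `U`. -/
def linComb {U : X.Opens} (r : ι → Γ(X, U)) (θ : ι → (M ⟶ N)) : sheafHomSections M N U :=
  ∑ j, r j • sheafHomOfHom (θ j) U

theorem sheafHomRestrict_linComb {U V : X.Opens} (h : V ≤ U) (r : ι → Γ(X, U)) (θ : ι → (M ⟶ N)) :
    sheafHomRestrict M N h (linComb r θ) = linComb (fun j => resFun h (r j)) θ := by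
  rw [linComb, map_sum]
  exact Finset.sum_congr rfl fun j _ => sheafHomRestrict_smul h _ _

theorem sheafHomPrecomp_linComb (p : M' ⟶ M) {U : X.Opens} (r : ι → Γ(X, U)) (θ : ι → (M ⟶ N)) :
    sheafHomPrecomp p N U (linComb r θ) = linComb r fun j => p ≫ θ j := by
  rw [linComb, map_sum]
  exact Finset.sum_congr rfl fun j _ => rfl

theorem sheafHomPostcomp_linComb (g : N ⟶ N') {U : X.Opens} (r : ι → Γ(X, U)) (θ : ι → (M ⟶ N)) :
    sheafHomPostcomp M g U (linComb r θ) = linComb r fun j => θ j ≫ g := by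
  rw [linComb, map_sum]
  exact Finset.sum_congr rfl fun j _ => sheafHomPostcomp_smul g _ _

theorem linComb_eq_zero {U : X.Opens} (r : ι → Γ(X, U)) (θ : ι → (M ⟶ N)) (h : ∀ j, θ j = 0) :
    linComb r θ = 0 :=
  Finset.sum_eq_zero fun j _ => by
    rw [h j, sheafHomOfHom_zero]; exact smul_zero (A := sheafHomSections M N U) _

theorem linComb_smulEnd {U : X.Opens} (r : ι → Γ(X, U)) (g : Γ(X, ⊤)) (θ : ι → (M ⟶ N)) :
    linComb r (fun j => smulEnd g M ≫ θ j) =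
      linComb (fun j => r j * resFun (le_top : U ≤ ⊤) g) θ :=
  Finset.sum_congr rfl fun j _ => by
    rw [← smul_sheafHomOfHom]; exact smul_smul _ _ (sheafHomOfHom (θ j) U)

theorem linComb_neg {U : X.Opens} (r : ι → Γ(X, U)) (θ : ι → (M ⟶ N)) :
    linComb (fun j => -r j) θ = -linComb r θ := by
  rw [linComb, linComb, ← Finset.sum_neg_distrib]
  exact Finset.sum_congr rfl fun j _ => neg_smul _ _

theorem linComb_unique [Unique ι] {U : X.Opens} (r : ι → Γ(X, U)) (θ : ι → (M ⟶ N)) :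
    linComb r θ = r default • sheafHomOfHom (θ default) U :=
  Fintype.sum_unique _

theorem sheafHomEval_restrict_one {U V : X.Opens} (h : V ≤ U)
    (φ : sheafHomSections (structureSheaf X) N U) :
    sheafHomEval (sheafHomRestrict _ _ h φ) le_rfl (ofFun 1) =
      res N h (sheafHomEval φ le_rfl (ofFun 1)) := by
  rw [← sheafHomEval_res φ le_rfl h, res_ofFun, map_one]
  rfl

theorem exists_sheafHomPrecomp_cokernel_eq (u : M' ⟶ M) {U : X.Opens} (χ : sheafHomSections M N U)
    (h : sheafHomPrecomp u N U χ = 0) :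
    ∃ χ' : sheafHomSections (cokernel u) N U, sheafHomPrecomp (cokernel.π u) N U χ' = χ := by
  refine exists_sheafHomPrecomp_eq _ χ fun V hV m hm => eq_zero_of_locally_eq_zero N _ fun x hx => ?_
  obtain ⟨W, hW, hxW, s, hs⟩ := exists_local_preimage_of_exact (ShortComplex.exact_cokernel u) m hm hx
  refine ⟨W, hW, hxW, ?_⟩
  rw [← sheafHomEval_res χ hV hW]
  have e : sheafHomEval (sheafHomPrecomp u N U χ) (hW.trans hV) s = 0 := by rw [h]; rfl
  exact (congrArg (sheafHomEval χ (hW.trans hV)) hs.symm).trans e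

theorem sheafHomPrecomp_zero {U : X.Opens} (φ : sheafHomSections M N U) :
    sheafHomPrecomp (0 : M' ⟶ M) N U φ = 0 :=
  sheafHomSections_ext' fun _ h _ => map_zero (sheafHomEval φ h)

/-- Every `d₁`-cocycle on `Q` is locally the sum of a linear combination of the morphisms `c j`
and a `d₀`-coboundary. -/
def LocallyGenerates (U : X.Opens) {Q N₀ N₁ N₂ : X.Modules} (d₀ : N₀ ⟶ N₁) (d₁ : N₁ ⟶ N₂)
    (c : ι → (Q ⟶ N₁)) : Prop :=
  ∀ V ≤ U, ∀ φ : sheafHomSections Q N₁ V, sheafHomPostcomp _ d₁ V φ = 0 →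
    ∀ x ∈ V, ∃ (W : X.Opens) (h : W ≤ V), x ∈ W ∧ ∃ (r : ι → Γ(X, W))
      (χ : sheafHomSections Q N₀ W),
      sheafHomRestrict _ _ h φ = linComb r c + sheafHomPostcomp _ d₀ W χ

/-- A linear combination of the morphisms `c j` is a `d₀`-coboundary only if the coefficients
vanish in `F`. -/
def IndependentModulo (U : X.Opens) {F Q N₀ N₁ : X.Modules} (toF : structureSheaf X ⟶ F)
    (d₀ : N₀ ⟶ N₁) (c : ι → (Q ⟶ N₁)) : Prop :=
  ∀ V ≤ U, ∀ (r : ι → Γ(X, V)) (χ : sheafHomSections Q N₀ V),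
    linComb r c = sheafHomPostcomp _ d₀ V χ → ∀ j, toF.app V (ofFun (r j)) = 0

theorem linComb_sumElim {ι' : Type*} [Fintype ι'] {U : X.Opens} (r : ι ⊕ ι' → Γ(X, U))
    (θ : ι → (M ⟶ N)) (θ' : ι' → (M ⟶ N)) :
    linComb r (Sum.elim θ θ') = linComb (r ∘ Sum.inl) θ + linComb (r ∘ Sum.inr) θ' :=
  Fintype.sum_sum_type _

/-- Locally u^*χ = ∑ r_j c_j + d₀χ₂. Extend χ₂ along u to χ₃, using that N₀ is injective. Then χ -
d₀χ₃ - ∑ (r_j/g) ψ_j is killed by u^*, so it comes from some χ' on Q'; applying d₁ gives the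
formula. -/
theorem LocallyGenerates.exists_correction {U : X.Opens} {Q Q' N₀ N₁ N₂ : X.Modules}
    {d₀ : N₀ ⟶ N₁} {d₁ : N₁ ⟶ N₂} (hd : d₀ ≫ d₁ = 0)
    [CategoryTheory.Injective N₀] {u : Q ⟶ Q} (hu : ∀ V ≤ U, Function.Injective (u.app V))
    {p : Q ⟶ Q'}
    (hp : ∀ (V : X.Opens) (χ : sheafHomSections Q N₁ V), sheafHomPrecomp u N₁ V χ = 0 →
      ∃ χ', sheafHomPrecomp p N₁ V χ' = χ)
    {g : Γ(X, ⊤)} (hg : ∀ V ≤ U, IsUnit (resFun (le_top : V ≤ ⊤) g))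
    {c ψ : ι → (Q ⟶ N₁)} (hψ : ∀ j, u ≫ ψ j = smulEnd g _ ≫ c j)
    (h : LocallyGenerates U d₀ d₁ c) {V : X.Opens} (hV : V ≤ U) (χ : sheafHomSections Q N₁ V)
    (hχ : sheafHomPostcomp _ d₁ V (sheafHomPrecomp u _ V χ) = 0) {x : X} (hx : x ∈ V) :
    ∃ (W : X.Opens) (hW : W ≤ V), x ∈ W ∧ ∃ (r : ι → Γ(X, W)) (χ' : sheafHomSections Q' N₁ W),
      sheafHomPostcomp _ d₁ W (sheafHomRestrict _ _ hW χ) =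
        sheafHomPrecomp p _ W (sheafHomPostcomp _ d₁ W χ') + linComb r (fun j => ψ j ≫ d₁) := by
  obtain ⟨W, hW, hxW, r, χ₂, e⟩ := h V hV _ hχ x hx
  obtain ⟨χ₃, e₃⟩ := exists_sheafHomPrecomp_eq_of_injective u N₀
    (fun W' hW' => hu W' (hW'.trans (hW.trans hV))) χ₂
  obtain ⟨gi, hgi⟩ := (hg W (hW.trans hV)).exists_left_inv
  have e₄ : sheafHomPrecomp u _ W (linComb (fun j => r j * gi) ψ) = linComb r c := by
    rw [sheafHomPrecomp_linComb, funext hψ, linComb_smulEnd]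
    congr 1
    funext j
    rw [mul_assoc, hgi, mul_one]
  obtain ⟨χ₅, e₅⟩ := hp W _ (AddMonoidHom.map_sub_sub_eq_zero (sheafHomPrecomp u N₁ W)
    (x := sheafHomRestrict _ _ hW χ) (y := sheafHomPostcomp _ d₀ W χ₃)
    (z := linComb (fun j => r j * gi) ψ) (e.trans (by
      rw [e₄, ← sheafHomPostcomp_precomp, e₃])))
  refine ⟨W, hW, hxW, fun j => r j * gi, χ₅, ?_⟩
  refine (AddMonoidHom.map_eq_add_of_eq_sub_sub _ e₅ ?_).trans (congrArg₂ (· + ·) ?_ ?_)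
  · rw [sheafHomPostcomp_postcomp, hd]; rfl
  · exact sheafHomPostcomp_precomp p d₁ χ₅
  · exact sheafHomPostcomp_linComb d₁ _ ψ

/-- Generation half of the long exact Ext sequence of 0 → Q → Q → Q' → 0 with first map u. As u
kills the classes c and c', the classes on Q' come from lifts of the c and from the connecting
images d₁ψ of the c', which are of one degree less. If p^*φ = ∑ r c + d₁χ₁, then applying u^* shows
that u^*χ₁ is a cocycle, and `exists_correction` replaces d₁χ₁ by terms which descend to Q'. -/
theorem LocallyGenerates.step {ι' : Type*} [Fintype ι'] {U : X.Opens}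
    {Q Q' N₀ N₁ N₂ N₃ : X.Modules}
    {d₀ : N₀ ⟶ N₁} {d₁ : N₁ ⟶ N₂} {d₂ : N₂ ⟶ N₃} (hd : d₀ ≫ d₁ = 0)
    [CategoryTheory.Injective N₀] {u : Q ⟶ Q} (hu : ∀ V ≤ U, Function.Injective (u.app V))
    {p : Q ⟶ Q'} [Epi p] (hup : u ≫ p = 0)
    (hp : ∀ (V : X.Opens) (χ : sheafHomSections Q N₁ V), sheafHomPrecomp u N₁ V χ = 0 →
      ∃ χ', sheafHomPrecomp p N₁ V χ' = χ)
    {g : Γ(X, ⊤)} (hg : ∀ V ≤ U, IsUnit (resFun (le_top : V ≤ ⊤) g))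
    {c : ι → (Q ⟶ N₂)} {c' : ι' → (Q ⟶ N₁)} {ψ : ι' → (Q ⟶ N₁)} {C : ι ⊕ ι' → (Q' ⟶ N₂)}
    (hc : ∀ j, u ≫ c j = 0) (hψ : ∀ j, u ≫ ψ j = smulEnd g _ ≫ c' j)
    (hC : ∀ j, p ≫ C j = Sum.elim c (fun j => ψ j ≫ d₁) j)
    (h : LocallyGenerates U d₁ d₂ c) (h' : LocallyGenerates U d₀ d₁ c') :
    LocallyGenerates U d₁ d₂ C := by
  intro V hV φ hφ x hx
  obtain ⟨W₁, h₁, hx₁, r₁, χ₁, e₁⟩ := h V hV (sheafHomPrecomp p _ V φ) (by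
    rw [sheafHomPostcomp_precomp, hφ, map_zero]) x hx
  have e₂ : sheafHomPostcomp _ d₁ W₁ (sheafHomPrecomp u _ W₁ χ₁) = 0 := by
    refine AddMonoidHom.map_eq_zero_of_add_eq (sheafHomPrecomp u _ W₁) e₁ ?_ ?_
    · rw [sheafHomRestrict_precomp, sheafHomPrecomp_precomp, hup, sheafHomPrecomp_zero]
    · rw [sheafHomPrecomp_linComb, linComb_eq_zero _ _ hc]
  obtain ⟨W₂, h₂, hx₂, r₃, χ₅, e₆⟩ := h'.exists_correction hd hu hp hg hψ (h₁.trans hV) χ₁ e₂ hx₁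
  refine ⟨W₂, h₂.trans h₁, hx₂, Sum.elim (fun j => resFun h₂ (r₁ j)) r₃, χ₅, ?_⟩
  apply sheafHomPrecomp_injective p W₂
  have e₇ : sheafHomPrecomp p _ W₂ (linComb (Sum.elim (fun j => resFun h₂ (r₁ j)) r₃) C) =
      sheafHomRestrict _ _ h₂ (linComb r₁ c) + linComb r₃ (fun j => ψ j ≫ d₁) := by
    rw [sheafHomPrecomp_linComb, funext hC, linComb_sumElim, Sum.elim_comp_inl, Sum.elim_comp_inr,
      sheafHomRestrict_linComb]
  exact AddMonoidHom.map_eq_of_add_eq (sheafHomRestrict Q N₂ h₂) (sheafHomPrecomp p N₂ W₂) e₁ e₆ e₇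

-- Independence half of the same sequence. A relation on Q', pulled back to Q, says that the c-part
-- is d₁ω with ω = p^*χ - ∑ r ψ. Independence of c kills its coefficients in F, so the c-part
-- vanishes and ω is a cocycle, locally ∑ a c' + d₀χ'. Applying u^* makes -g ∑ r c' a coboundary,
-- and independence of c' kills r because g is a unit.
set_option maxHeartbeats 1000000 in
theorem IndependentModulo.step {ι' : Type*} [Fintype ι'] {U : X.Opens}
    {F Q Q' N₀ N₁ N₂ : X.Modules} {toF : structureSheaf X ⟶ F}
    {d₀ : N₀ ⟶ N₁} {d₁ : N₁ ⟶ N₂} {u : Q ⟶ Q} {p : Q ⟶ Q'} (hup : u ≫ p = 0)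
    {g : Γ(X, ⊤)} (hg : ∀ V ≤ U, IsUnit (resFun (le_top : V ≤ ⊤) g))
    {c : ι → (Q ⟶ N₂)} {c' : ι' → (Q ⟶ N₁)} {ψ : ι' → (Q ⟶ N₁)} {C : ι ⊕ ι' → (Q' ⟶ N₂)}
    (hc : ∀ (V : X.Opens) (r : Γ(X, V)), toF.app V (ofFun r) = 0 →
      ∀ j, r • sheafHomOfHom (c j) V = 0)
    (hc' : ∀ j, u ≫ c' j = 0) (hψ : ∀ j, u ≫ ψ j = smulEnd g _ ≫ c' j)
    (hC : ∀ j, p ≫ C j = Sum.elim c (fun j => ψ j ≫ d₁) j)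
    (hgen : LocallyGenerates U d₀ d₁ c') (h : IndependentModulo U toF d₁ c)
    (h' : IndependentModulo U toF d₀ c') : IndependentModulo U toF d₁ C := by
  intro V hV r χ e
  let ω : sheafHomSections Q N₁ V := sheafHomPrecomp p _ V χ - linComb (r ∘ Sum.inr) ψ
  have hω : linComb (r ∘ Sum.inl) c = sheafHomPostcomp _ d₁ V ω := by
    have e' := congrArg (sheafHomPrecomp p _ V) e
    rw [sheafHomPrecomp_linComb, funext hC, linComb_sumElim] at e'
    refine (eq_sub_of_add_eq e').trans ?_
    rw [← sheafHomPostcomp_precomp]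
    refine Eq.trans ?_ ((sheafHomPostcomp Q d₁ V).map_sub _ _).symm
    exact congrArg (_ - ·) (sheafHomPostcomp_linComb d₁ (r ∘ Sum.inr) ψ).symm
  have h₁ := h V hV _ ω hω
  have hω' : sheafHomPostcomp _ d₁ V ω = 0 := by
    rw [← hω]
    exact Finset.sum_eq_zero fun j _ => hc V _ (h₁ j) _
  have h₂ : ∀ j, toF.app V (ofFun (r (.inr j))) = 0 := fun j =>
    eq_zero_of_locally_eq_zero F _ fun x hx => by
      obtain ⟨W, hW, hxW, a, χ', e'⟩ := hgen V hV ω hω' x hx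
      refine ⟨W, hW, hxW, ?_⟩
      have e'' : linComb (fun j => -resFun hW (r (.inr j) * resFun (le_top : V ≤ ⊤) g)) c' =
          sheafHomPostcomp _ d₀ W (sheafHomPrecomp u _ W χ') := by
        have e₁ : sheafHomPrecomp u _ W (linComb a c') = 0 := by
          rw [sheafHomPrecomp_linComb, linComb_eq_zero _ _ hc']
        have e₂ : sheafHomPrecomp u _ V (sheafHomPrecomp p _ V χ) = 0 := by
          rw [sheafHomPrecomp_precomp, hup, sheafHomPrecomp_zero]
        have e₃ : sheafHomPrecomp u _ V (linComb (r ∘ Sum.inr) ψ) =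
            linComb (fun j => r (.inr j) * resFun (le_top : V ≤ ⊤) g) c' := by
          rw [sheafHomPrecomp_linComb, funext hψ, linComb_smulEnd]; rfl
        have e₄ : sheafHomPrecomp u _ V ω =
            -linComb (fun j => r (.inr j) * resFun (le_top : V ≤ ⊤) g) c' :=
          ((sheafHomPrecomp u _ V).map_sub _ _).trans
            ((congrArg₂ (· - ·) e₂ e₃).trans (zero_sub _))
        have e₅ := congrArg (sheafHomPrecomp u _ W) e'
        rw [← sheafHomRestrict_precomp, e₄, ← linComb_neg, sheafHomRestrict_linComb] at e₅
        simp only [map_neg] at e₅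
        refine e₅.trans (((sheafHomPrecomp u _ W).map_add _ _).trans ?_)
        exact (congrArg (· + _) e₁).trans ((zero_add _).trans (sheafHomPostcomp_precomp u d₀ χ').symm)
      have h₃ := h' W (hW.trans hV) _ _ e'' j
      obtain ⟨gi, hgi⟩ := (hg W (hW.trans hV)).exists_left_inv
      have h₄ : -gi • toF.app W (ofFun (-resFun hW (r (.inr j) * resFun (le_top : V ≤ ⊤) g))) =
          0 := (congrArg (-gi • ·) h₃).trans (smul_zero _)
      rw [← Hom.app_smul, smul_ofFun, neg_mul_neg, map_mul, resFun_resFun, mul_left_comm, hgi,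
        mul_one] at h₄
      rw [← app_res, res_ofFun]
      exact h₄
  rintro (j | j)
  · exact h₁ j
  · exact h₂ j

end LinearCombinations

/-! ### Koszul induction along a list of coordinates. -/

section KoszulCocycles

variable {α : Type} {X : Scheme.{u}} {F : X.Modules} 

/-- Indices for the sublists of length `q` of a list. -/
def SublistIdx : List α → ℤ → Type
  -- The length is an integer so that q - 1 always makes sense; there are no indices for negative q.
  | [], q => PLift (q = 0)
  | _ :: l, q => SublistIdx l q ⊕ SublistIdx l (q - 1)

instance SublistIdx.fintype : ∀ (l : List α) (q : ℤ), Fintype (SublistIdx l q)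
  | [], q => inferInstanceAs (Fintype (PLift (q = 0)))
  | _ :: l, q =>
    have := SublistIdx.fintype l q
    have := SublistIdx.fintype l (q - 1)
    inferInstanceAs (Fintype (SublistIdx l q ⊕ SublistIdx l (q - 1)))

/-- The sublist given by an index. -/
def SublistIdx.toList : ∀ {l : List α} {q : ℤ}, SublistIdx l q → List α
  | [], _, _ => []
  | _ :: _, _, .inl j => SublistIdx.toList j
  | a :: _, _, .inr j => a :: SublistIdx.toList j

/-- Cocycles `F ⟶ J q` indexed by lists, which are related by a Koszul type rule: `θ (a :: L)` is
the coboundary of a cochain `ψ a L` on the structure sheaf that restricts to `g • θ L` on the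
function `t a`, and to zero on the other functions `t b`. -/
structure KoszulCocycles (toF : structureSheaf X ⟶ F) (J : CochainComplex X.Modules ℤ)
    (α : Type) where
  t : α → Γ(X, ⊤)
  g : Γ(X, ⊤)
  θ : List α → ∀ q : ℤ, F ⟶ J.X q
  ψ : α → List α → ∀ q : ℤ, structureSheaf X ⟶ J.X q
  θ_d : ∀ L (q q' : ℤ), q + 1 = q' → θ L q ≫ J.d q q' = 0
  smulEnd_t : ∀ a, smulEnd (t a) F = 0
  ψ_self : ∀ a L (q : ℤ), smulEnd (t a) _ ≫ ψ a L q = smulEnd g _ ≫ toF ≫ θ L q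
  ψ_ne : ∀ a b L (q : ℤ), a ≠ b → smulEnd (t b) _ ≫ ψ a L q = 0
  ψ_d : ∀ a L (q q' : ℤ), q + 1 = q' → ψ a L q ≫ J.d q q' = toF ≫ θ (a :: L) q'
  -- The remaining fields express that `θ [] 0` makes J an injective resolution of F.
  zero_exact : ∀ (V : X.Opens) (s : Γ(J.X 0, V)), (J.d 0 1).app V s = 0 → ∀ x ∈ V,
    ∃ (W : X.Opens) (h : W ≤ V), x ∈ W ∧ ∃ r : Γ(F, W), (θ [] 0).app W r = res _ h s
  zero_injective : ∀ (V : X.Opens), Function.Injective ((θ [] 0).app V)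
  exact : ∀ (q q' q'' : ℤ), q + 1 = q' → q' + 1 = q'' → q' ≠ 0 → ∀ (V : X.Opens)
    (s : Γ(J.X q', V)), (J.d q' q'').app V s = 0 → ∀ x ∈ V,
    ∃ (W : X.Opens) (h : W ≤ V), x ∈ W ∧ ∃ r : Γ(J.X q, W), (J.d q q').app W r = res _ h s
  isZero : ∀ q < 0, IsZero (J.X q)
  injective : ∀ q, CategoryTheory.Injective (J.X q)

namespace KoszulCocycles

variable {toF : structureSheaf X ⟶ F} {J : CochainComplex X.Modules ℤ} (D : KoszulCocycles toF J α)

/-- The quotient of the structure sheaf by the functions indexed by a list. -/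
abbrev quot (l : List α) : X.Modules := quotObj (l.map D.t)

/-- The morphism from the quotient of the structure sheaf to `F`. -/
abbrev desc (l : List α) : D.quot l ⟶ F := quotDesc toF (l.map D.t)

/-- The projection between successive quotients. -/
abbrev proj (a : α) (l : List α) : D.quot l ⟶ D.quot (a :: l) :=
  cokernel.π (smulEnd (D.t a) (D.quot l))

/-- The cocycles on a quotient of the structure sheaf. -/
def cls (l : List α) {q : ℤ} (j : SublistIdx l q) : D.quot l ⟶ J.X q :=
  D.desc l ≫ D.θ j.toList q

theorem smulEnd_comp_toF (a : α) : smulEnd (D.t a) _ ≫ toF = 0 := by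
  rw [smulEnd_comp, D.smulEnd_t, comp_zero]

theorem smulEnd_comp_toF' (l : List α) : ∀ s ∈ l.map D.t, smulEnd s _ ≫ toF = 0 := by
  intro s hs
  obtain ⟨a, -, rfl⟩ := List.mem_map.mp hs
  exact D.smulEnd_comp_toF a

theorem proj_comp_desc (a : α) (l : List α) : D.proj a l ≫ D.desc (a :: l) = D.desc l :=
  quotDesc_cons toF (D.t a) (l.map D.t) (D.smulEnd_comp_toF' (a :: l))

theorem smulEnd_comp_desc (a : α) (l : List α) : smulEnd (D.t a) _ ≫ D.desc l = 0 := by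
  rw [smulEnd_comp, D.smulEnd_t, comp_zero]

/-- The cochain `ψ a L` on a quotient of the structure sheaf. -/
def cochain (l : List α) (a : α) (L : List α) (q : ℤ) : D.quot l ⟶ J.X q :=
  quotDesc (D.ψ a L q) (l.map D.t)

theorem quotMap_cochain {l : List α} {a : α} (ha : a ∉ l) (L : List α) (q : ℤ) :
    quotMap (l.map D.t) ≫ D.cochain l a L q = D.ψ a L q := by
  refine quotMap_desc _ _ fun s hs => ?_
  obtain ⟨b, hb, rfl⟩ := List.mem_map.mp hs
  exact D.ψ_ne a b L q (fun e => ha (e ▸ hb))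

theorem cochain_d {l : List α} {a : α} (ha : a ∉ l) (L : List α) {q q' : ℤ} (h : q + 1 = q') :
    D.cochain l a L q ≫ J.d q q' = D.desc l ≫ D.θ (a :: L) q' := by
  rw [← cancel_epi (quotMap (l.map D.t)), ← Category.assoc, D.quotMap_cochain ha, D.ψ_d a L q q' h,
    ← Category.assoc, quotMap_desc toF _ (D.smulEnd_comp_toF' l)]

theorem smulEnd_cochain {l : List α} {a : α} (ha : a ∉ l) (L : List α) (q : ℤ) :
    smulEnd (D.t a) _ ≫ D.cochain l a L q = smulEnd D.g _ ≫ D.desc l ≫ D.θ L q := by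
  rw [← cancel_epi (quotMap (l.map D.t)), ← Category.assoc, ← smulEnd_comp, Category.assoc,
    D.quotMap_cochain ha, D.ψ_self, ← Category.assoc (quotMap _), ← smulEnd_comp, Category.assoc,
    ← Category.assoc (quotMap _) (D.desc l), quotMap_desc toF _ (D.smulEnd_comp_toF' l)]

/-- The classes factor through F, so a coefficient matters only through its image in F. -/
theorem smul_desc_eq_zero (l : List α) {V : X.Opens} (r : Γ(X, V)) (hr : toF.app V (ofFun r) = 0)
    {q : ℤ} (k : F ⟶ J.X q) : r • sheafHomOfHom (D.desc l ≫ k) V = 0 := by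
  apply sheafHomPrecomp_injective (quotMap (l.map D.t)) V
  rw [sheafHomPrecomp_smul, sheafHomPrecomp_ofHom, map_zero, ← Category.assoc,
    quotMap_desc toF _ (D.smulEnd_comp_toF' l)]
  refine sheafHomSections_structureSheaf_ext ?_
  rw [sheafHomEval_smul, resFun_self]
  change r • k.app V (toF.app V (ofFun 1)) = 0
  rw [← Hom.app_smul, ← Hom.app_smul, smul_ofFun, mul_one, hr, map_zero]

/-- Multiplication by each function in a list is injective modulo the later functions. -/
def Regular (U : X.Opens) : List α → Prop
  | [] => True
  | a :: l => (∀ V ≤ U, Function.Injective ((smulEnd (D.t a) (D.quot l)).app V)) ∧ Regular U l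

/-- The two kinds of sublists of a :: l correspond to the two ends of the Ext sequence: those
without a are lifts of classes on the shorter quotient, and those with a are connecting images,
given by the coboundary of a cochain that does not itself descend. -/
theorem proj_comp_cls (a : α) (l : List α) {q : ℤ} (ha : a ∉ l) :
    ∀ j : SublistIdx (a :: l) q, D.proj a l ≫ D.cls (a :: l) j =
      Sum.elim (D.cls l) (fun j => D.cochain l a j.toList (q - 1) ≫ J.d (q - 1) q) j := by
  have e (k : F ⟶ J.X q) : D.proj a l ≫ D.desc (a :: l) ≫ k = D.desc l ≫ k := by
    rw [← Category.assoc, D.proj_comp_desc]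
  rintro (j | j)
  · exact e _
  · exact (e _).trans (D.cochain_d ha j.toList (by omega)).symm

theorem smulEnd_comp_cls (a : α) (l : List α) {q : ℤ} (j : SublistIdx l q) :
    smulEnd (D.t a) _ ≫ D.cls l j = 0 := by
  rw [cls, ← Category.assoc, D.smulEnd_comp_desc, zero_comp]

instance : Unique (SublistIdx ([] : List α) 0) := ⟨⟨⟨rfl⟩⟩, fun _ => rfl⟩

theorem cls_nil {q : ℤ} (j : SublistIdx ([] : List α) q) : D.cls [] j = toF ≫ D.θ [] q := by
  have h := quotMap_desc toF [] (by simp)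
  exact congrArg (· ≫ D.θ [] q) ((Category.id_comp _).symm.trans h)

/-- For the empty list the quotient is 𝒪, and ℋom(𝒪, J) = J. A resolution has the cohomology F in
degree 0 and none elsewhere, which matches the single empty sublist. -/
theorem locallyGenerates_nil (U : X.Opens) [Epi toF] (q q' q'' : ℤ) (h : q + 1 = q')
    (h' : q' + 1 = q'') :
    LocallyGenerates U (J.d q q') (J.d q' q'') (D.cls [] (q := q')) := by
  intro V hV φ hφ x hx
  let s : Γ(J.X q', V) := sheafHomEval φ le_rfl (ofFun 1)
  have hs : (J.d q' q'').app V s = 0 := by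
    have := sheafHomEval_postcomp (J.d q' q'') φ le_rfl (ofFun 1)
    rw [hφ] at this
    exact this.symm
  by_cases hq : q' = 0
  · subst hq
    obtain rfl : q'' = 1 := by omega
    obtain ⟨W, hW, hxW, m, hm⟩ := D.zero_exact V s hs x hx
    obtain ⟨W', hW', hxW', r, hr⟩ := exists_local_preimage toF m hxW
    refine ⟨W', hW'.trans hW, hxW', fun _ => toFun r, 0, sheafHomSections_structureSheaf_ext ?_⟩
    have e : (D.θ [] 0).app W' (toF.app W' r) = res _ (hW'.trans hW) s := by
      rw [hr, app_res, hm, res_res]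
    refine (sheafHomEval_restrict_one _ φ).trans (e.symm.trans ?_)
    rw [map_zero, linComb_unique, add_zero, D.cls_nil]
    change _ = resFun le_rfl (toFun r) • (D.θ [] 0).app W' (toF.app W' (ofFun 1))
    rw [resFun_self, ← Hom.app_smul, ← Hom.app_smul, smul_ofFun, mul_one]
    rfl
  · obtain ⟨W, hW, hxW, m, hm⟩ := D.exact q q' q'' h h' hq V s hs x hx
    have : IsEmpty (SublistIdx ([] : List α) q') := ⟨fun j => hq j.down⟩
    refine ⟨W, hW, hxW, isEmptyElim, sheafHomOfSection m, sheafHomSections_structureSheaf_ext ?_⟩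
    refine (sheafHomEval_restrict_one _ φ).trans (hm.symm.trans ?_)
    rw [show linComb isEmptyElim (D.cls ([] : List α) (q := q')) = 0 from Fintype.sum_empty _,
      zero_add]
    change _ = (J.d q q').app W ((1 : Γ(X, W)) • res (J.X q) le_rfl m)
    rw [one_smul, res_self]

/-- Only degree 0 has an index, and there no coboundaries exist since J vanishes in negative
degrees. -/
theorem independentModulo_nil (U : X.Opens) (q q' : ℤ) (h : q + 1 = q') :
    IndependentModulo U toF (J.d q q') (D.cls [] (q := q')) := by
  rintro V hV r χ e ⟨rfl⟩
  rw [linComb_unique, D.cls_nil] at e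
  have e' := congrArg (fun φ => sheafHomEval φ le_rfl (ofFun 1)) e
  have h0 : J.d q 0 = 0 := (D.isZero q (by omega)).eq_of_src _ _
  replace e' : resFun le_rfl (r default) • (D.θ [] 0).app V (toF.app V (ofFun 1)) = 0 := by
    refine e'.trans ?_
    rw [h0]
    rfl
  rw [resFun_self, ← Hom.app_smul, ← Hom.app_smul, smul_ofFun, mul_one] at e'
  exact D.zero_injective V (e'.trans (map_zero _).symm)

/-- The step for degree q' needs the shorter list in degrees q' and q' - 1, so the induction runs
over all degrees at once. -/
theorem locallyGenerates {U : X.Opens} [Epi toF]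
    (hg : ∀ V ≤ U, IsUnit (resFun (le_top : V ≤ ⊤) D.g)) :
    ∀ (l : List α) (_ : l.Nodup) (_ : D.Regular U l) (q q' q'' : ℤ), q + 1 = q' → q' + 1 = q'' →
      LocallyGenerates U (J.d q q') (J.d q' q'') (D.cls l (q := q'))
  | [], _, _, q, q', q'', h, h' => D.locallyGenerates_nil U q q' q'' h h'
  | a :: l, hl, hreg, q, q', q'', h, h' => by
    obtain rfl : q = q' - 1 := by omega
    have := D.injective
    rw [List.nodup_cons] at hl
    exact LocallyGenerates.step (J.d_comp_d (q' - 1 - 1) (q' - 1) q') hreg.1 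
      (p := cokernel.π (smulEnd (D.t a) (D.quot l))) (cokernel.condition _)
      (fun V χ hχ => exists_sheafHomPrecomp_cokernel_eq _ χ hχ) hg
      (D.smulEnd_comp_cls a l)
      (fun j => D.smulEnd_cochain hl.1 _ _) (D.proj_comp_cls a l hl.1)
      (locallyGenerates hg l hl.2 hreg.2 _ _ _ h h')
      (locallyGenerates hg l hl.2 hreg.2 _ _ _ (by omega) h)

theorem independentModulo {U : X.Opens} [Epi toF]
    (hg : ∀ V ≤ U, IsUnit (resFun (le_top : V ≤ ⊤) D.g)) :
    ∀ (l : List α) (_ : l.Nodup) (_ : D.Regular U l) (q q' : ℤ), q + 1 = q' →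
      IndependentModulo U toF (J.d q q') (D.cls l (q := q'))
  | [], _, _, q, q', h => D.independentModulo_nil U q q' h
  | a :: l, hl, hreg, q, q', h => by
    obtain rfl : q = q' - 1 := by omega
    rw [List.nodup_cons] at hl
    exact IndependentModulo.step
      (p := D.proj a l) (cokernel.condition _) hg
      (fun V r hr j => D.smul_desc_eq_zero l r hr _) (D.smulEnd_comp_cls a l)
      (fun j => D.smulEnd_cochain hl.1 _ _) (D.proj_comp_cls a l hl.1)
      (locallyGenerates D hg l hl.2 hreg.2 (q' - 1 - 1) (q' - 1) q' (by omega) h)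
      (independentModulo hg l hl.2 hreg.2 _ _ h)
      (independentModulo hg l hl.2 hreg.2 (q' - 1 - 1) (q' - 1) (by omega))

/-- When the list generates the ideal of F over U, the quotient is F there; this moves the
computation from the quotient to F. -/
theorem desc_injective {U : X.Opens} (l : List α)
    (hI : ∀ V ≤ U, ∀ r : Γ(X, V), toF.app V (ofFun r) = 0 → ∀ x ∈ V,
      ∃ (W : X.Opens) (h : W ≤ V), x ∈ W ∧
        resFun h r ∈ Ideal.ofList ((l.map D.t).map (resFun (le_top : W ≤ ⊤)))) :
    ∀ V ≤ U, Function.Injective ((D.desc l).app V) := by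
  intro V hV
  refine (injective_iff_map_eq_zero _).mpr fun s hs => eq_zero_of_locally_eq_zero _ _ fun x hx => ?_
  obtain ⟨W, hW, hxW, r, hr⟩ := exists_local_preimage (quotMap (l.map D.t)) s hx
  refine ⟨W, hW, hxW, ?_⟩
  rw [← hr]
  refine (quotMap_app_eq_zero_iff (l.map D.t) (toFun r)).mpr (hI W (hW.trans hV) _ ?_)
  have e : toF.app W r = (D.desc l).app W ((quotMap (l.map D.t)).app W r) :=
    congrArg (fun k : structureSheaf X ⟶ F => k.app W r)
      (quotMap_desc toF _ (D.smulEnd_comp_toF' l)).symm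
  refine e.trans ?_
  rw [hr, app_res, hs, map_zero]

theorem epi_desc [Epi toF] (l : List α) : Epi (D.desc l) := by
  have h := quotMap_desc toF _ (D.smulEnd_comp_toF' l)
  have : Epi (quotMap (l.map D.t) ≫ D.desc l) := by rw [h]; infer_instance
  exact epi_of_epi (quotMap (l.map D.t)) _

/-- The cocycles `F ⟶ J q` given by a list of functions that generate the ideal of `F` locally
generate all cocycles up to coboundaries. -/
theorem locallyGenerates_target {U : X.Opens} [Epi toF] {l : List α}
    (hinj : ∀ V ≤ U, Function.Injective ((D.desc l).app V)) {q q' q'' : ℤ}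
    (h : LocallyGenerates U (J.d q q') (J.d q' q'') (D.cls l (q := q'))) :
    LocallyGenerates U (J.d q q') (J.d q' q'') fun j : SublistIdx l q' => D.θ j.toList q' := by
  have := D.epi_desc l
  intro V hV φ hφ x hx
  obtain ⟨W, hW, hxW, r, χ, e⟩ := h V hV (sheafHomPrecomp (D.desc l) _ V φ) (by
    rw [sheafHomPostcomp_precomp, hφ, map_zero]) x hx
  obtain ⟨χ', rfl⟩ := exists_sheafHomPrecomp_eq (D.desc l) χ fun V' hV' m hm => by
    rw [hinj V' (hV'.trans (hW.trans hV)) (hm.trans (map_zero _).symm), map_zero]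
  refine ⟨W, hW, hxW, r, χ', ?_⟩
  apply sheafHomPrecomp_injective (D.desc l) W
  refine e.trans (((sheafHomPrecomp (D.desc l) (J.X q') W).map_add _ _).trans ?_).symm
  rw [sheafHomPrecomp_linComb]
  rfl

theorem independentModulo_target {U : X.Opens} {l : List α} {q q' : ℤ}
    (h : IndependentModulo U toF (J.d q q') (D.cls l (q := q'))) :
    IndependentModulo U toF (J.d q q') fun j : SublistIdx l q' => D.θ j.toList q' := by
  intro V hV r χ e
  refine h V hV r (sheafHomPrecomp (D.desc l) _ V χ) ?_
  rw [sheafHomPostcomp_precomp, ← e, sheafHomPrecomp_linComb]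
  rfl

end KoszulCocycles

end KoszulCocycles

end

end AlgebraicGeometry.Scheme.Modules

/-! ### Étale coordinates and regular sequences. -/

namespace Algebra

noncomputable section

open KaehlerDifferential

open scoped _root_.TensorProduct

section Coordinates

variable {A B : Type u} [CommRing A] [CommRing B] [Algebra A B]

/-- The inverse of the isomorphism given by the basis lifts, up to one denominator s, to a map out
of the finitely presented module M. Two more denominators make both composites equal to
multiplication by a scalar before localizing. -/
theorem _root_.Module.FinitePresentation.exists_smul_inverse_of_basis {R M M' R' κ : Type*}
    [CommRing R] [AddCommGroup M] [Module R M] [AddCommGroup M'] [Module R M'] [CommRing R']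
    [Algebra R R'] [Module R' M'] [IsScalarTower R R' M'] [Module.FinitePresentation R M]
    [Finite κ] (S : Submonoid R) [IsLocalization S R'] (f : M →ₗ[R] M') [IsLocalizedModule S f]
    (b : Module.Basis κ R' M') (m : κ → M) (hb : ∀ i, b i = f (m i)) :
    ∃ g ∈ S, ∃ F : M →ₗ[R] (κ →₀ R), (∀ i, F (m i) = Finsupp.single i g) ∧
      ∀ x, g • x = Finsupp.linearCombination R m (F x) := by
  let e : (κ →₀ R) →ₗ[R] M := Finsupp.linearCombination R m
  let l : (κ →₀ R) →ₗ[R] (κ →₀ R') := Finsupp.mapRange.linearMap (Algebra.linearMap R R')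
  have hl : ∀ x, b.repr (f (e x)) = l x := by
    intro x
    suffices h : (b.repr.toLinearMap.restrictScalars R) ∘ₗ f ∘ₗ e = l from LinearMap.congr_fun h x
    ext i : 2
    simp [e, l, ← hb]
  obtain ⟨F, s, hF⟩ := Module.FinitePresentation.exists_lift_of_isLocalizedModule S l
    ((b.repr.toLinearMap.restrictScalars R) ∘ₗ f)
  have hF' : ∀ x, l (F x) = (s : R) • b.repr (f x) := fun x => LinearMap.congr_fun hF x
  have h₁ : f ∘ₗ (e ∘ₗ F) = f ∘ₗ ((s : R) • LinearMap.id) := by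
    refine LinearMap.ext fun x => b.repr.injective ?_
    change b.repr (f (e (F x))) = b.repr (f ((s : R) • x))
    rw [hl, hF', map_smul f, ← IsScalarTower.algebraMap_smul R' (s : R) (f x), map_smul,
      IsScalarTower.algebraMap_smul]
  have h₂ : l ∘ₗ (F ∘ₗ e) = l ∘ₗ ((s : R) • LinearMap.id) := by
    refine LinearMap.ext fun x => ?_
    change l (F (e x)) = l ((s : R) • x)
    rw [hF', hl, map_smul]
  obtain ⟨s₁, hs₁⟩ := Module.Finite.exists_smul_of_comp_eq_of_isLocalizedModule S f _ _ h₁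
  obtain ⟨s₂, hs₂⟩ := Module.Finite.exists_smul_of_comp_eq_of_isLocalizedModule S l _ _ h₂
  refine ⟨s₁ * s₂ * s, S.mul_mem (S.mul_mem s₁.2 s₂.2) s.2, ((s₁ : R) * s₂) • F, fun i => ?_,
    fun x => ?_⟩
  · have h := LinearMap.congr_fun hs₂ (Finsupp.single i 1)
    have h' : (s₂ : R) • F (e (Finsupp.single i 1)) = (s₂ : R) • (s : R) • Finsupp.single i (1 : R) :=
      h
    have h'' : e (Finsupp.single i 1) = m i := by simp [e]
    rw [LinearMap.smul_apply, mul_smul, ← h'', h', smul_smul, smul_smul, Finsupp.smul_single,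
      smul_eq_mul, mul_one, mul_assoc]
  · have h := LinearMap.congr_fun hs₁ x
    have h' : (s₁ : R) • e (F x) = (s₁ : R) • (s : R) • x := h
    change _ = e _
    rw [LinearMap.smul_apply, map_smul, mul_comm (s₁ : R), mul_smul (s₂ : R) (s₁ : R) (e (F x)), h',
      mul_smul, mul_smul]

/-- Localized at p, the differentials form a finite flat module over a local ring, so any spanning
family contains a basis. Clearing denominators gives g and F, an inverse of the basis map up to g.
-/
theorem exists_kaehler_coordinates [FormallySmooth A B] [FinitePresentation A B]
    (p : Ideal B) [p.IsPrime] {ι : Type u} (s : ι → B)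
    (hs : Submodule.span B (Set.range fun i => D A B (s i)) = ⊤) :
    ∃ (κ : Type u) (_ : Finite κ) (a : κ → ι) (g : B) (F : Ω[B⁄A] →ₗ[B] (κ →₀ B)), g ∉ p ∧
      (∀ i, F (D A B (s (a i))) = Finsupp.single i g) ∧
      ∀ ω, g • ω = Finsupp.linearCombination B (fun i => D A B (s (a i))) (F ω) := by
  let l : Ω[B⁄A] →ₗ[B] Ω[Localization.AtPrime p⁄A] := map A A B (Localization.AtPrime p)
  have hl : Submodule.span (Localization.AtPrime p) (Set.range fun i => l (D A B (s i))) = ⊤ := by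
    have := span_eq_top_of_isLocalizedModule (Localization.AtPrime p) p.primeCompl l hs
    rwa [← Set.range_comp] at this
  have : FormallySmooth A (Localization.AtPrime p) := by
    have : FormallySmooth B (Localization.AtPrime p) := .of_isLocalization p.primeCompl
    exact .comp A B _
  have : EssFiniteType A (Localization.AtPrime p) := by
    have : EssFiniteType B (Localization.AtPrime p) := .of_isLocalization _ p.primeCompl
    exact .comp A B _
  obtain ⟨κ, a, b, hb⟩ := Module.exists_basis_of_span_of_flat _ hl
  have : Finite κ := Module.Finite.finite_basis b
  obtain ⟨g, hg, F, h, h'⟩ := Module.FinitePresentation.exists_smul_inverse_of_basis p.primeCompl l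
    b (fun i => D A B (s (a i))) hb
  exact ⟨κ, this, a, g, F, hg, h, h'⟩

/-- Jacobian criterion. Since the dt_i are a basis over C, the map Φ from C ⊗ Ω of the polynomial
ring to Ω of C is bijective; G inverts it up to the unit g. In the Jacobi–Zariski sequence
surjectivity kills the relative differentials, and injectivity together with smoothness of C over A
kills the relative H₁ of the cotangent complex. So C is étale over the polynomial ring, hence flat.
-/
theorem flat_of_kaehler_coordinates [FormallySmooth A B] [FinitePresentation A B] {κ : Type u}
    [Finite κ] (t : κ → B) (g : B) (F : Ω[B⁄A] →ₗ[B] (κ →₀ B))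
    (hF : ∀ i, F (D A B (t i)) = Finsupp.single i g)
    (hF' : ∀ ω, g • ω = Finsupp.linearCombination B (fun i => D A B (t i)) (F ω))
    (C : Type u) [CommRing C] [Algebra B C] [Algebra A C] [IsScalarTower A B C]
    [IsLocalization.Away g C] :
    (MvPolynomial.aeval (R := A) fun i : κ => algebraMap B C (t i)).toRingHom.Flat := by
  have hBC : FormallyEtale B C := .of_isLocalization (.powers g)
  have : FormallySmooth A C := .comp A B C
  have : FinitePresentation A C := by
    have : FinitePresentation B C := IsLocalization.Away.finitePresentation g
    exact .trans A B C
  let φ : MvPolynomial κ A →ₐ[A] C := MvPolynomial.aeval fun i => algebraMap B C (t i)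
  let : Algebra (MvPolynomial κ A) C := φ.toRingHom.toAlgebra
  have hφ : ∀ i, algebraMap (MvPolynomial κ A) C (.X i) = algebraMap B C (t i) :=
    fun i => MvPolynomial.aeval_X _ i
  have : IsScalarTower A (MvPolynomial κ A) C := .of_algebraMap_eq fun r => (φ.commutes r).symm
  have hu : IsUnit (algebraMap B C g) := IsLocalization.Away.algebraMap_isUnit g
  let l : (κ →₀ B) →ₗ[B] (κ →₀ C) := Finsupp.mapRange.linearMap (Algebra.linearMap B C)
  have hbc := isBaseChange_of_formallyEtale A B C
  let G : Ω[C⁄A] →ₗ[C] (κ →₀ C) := hbc.lift (l ∘ₗ F)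
  have hG : ∀ ω, G (map A A B C ω) = l (F ω) := hbc.lift_eq _
  have hG' : ∀ i, G (D A C (algebraMap B C (t i))) = Finsupp.single i (algebraMap B C g) := by
    intro i
    have := hG (D A B (t i))
    rw [map_D, hF] at this
    simpa [l] using this
  let b : Module.Basis κ C (C ⊗[MvPolynomial κ A] Ω[MvPolynomial κ A⁄A]) :=
    (mvPolynomialBasis A κ).baseChange C
  let Φ := mapBaseChange A (MvPolynomial κ A) C
  have hΦ : ∀ i, Φ (b i) = D A C (algebraMap B C (t i)) := fun i => by
    simp [Φ, b, hφ]
  have hGΦ : G ∘ₗ Φ = algebraMap B C g • b.repr.toLinearMap := b.ext fun i => by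
    simp [hΦ, hG', Algebra.smul_def]
  have hinj : Function.Injective Φ := by
    refine (injective_iff_map_eq_zero _).mpr fun x hx => ?_
    have := LinearMap.congr_fun hGΦ x
    rw [LinearMap.comp_apply, hx, map_zero, LinearMap.smul_apply] at this
    exact b.repr.map_eq_zero_iff.mp ((hu.smul_eq_zero).mp this.symm)
  have hsurj : Function.Surjective Φ := by
    intro x
    suffices h : x ∈ LinearMap.range Φ from h
    induction x using hbc.inductionOn with
    | zero => exact zero_mem _
    | tmul ω =>
      have h := congrArg (map A A B C) (hF' ω)
      rw [map_smul, ← IsScalarTower.algebraMap_smul C] at h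
      refine (Submodule.smul_mem_iff_of_isUnit _ hu).mp ?_
      rw [h, Finsupp.linearCombination_apply, Finsupp.sum, map_sum]
      refine sum_mem fun i _ => ?_
      rw [map_smul, map_D, ← hΦ, ← IsScalarTower.algebraMap_smul C]
      exact Submodule.smul_mem _ _ ⟨_, rfl⟩
    | smul c x hx => exact Submodule.smul_mem _ _ hx
    | add x y hx hy => exact add_mem hx hy
  have : FormallyEtale (MvPolynomial κ A) C := by
    refine ⟨?_, ?_⟩
    · refine subsingleton_of_forall_eq 0 fun x => ?_
      obtain ⟨y, rfl⟩ := KaehlerDifferential.map_surjective A (MvPolynomial κ A) C x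
      obtain ⟨z, rfl⟩ := hsurj y
      exact (exact_mapBaseChange_map A (MvPolynomial κ A) C).apply_apply_eq_zero z
    · refine subsingleton_of_forall_eq 0 fun x => ?_
      have h : H1Cotangent.δ A (MvPolynomial κ A) C x = 0 :=
        hinj (((H1Cotangent.exact_δ_mapBaseChange A (MvPolynomial κ A) C).apply_apply_eq_zero
          x).trans (map_zero _).symm)
      obtain ⟨y, rfl⟩ := (H1Cotangent.exact_map_δ A (MvPolynomial κ A) C x).mp h
      rw [Subsingleton.elim y 0, map_zero]
  have : FinitePresentation (MvPolynomial κ A) C :=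
    .of_restrict_scalars_finitePresentation A _ _
  have : Smooth (MvPolynomial κ A) C := { }
  exact Smooth.flat (MvPolynomial κ A) C

/-- Membership in a monomial ideal is tested on exponents, and multiplication by X_a changes only
the exponent of a. -/
theorem _root_.MvPolynomial.mem_span_X_image_of_X_mul_mem {R κ : Type*} [CommRing R] {s : Set κ}
    {a : κ} (ha : a ∉ s) {r : MvPolynomial κ R}
    (h : MvPolynomial.X a * r ∈ Ideal.span (MvPolynomial.X '' s)) :
    r ∈ Ideal.span (MvPolynomial.X '' s) := by
  rw [MvPolynomial.mem_ideal_span_X_image] at h ⊢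
  intro m hm
  obtain ⟨i, hi, h'⟩ := h (Finsupp.single a 1 + m) (by
    rw [MvPolynomial.mem_support_iff, MvPolynomial.coeff_X_mul]
    exact MvPolynomial.mem_support_iff.mp hm)
  refine ⟨i, hi, ?_⟩
  rwa [Finsupp.add_apply, Finsupp.single_eq_of_ne, zero_add] at h'
  rintro rfl
  exact ha hi

/-- Flat base change of the condition that `a` is a nonzerodivisor modulo an ideal. -/
theorem _root_.Module.Flat.mem_span_image_of_mul_mem {P C κ : Type*} [CommRing P] [CommRing C]
    [Algebra P C] [Module.Flat P C] [Finite κ] (x : κ → P) (a : P)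
    (ha : ∀ r, a * r ∈ Ideal.span (Set.range x) → r ∈ Ideal.span (Set.range x)) (r : C)
    (hr : algebraMap P C a * r ∈ Ideal.span (Set.range fun i => algebraMap P C (x i))) :
    r ∈ Ideal.span (Set.range fun i => algebraMap P C (x i)) := by
  have := Fintype.ofFinite κ
  obtain ⟨c, hc⟩ := (Ideal.mem_span_range_iff_exists_fun).mp hr
  -- The relation a r - ∑ x_i c_i = 0 in the flat module C is, by the equational criterion, a
  -- combination of relations over P. In each of these the coefficient of a lies in the ideal by
  -- `ha`.
  let f : Option κ → P := fun i => i.elim a fun i => -x i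
  let y : Option κ → C := fun i => i.elim r c
  obtain ⟨n, A, z, hA, hA'⟩ := Module.Flat.isTrivialRelation_of_sum_smul_eq_zero (R := P) (M := C) (f := f) (x := y) (by
    rw [Fintype.sum_option]
    simp only [f, y, Option.elim, Algebra.smul_def, map_neg, neg_mul, Finset.sum_neg_distrib, ← hc]
    simp only [mul_comm, add_neg_cancel])
  have h : ∀ j, A none j ∈ Ideal.span (Set.range x) := fun j => by
    refine ha _ ?_
    have := hA' j
    rw [Fintype.sum_option] at this
    simp only [f, Option.elim, neg_mul, Finset.sum_neg_distrib] at this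
    rw [add_neg_eq_zero.mp this]
    exact sum_mem fun i _ => Ideal.mul_mem_right _ _ (Ideal.subset_span ⟨i, rfl⟩)
  have e : r = ∑ j, A none j • z j := hA none
  rw [e]
  refine sum_mem fun j _ => ?_
  rw [Algebra.smul_def]
  refine Ideal.mul_mem_right _ _ ?_
  have := Ideal.mem_map_of_mem (algebraMap P C) (h j)
  rwa [Ideal.map_span, ← Set.range_comp] at this

end Coordinates

end

end Algebra

/-! ### The kernel of a retraction of a smooth algebra: dual bases and coordinates. -/

namespace RingHom

noncomputable section

open KaehlerDifferential

section Retraction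

variable {A B : Type u} [CommRing A] [CommRing B] [Algebra A B] (ρ : B →+* A)
  (hρ : ∀ a, ρ (algebraMap A B a) = a)

variable {ρ}

/-- The projection of `B` onto the kernel of a retraction `ρ : B → A`. -/
def kerProj (b : B) : ker ρ :=
  ⟨b - algebraMap A B (ρ b), by rw [mem_ker, map_sub, hρ, sub_self]⟩

theorem kerProj_add (b c : B) : kerProj hρ (b + c) = kerProj hρ b + kerProj hρ c :=
  Subtype.ext (by simp [kerProj]; ring)

theorem kerProj_algebraMap (a : A) : kerProj hρ (algebraMap A B a) = 0 :=
  Subtype.ext (by simp [kerProj, hρ])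

theorem kerProj_coe (s : ker ρ) : kerProj hρ (s : B) = s :=
  Subtype.ext (by simp [kerProj, mem_ker.mp s.2])

/-- The Leibniz rule: a semilinear map on ker ρ becomes a derivation of B, and so a map on the
differentials. -/
theorem map_kerProj_mul {M : Type*} [AddCommGroup M] [Module A M] (w : ker ρ →ₛₗ[ρ] M) (b c : B) :
    w (kerProj hρ (b * c)) = ρ b • w (kerProj hρ c) + ρ c • w (kerProj hρ b) := by
  have e : kerProj hρ (b * c) = b • kerProj hρ c + algebraMap A B (ρ c) • kerProj hρ b :=
    Subtype.ext (by simp [kerProj, Algebra.smul_def]; ring)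
  rw [e, map_add, map_smulₛₗ, map_smulₛₗ, hρ]

theorem map_kerProj_smul {M : Type*} [AddCommGroup M] [Module A M] (w : ker ρ →ₛₗ[ρ] M) (a : A)
    (b : B) : w (kerProj hρ (a • b)) = a • w (kerProj hρ b) := by
  rw [Algebra.smul_def, map_kerProj_mul, kerProj_algebraMap, map_zero, smul_zero, add_zero, hρ]

/-- The map on differentials induced by a semilinear map on the kernel of a retraction. -/
def kaehlerLift {M : Type u} [AddCommGroup M] [Module A M] (w : ker ρ →ₛₗ[ρ] M) :
    Ω[B⁄A] →ₛₗ[ρ] M :=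
  letI : Module B M := Module.compHom M ρ
  haveI : IsScalarTower A B M := .of_algebraMap_smul fun a m => by
    change ρ (algebraMap A B a) • m = a • m
    rw [hρ]
  let d : Derivation A B M := Derivation.mk'
    { toFun := fun b => w (kerProj hρ b)
      map_add' := fun b c => by rw [kerProj_add, map_add]
      map_smul' := fun a b => map_kerProj_smul hρ w a b } (map_kerProj_mul hρ w)
  { toFun := d.liftKaehlerDifferential
    map_add' := map_add _
    map_smul' := fun b x => map_smul d.liftKaehlerDifferential b x }

theorem kaehlerLift_D {M : Type u} [AddCommGroup M] [Module A M] (w : ker ρ →ₛₗ[ρ] M) (b : B) :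
    kaehlerLift hρ w (D A B b) = w (kerProj hρ b) := by
  let : Module B M := Module.compHom M ρ
  have : IsScalarTower A B M := .of_algebraMap_smul fun a m => by
    change ρ (algebraMap A B a) • m = a • m
    rw [hρ]
  exact Derivation.liftKaehlerDifferential_comp_D _ _

theorem kaehlerLift_D_coe {M : Type u} [AddCommGroup M] [Module A M] (w : ker ρ →ₛₗ[ρ] M)
    (s : ker ρ) : kaehlerLift hρ w (D A B s) = w s := by
  rw [kaehlerLift_D, kerProj_coe]

include hρ in
theorem span_D_ker : Submodule.span B (Set.range fun s : ker ρ => D A B (s : B)) = ⊤ := by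
  rw [eq_top_iff, ← span_range_derivation A B, Submodule.span_le]
  rintro _ ⟨b, rfl⟩
  refine Submodule.subset_span ⟨kerProj hρ b, ?_⟩
  simp [kerProj]

/-- The element t is chosen independently of w. This is the surjectivity of the map from ker ρ to A
⊗ Ω, phrased through semilinear maps. -/
theorem exists_kaehlerLift_eq (x : Ω[B⁄A]) :
    ∃ t : ker ρ, ∀ (M : Type u) [AddCommGroup M] [Module A M] (w : ker ρ →ₛₗ[ρ] M),
      kaehlerLift hρ w x = w t := by
  have hx : x ∈ Submodule.span B (Set.range fun s : ker ρ => D A B (s : B)) := by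
    rw [span_D_ker hρ]; trivial
  induction hx using Submodule.span_induction with
  | mem x hx => obtain ⟨s, rfl⟩ := hx; exact ⟨s, fun M _ _ w => kaehlerLift_D_coe hρ w s⟩
  | zero => exact ⟨0, fun M _ _ w => by rw [map_zero, map_zero]⟩
  | add x y _ _ hx hy =>
    obtain ⟨s, hs⟩ := hx
    obtain ⟨t, ht⟩ := hy
    exact ⟨s + t, fun M _ _ w => by rw [map_add, map_add, hs, ht]⟩
  | smul b x _ hx =>
    obtain ⟨s, hs⟩ := hx
    exact ⟨b • s, fun M _ _ w => by rw [map_smulₛₗ, map_smulₛₗ, hs]⟩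

/-- The semilinear map on the kernel of `ρ` given by a linear form on the differentials. -/
def kerOfKaehler (f : Ω[B⁄A] →ₗ[B] B) : ker ρ →ₛₗ[ρ] A where
  toFun s := ρ (f (D A B s))
  map_add' s t := by simp
  map_smul' b s := by simp [mem_ker.mp s.2]

theorem kerOfKaehler_apply (f : Ω[B⁄A] →ₗ[B] B) (s : ker ρ) :
    kerOfKaehler f s = ρ (f (D A B s)) := rfl

include hρ in
/-- A dual basis of the conormal module of a section of a smooth algebra. -/
theorem exists_ker_dualBasis [Algebra.FormallySmooth A B] [Algebra.FinitePresentation A B] :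
    ∃ (n : ℕ) (t : Fin n → ker ρ) (m : Fin n → (ker ρ →ₛₗ[ρ] A)),
      ∀ (M : Type u) [AddCommGroup M] [Module A M] (w : ker ρ →ₛₗ[ρ] M) (s : ker ρ),
        w s = ∑ i, m i s • w (t i) := by
  -- Finite projectivity of Ω makes it a retract of Bⁿ. The dual basis of this retract is carried to
  -- ker ρ.
  obtain ⟨n, p, i, hp, hi, hpi⟩ := Module.Finite.exists_comp_eq_id_of_projective B Ω[B⁄A]
  choose t ht using fun k : Fin n => exists_kaehlerLift_eq hρ (p (Pi.single k 1))
  refine ⟨n, t, fun k => kerOfKaehler (LinearMap.proj k ∘ₗ i), fun M _ _ w s => ?_⟩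
  rw [← kaehlerLift_D_coe hρ w s]
  have e : D A B (s : B) = ∑ k, i (D A B s) k • p (Pi.single k 1) := by
    conv_lhs => rw [← LinearMap.id_apply (R := B) (D A B (s : B)), ← hpi, LinearMap.comp_apply,
      pi_eq_sum_univ' (i (D A B (s : B))), map_sum]
    simp
  conv_lhs => rw [e, map_sum]
  exact Finset.sum_congr rfl fun k _ => by rw [map_smulₛₗ, ht]; rfl

/-- Functions in the kernel of `ρ` which form a regular sequence and generate it after inverting
`g`, and whose classes in the conormal module have a dual basis there. -/
structure RegularCoordinates (ρ : B →+* A) (κ : Type u) where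
  t : κ → ker ρ
  g : B
  v : κ → (ker ρ →ₛₗ[ρ] A)
  v_self : ∀ i, v i (t i) = ρ g
  v_ne : ∀ i j, i ≠ j → v i (t j) = 0
  mul_mem_span : ∀ s ∈ ker ρ, g * s ∈ Ideal.span (Set.range fun i => (t i : B))
  regular : ∀ (C : Type u) [CommRing C] [Algebra B C] [Module.Flat B C],
    IsUnit (algebraMap B C g) → ∀ (s : Set κ) (a : κ), a ∉ s → ∀ r : C,
    algebraMap B C (t a) * r ∈ Ideal.span (Set.range fun i : s => algebraMap B C (t i)) →
    r ∈ Ideal.span (Set.range fun i : s => algebraMap B C (t i))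

/-- Nakayama at p: after localizing, I ≤ N + I² with I in the maximal ideal, so I ≤ N. Finitely many
generators of I need only one common denominator. -/
theorem exists_mul_mem_of_mul_mem_sup_sq {I N : Ideal B} (hI : I.FG) (hN : N ≤ I) {p : Ideal B}
    [hp : p.IsPrime] (hIp : I ≤ p) {g : B} (hg : g ∉ p) (h : ∀ s ∈ I, g * s ∈ N ⊔ I * I) :
    ∃ h ∉ p, ∀ s ∈ I, h * s ∈ N := by
  let Bp := Localization.AtPrime p
  let f := algebraMap B Bp
  have h₁ : I.map f ≤ N.map f ⊔ I.map f • I.map f := by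
    rw [Ideal.map_le_iff_le_comap]
    intro s hs
    have h₂ := Ideal.mem_map_of_mem f (h s hs)
    rw [Ideal.map_sup, Ideal.map_mul, map_mul] at h₂
    exact (Ideal.unit_mul_mem_iff_mem _
      (IsLocalization.map_units Bp (⟨g, hg⟩ : p.primeCompl))).mp h₂
  have h₂ : I.map f ≤ N.map f := by
    refine Submodule.le_of_le_smul_of_le_jacobson_bot (hI.map f) ?_ h₁
    rw [IsLocalRing.jacobson_eq_maximalIdeal _ bot_ne_top, ← Localization.AtPrime.map_eq_maximalIdeal]
    exact Ideal.map_mono hIp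
  have h₃ : ∀ s ∈ I, ∃ h ∉ p, h * s ∈ N := by
    intro s hs
    obtain ⟨m, hm, h⟩ := (IsLocalization.algebraMap_mem_map_algebraMap_iff p.primeCompl Bp _ _).mp
      (h₂ (Ideal.mem_map_of_mem f hs))
    exact ⟨m, hm, h⟩
  classical
  obtain ⟨S, rfl⟩ := hI
  choose k hk hk' using fun s : S => h₃ s (Ideal.subset_span s.2)
  refine ⟨∏ s, k s, fun hmem => ?_, fun s hs => ?_⟩
  · obtain ⟨s, -, h⟩ := (Ideal.IsPrime.prod_mem_iff).mp hmem
    exact hk s h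
  · induction hs using Submodule.span_induction with
    | mem s hs =>
      obtain ⟨c, hc⟩ := Finset.dvd_prod_of_mem k (Finset.mem_univ ⟨s, hs⟩)
      rw [hc, mul_right_comm]
      exact Ideal.mul_mem_right _ _ (hk' ⟨s, hs⟩)
    | zero => simp
    | add x y _ _ hx hy => rw [mul_add]; exact add_mem hx hy
    | smul b x _ hx => rw [smul_eq_mul, mul_left_comm]; exact Ideal.mul_mem_left _ _ hx

-- The differentials of elements of ker ρ span Ω, so coordinates can be chosen inside the kernel.
-- They generate the kernel modulo its square, hence near p by Nakayama; regularity is inherited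
-- from the variables of a polynomial ring over which the localization is flat.
include hρ in
theorem exists_regularCoordinates [Algebra.FormallySmooth A B] [Algebra.FinitePresentation A B]
    (p : Ideal B) [p.IsPrime] (hp : ker ρ ≤ p) :
    ∃ (κ : Type u) (_ : _root_.Finite κ) (c : RegularCoordinates ρ κ), c.g ∉ p := by
  obtain ⟨κ, hκ, a, g, F, hg, hF, hF'⟩ := Algebra.exists_kaehler_coordinates p
    (fun s : ker ρ => (s : B)) (span_D_ker hρ)
  have := Fintype.ofFinite κ
  have hfg : (ker ρ).FG := by
    let ρ' : B →ₐ[A] A := { ρ with commutes' := hρ }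
    exact Algebra.FinitePresentation.ker_fG_of_surjective ρ' fun x => ⟨algebraMap A B x, hρ x⟩
  let N : Ideal B := Ideal.span (Set.range fun i => (a i : B))
  have hN : N ≤ ker ρ := Ideal.span_le.mpr (by rintro _ ⟨i, rfl⟩; exact (a i).2)
  let w : ker ρ →ₛₗ[ρ] (ker ρ).Cotangent :=
    { toFun := (ker ρ).toCotangent
      map_add' := map_add _
      map_smul' := fun b s => by
        rw [map_smul, ← algebraMap_smul B (ρ b), ← sub_eq_zero, ← sub_smul, ← map_smul]
        exact ((ker ρ).toCotangent_eq_zero _).mpr (by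
          rw [pow_two]
          exact Ideal.mul_mem_mul (kerProj hρ b).2 s.2) }
  obtain ⟨h, hh, hh'⟩ := exists_mul_mem_of_mul_mem_sup_sq hfg hN hp hg (fun s hs => by
    have e := congrArg (kaehlerLift hρ w) (hF' (D A B s))
    rw [map_smulₛₗ, kaehlerLift_D_coe hρ w ⟨s, hs⟩, ← map_smulₛₗ, Finsupp.linearCombination_apply,
      Finsupp.sum_fintype _ _ (by simp), map_sum] at e
    simp only [map_smulₛₗ (kaehlerLift hρ w), kaehlerLift_D_coe] at e
    simp only [← map_smulₛₗ w, ← map_sum] at e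
    rw [← sub_eq_zero, ← map_sub] at e
    have e' := ((ker ρ).toCotangent_eq_zero _).mp e
    rw [pow_two] at e'
    have e'' : g * s = (∑ i, F (D A B s) i * (a i : B)) +
        (g * s - ∑ i, F (D A B s) i * (a i : B)) := by ring
    rw [e'']
    refine add_mem (Ideal.mem_sup_left (sum_mem fun i _ => Ideal.mul_mem_left _ _
      (Ideal.subset_span ⟨i, rfl⟩))) (Ideal.mem_sup_right ?_)
    simpa using e')
  -- Inverting g makes the differentials a basis, and inverting h makes the coordinates generate.
  -- The dual forms are rescaled by ρ h so that their diagonal value is ρ (g h).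
  refine ⟨κ, hκ, ⟨a, g * h, fun i => ρ h • kerOfKaehler (Finsupp.lapply i ∘ₗ F), fun i => ?_,
    fun i j hij => ?_, fun s hs => ?_, ?_⟩, Ideal.IsPrime.mul_notMem ‹_› hg hh⟩
  · simp [kerOfKaehler_apply, hF, mul_comm]
  · simp [kerOfKaehler_apply, hF, hij]
  · rw [mul_assoc]
    exact Ideal.mul_mem_left _ _ (hh' s hs)
  · intro C _ _ _ hu s i hi r hr
    -- C is flat over B_g, which is flat over the polynomial ring, so the regularity of the
    -- variables passes to C.
    let Bg := Localization.Away g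
    have hu' : IsUnit (algebraMap B C g) := isUnit_of_mul_isUnit_left (by rwa [map_mul] at hu)
    have hu'' : ∀ y : Submonoid.powers g, IsUnit (algebraMap B C y) := by
      rintro ⟨_, n, rfl⟩
      rw [map_pow]
      exact hu'.pow n
    let : Algebra Bg C := (IsLocalization.lift hu'' : Bg →+* C).toAlgebra
    have : IsScalarTower B Bg C := .of_algebraMap_eq fun b => (IsLocalization.lift_eq hu'' b).symm
    have : Module.Flat Bg C := (Module.flat_iff_of_isLocalization Bg (Submonoid.powers g) C).mpr ‹_›
    let φ := (MvPolynomial.aeval (R := A) fun i : κ => algebraMap B Bg (a i))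
    let : Algebra (MvPolynomial κ A) Bg := φ.toRingHom.toAlgebra
    have : Module.Flat (MvPolynomial κ A) Bg :=
      Algebra.flat_of_kaehler_coordinates (fun i => (a i : B)) g F hF hF' Bg
    let : Algebra (MvPolynomial κ A) C := ((algebraMap Bg C).comp (algebraMap _ Bg)).toAlgebra
    have : IsScalarTower (MvPolynomial κ A) Bg C := .of_algebraMap_eq fun b => rfl
    have : Module.Flat (MvPolynomial κ A) C := .trans _ Bg _
    have hX : ∀ j, algebraMap (MvPolynomial κ A) C (.X j) = algebraMap B C (a j) := fun j => by
      rw [IsScalarTower.algebraMap_apply _ Bg C, IsScalarTower.algebraMap_apply B Bg C]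
      congr 1
      exact MvPolynomial.aeval_X _ j
    have := Module.Flat.mem_span_image_of_mul_mem (C := C) (fun j : s => (.X j : MvPolynomial κ A))
      (.X i) (fun r hr => by
        have e : Set.range (fun j : s => (.X j : MvPolynomial κ A)) = MvPolynomial.X '' s := by
          ext; simp
        rw [e] at hr ⊢
        exact MvPolynomial.mem_span_X_image_of_X_mul_mem hi hr) r
    simp only [hX] at this
    exact this hr

end Retraction

/-! ### Second-order extension of a tangent vector. -/

section SecondOrder

open Polynomial

theorem _root_.Polynomial.aeval_eps_eq {A : Type*} [CommRing A] (p : A[X]) :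
    aeval (DualNumber.eps : DualNumber A) p =
      TrivSqZeroExt.inl (p.coeff 0) + TrivSqZeroExt.inr (p.coeff 1) := by
  induction p using Polynomial.induction_on' with
  | add p q hp hq =>
    rw [map_add, hp, hq, coeff_add, coeff_add, TrivSqZeroExt.inl_add, TrivSqZeroExt.inr_add]
    abel
  | monomial n a =>
    rw [aeval_monomial]
    match n with
    | 0 => simp [TrivSqZeroExt.algebraMap_eq_inl]
    | 1 => simp [TrivSqZeroExt.algebraMap_eq_inl, coeff_monomial]; ext <;> simp
    | n + 2 => simp [pow_add, pow_two, coeff_monomial]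

variable {A B : Type u} [CommRing A] [CommRing B] [Algebra A B] {ρ : B →+* A}
  (hρ : ∀ a, ρ (algebraMap A B a) = a)

/-- The algebra homomorphism to the dual numbers given by a tangent vector along a section. -/
def dualNumberOfKer (v : ker ρ →ₛₗ[ρ] A) : B →ₐ[A] DualNumber A :=
  AlgHom.ofLinearMap
    { toFun := fun b => TrivSqZeroExt.inl (ρ b) + TrivSqZeroExt.inr (v (kerProj hρ b))
      map_add' := fun b c => by
        rw [map_add, kerProj_add, map_add, TrivSqZeroExt.inl_add, TrivSqZeroExt.inr_add]; abel
      map_smul' := fun a b => by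
        rw [map_kerProj_smul, Algebra.smul_def a b, map_mul, hρ]
        ext <;> simp }
    (by
      have : kerProj hρ 1 = 0 := by simpa using kerProj_algebraMap hρ 1
      ext <;> simp [this])
    (fun b c => by
      simp only [LinearMap.coe_mk, AddHom.coe_mk, map_kerProj_mul]
      ext <;> simp [mul_comm])

/-- A tangent vector along a section of a smooth algebra extends to second order. -/
theorem exists_secondOrder [Algebra.FormallySmooth A B] (v : ker ρ →ₛₗ[ρ] A) :
    ∃ D : B →+ A, ∀ b c,
      D (b * c) = ρ b * D c + v (kerProj hρ b) * v (kerProj hρ c) + D b * ρ c := by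
  -- A[X]/(X³) maps onto the dual numbers with square-zero kernel. Formal smoothness lifts b ↦ ρ(b)
  -- + v(b)ε, and D is the X²-coefficient of the lift; the formula for D(bc) is multiplicativity
  -- read off in that coefficient.
  let J : Ideal A[X] := Ideal.span {X ^ 3}
  let R := A[X] ⧸ J
  have hJ : ∀ p : A[X], p ∈ J ↔ ∀ d < 3, p.coeff d = 0 := fun p => by
    rw [Ideal.mem_span_singleton, X_pow_dvd_iff]
  let π : A[X] →ₐ[A] R := Ideal.Quotient.mkₐ A J
  have hπ : Function.Surjective π := Ideal.Quotient.mkₐ_surjective A J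
  let g : R →ₐ[A] DualNumber A := Ideal.Quotient.liftₐ J (aeval DualNumber.eps) fun p hp => by
    have := (hJ p).mp hp
    rw [aeval_eps_eq, this 0 (by simp), this 1 (by simp)]
    simp
  have hg : ∀ p, g (π p) = TrivSqZeroExt.inl (p.coeff 0) + TrivSqZeroExt.inr (p.coeff 1) :=
    fun p => aeval_eps_eq p
  have hsurj : Function.Surjective g := fun z => ⟨π (C z.fst + C z.snd * X), by
    rw [hg]
    ext <;> simp⟩
  have hnil : IsNilpotent (RingHom.ker (g : R →+* DualNumber A)) := by
    suffices h : RingHom.ker (g : R →+* DualNumber A) * RingHom.ker (g : R →+* DualNumber A) = ⊥ from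
      ⟨2, by rw [show 2 = 1 + 1 from rfl, Submodule.pow_succ, Submodule.pow_one]; exact h⟩
    rw [eq_bot_iff, Ideal.mul_le]
    intro a ha b hb
    obtain ⟨p, rfl⟩ := hπ a
    obtain ⟨q, rfl⟩ := hπ b
    have h : ∀ p, π p ∈ RingHom.ker (g : R →+* DualNumber A) → X ^ 2 ∣ p := fun p hp => by
      have hp' : g (π p) = 0 := hp
      rw [hg] at hp'
      rw [X_pow_dvd_iff]
      intro d hd
      interval_cases d
      · simpa using congrArg TrivSqZeroExt.fst hp'
      · simpa using congrArg TrivSqZeroExt.snd hp'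
    rw [← map_mul]
    refine Ideal.Quotient.eq_zero_iff_mem.mpr (Ideal.mem_span_singleton.mpr ?_)
    exact (pow_dvd_pow X (by norm_num : 3 ≤ 2 + 2)).trans (pow_add (X : A[X]) 2 2 ▸
      mul_dvd_mul (h p ha) (h q hb))
  let φ : B →ₐ[A] R :=
    Algebra.FormallySmooth.liftOfSurjective (dualNumberOfKer hρ v) g hsurj hnil
  have hφ : ∀ b, g (φ b) = dualNumberOfKer hρ v b :=
    Algebra.FormallySmooth.liftOfSurjective_apply _ g hsurj hnil
  choose P hP using fun b => hπ (φ b)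
  have h0 : ∀ b, (P b).coeff 0 = ρ b := fun b => by
    have := (hg (P b)).symm.trans ((congrArg g (hP b)).trans (hφ b))
    simpa [dualNumberOfKer] using congrArg TrivSqZeroExt.fst this
  have h1 : ∀ b, (P b).coeff 1 = v (kerProj hρ b) := fun b => by
    have := (hg (P b)).symm.trans ((congrArg g (hP b)).trans (hφ b))
    simpa [dualNumberOfKer] using congrArg TrivSqZeroExt.snd this
  have h2 : ∀ p q : A[X], π p = π q → p.coeff 2 = q.coeff 2 := fun p q h => by
    have := (hJ (p - q)).mp (Ideal.Quotient.eq.mp h) 2 (by simp)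
    rwa [coeff_sub, sub_eq_zero] at this
  refine ⟨AddMonoidHom.mk' (fun b => (P b).coeff 2) fun b c => ?_, fun b c => ?_⟩
  · rw [← coeff_add]
    exact h2 _ _ (by rw [map_add, hP, hP, hP, map_add])
  · have h : (P (b * c)).coeff 2 = (P b * P c).coeff 2 :=
      h2 _ _ (by rw [map_mul, hP, hP, hP, map_mul])
    change (P (b * c)).coeff 2 = ρ b * (P c).coeff 2 + _ + (P b).coeff 2 * ρ c
    rw [h, coeff_mul, Finset.Nat.sum_antidiagonal_eq_sum_range_succ_mk]
    simp [Finset.sum_range_succ, h0, h1]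

end SecondOrder

end

end RingHom

namespace AlgebraicGeometry.Scheme.Modules
noncomputable section

/-! ### Morphisms on an affine scheme constructed from global sections. -/

section Localizing

variable {X : Scheme.{u}}

theorem exists_basicOpen_le [IsAffine X] {V : X.Opens} {x : X} (hx : x ∈ V) :
    ∃ f : Γ(X, ⊤), X.basicOpen f ≤ V ∧ x ∈ X.basicOpen f := by
  obtain ⟨_, ⟨f, rfl⟩, hxf, hf⟩ := (Opens.isBasis_iff_nbhd.mp (isBasis_basicOpen X)) hx
  exact ⟨f, hf, hxf⟩

theorem isUnit_resFun {f : Γ(X, ⊤)} {V : X.Opens} (h : V ≤ X.basicOpen f) :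
    IsUnit (resFun (le_top : V ≤ ⊤) f) := by
  have := (RingedSpace.isUnit_res_basicOpen X.toRingedSpace f).map (resFun h)
  rw [← resFun_resFun h (le_top : X.basicOpen f ≤ ⊤)]
  exact this

/-- The sections of `M` over basic open subsets are localizations of the global sections. -/
structure IsLocalizing (M : X.Modules) : Prop where
  exists_pow_smul_eq_zero : ∀ (f : Γ(X, ⊤)) (m : Γ(M, ⊤)),
    res M (le_top : X.basicOpen f ≤ ⊤) m = 0 → ∃ n : ℕ, f ^ n • m = 0
  exists_pow_smul_eq : ∀ (f : Γ(X, ⊤)) (s : Γ(M, X.basicOpen f)), ∃ (n : ℕ) (m : Γ(M, ⊤)),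
    res M le_top m = resFun (le_top : X.basicOpen f ≤ ⊤) f ^ n • s

theorem exists_pow_mul_eq_zero [IsAffine X] (f a : Γ(X, ⊤))
    (h : resFun (le_top : X.basicOpen f ≤ ⊤) a = 0) : ∃ n : ℕ, f ^ n * a = 0 := by
  have := (isAffineOpen_top X).isLocalization_basicOpen f
  obtain ⟨⟨_, n, rfl⟩, hc⟩ := (IsLocalization.map_eq_zero_iff (Submonoid.powers f)
    Γ(X, X.basicOpen f) a).mp h
  exact ⟨n, hc⟩

theorem exists_pow_mul_eq [IsAffine X] (f : Γ(X, ⊤)) (s : Γ(X, X.basicOpen f)) :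
    ∃ (n : ℕ) (a : Γ(X, ⊤)), resFun le_top a = resFun (le_top : X.basicOpen f ≤ ⊤) f ^ n * s := by
  have := (isAffineOpen_top X).isLocalization_basicOpen f
  obtain ⟨⟨a, ⟨_, n, rfl⟩⟩, hc⟩ := IsLocalization.surj (Submonoid.powers f) s
  refine ⟨n, a, ?_⟩
  rw [mul_comm, ← map_pow]
  exact hc.symm

theorem isLocalizing_structureSheaf [IsAffine X] : IsLocalizing (structureSheaf X) where
  exists_pow_smul_eq_zero f m h := exists_pow_mul_eq_zero f (toFun m) h
  exists_pow_smul_eq f s := exists_pow_mul_eq f (toFun s)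

/-- Fractions in the kernel lift to M, and their images in N are torsion. So of N only the torsion
half of the condition is needed. -/
theorem isLocalizing_kernel {M N : X.Modules} (p : M ⟶ N) (hM : IsLocalizing M)
    (hN : ∀ (f : Γ(X, ⊤)) (m : Γ(N, ⊤)),
      res N (le_top : X.basicOpen f ≤ ⊤) m = 0 → ∃ n : ℕ, f ^ n • m = 0) :
    IsLocalizing (kernel p) where
  exists_pow_smul_eq_zero f m h := by
    obtain ⟨n, hn⟩ := hM.exists_pow_smul_eq_zero f ((kernel.ι p).app ⊤ m) (by
      rw [← app_res, h, map_zero])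
    refine ⟨n, injective_app_of_mono (kernel.ι p) ⊤ ?_⟩
    rw [Hom.app_smul, hn, map_zero]
  exists_pow_smul_eq f s := by
    obtain ⟨n, m, hm⟩ := hM.exists_pow_smul_eq f ((kernel.ι p).app _ s)
    have h0 : ∀ V (k : Γ(kernel p, V)), p.app V ((kernel.ι p).app V k) = 0 := fun V k =>
      congrArg (fun g : kernel p ⟶ N => g.app V k) (kernel.condition p)
    obtain ⟨k, hk⟩ := hN f (p.app ⊤ m) (by
      rw [← app_res, hm, Hom.app_smul, h0, smul_zero])
    obtain ⟨t, ht⟩ := exists_kernel_ι_app_eq p (f ^ k • m) (by rw [Hom.app_smul, hk])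
    refine ⟨k + n, t, injective_app_of_mono (kernel.ι p) _ ?_⟩
    rw [app_res, ht, res_smul, hm, Hom.app_smul, pow_add, mul_smul, map_pow]

/-- The torsion half for i_*𝒪_X holds because the preimage of D(f) is the basic open subset of the
pulled back function. -/
theorem isLocalizing_idealSheaf {Y : Scheme.{u}} [IsAffine X] [IsAffine Y] (i : X ⟶ Y) :
    IsLocalizing (idealSheaf i) := by
  refine isLocalizing_kernel _ isLocalizing_structureSheaf fun f m h => ?_
  have e : i ⁻¹ᵁ Y.basicOpen f = X.basicOpen (i.app ⊤ f) := by
    exact Scheme.preimage_basicOpen i f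
  have key : ∀ (a : Γ(X, ⊤)) (V : X.Opens) (_ : V = X.basicOpen a) (m : Γ(X, ⊤)),
      resFun (le_top : V ≤ ⊤) m = 0 → ∃ n : ℕ, a ^ n * m = 0 := by
    rintro a _ rfl m h
    exact exists_pow_mul_eq_zero a m h
  obtain ⟨n, hn⟩ := key (show Γ(X, ⊤) from i.app ⊤ f) _ e m h
  refine ⟨n, Eq.trans ?_ hn⟩
  exact congrArg (fun a : Γ(X, ⊤) => a * (show Γ(X, ⊤) from m)) (map_pow (i.app ⊤).hom f n)

variable {M G : X.Modules}

theorem eq_of_resFun_pow_smul_eq {f : Γ(X, ⊤)} {V : X.Opens} (h : V ≤ X.basicOpen f) (n : ℕ)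
    {s t : Γ(G, V)} (e : resFun (le_top : V ≤ ⊤) (f ^ n) • s = resFun (le_top : V ≤ ⊤) (f ^ n) • t) :
    s = t := by
  have hu : IsUnit (resFun (le_top : V ≤ ⊤) (f ^ n)) := by
    rw [map_pow]; exact (isUnit_resFun h).pow n
  exact hu.smul_left_cancel.mp e

variable (φ : Γ(M, ⊤) →ₗ[Γ(X, ⊤)] Γ(G, ⊤))

/-- The condition that the section `n` of `G` is the image of the section `m` of `M` under the
morphism which is `φ` on global sections. -/
def IsLocalValue {V : X.Opens} (m : Γ(M, V)) (n : Γ(G, V)) : Prop :=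
  ∀ W (h : W ≤ V) (b : Γ(M, ⊤)) (c : Γ(X, W)), res M (le_top : W ≤ ⊤) b = c • res M h m →
    res G (le_top : W ≤ ⊤) (φ b) = c • res G h n

theorem IsLocalValue.res {V W : X.Opens} {m : Γ(M, V)} {n : Γ(G, V)} (h : IsLocalValue φ m n)
    (hW : W ≤ V) : IsLocalValue φ (res M hW m) (res G hW n) := by
  intro W' hW' b c e
  rw [res_res] at e ⊢
  exact h W' (hW'.trans hW) b c e

variable [IsAffine X]

theorem IsLocalizing.exists_local_pow_smul_eq (hM : IsLocalizing M) {V : X.Opens} (m : Γ(M, V))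
    {x : X} (hx : x ∈ V) : ∃ (f : Γ(X, ⊤)) (h : X.basicOpen f ≤ V), x ∈ X.basicOpen f ∧
      ∃ (n : ℕ) (b : Γ(M, ⊤)), res M (le_top : X.basicOpen f ≤ ⊤) b =
        resFun (le_top : X.basicOpen f ≤ ⊤) (f ^ n) • res M h m := by
  obtain ⟨f, hf, hxf⟩ := exists_basicOpen_le hx
  obtain ⟨n, b, hb⟩ := hM.exists_pow_smul_eq f (res M hf m)
  exact ⟨f, hf, hxf, n, b, by rw [hb, map_pow]⟩

theorem IsLocalizing.hom_ext (hM : IsLocalizing M) {g g' : M ⟶ G}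
    (h : ∀ m : Γ(M, ⊤), g.app ⊤ m = g'.app ⊤ m) : g = g' := by
  refine hom_ext' fun V m => eq_of_locally_eq G _ _ fun x hx => ?_
  obtain ⟨f, hf, hxf, n, b, hb⟩ := hM.exists_local_pow_smul_eq m hx
  refine ⟨_, hf, hxf, eq_of_resFun_pow_smul_eq le_rfl n ?_⟩
  rw [← app_res, ← app_res, ← Hom.app_smul, ← Hom.app_smul, ← hb, app_res, app_res, h]

theorem IsLocalValue.unique (hM : IsLocalizing M) {V : X.Opens} {m : Γ(M, V)} {n n' : Γ(G, V)}
    (h : IsLocalValue φ m n) (h' : IsLocalValue φ m n') : n = n' := by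
  refine eq_of_locally_eq G _ _ fun x hx => ?_
  obtain ⟨f, hf, hxf, k, b, hb⟩ := hM.exists_local_pow_smul_eq m hx
  exact ⟨_, hf, hxf, eq_of_resFun_pow_smul_eq le_rfl k
    ((h _ hf b _ hb).symm.trans (h' _ hf b _ hb))⟩

/-- Near each point m is a fraction b / f^k with b global, and the value must be φ(b) / f^k. -/
theorem IsLocalValue.exists (hM : IsLocalizing M) {V : X.Opens} (m : Γ(M, V)) :
    ∃ n : Γ(G, V), IsLocalValue φ m n := by
  obtain ⟨n, hn⟩ := exists_glue G (U := V) (fun W h n => IsLocalValue φ (Modules.res M h m) n)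
    (fun W W' hW h s hs => by
      have := hs.res φ h
      rwa [res_res] at this)
    (fun W hW s t hs ht => hs.unique φ hM ht) (fun x hx => by
      obtain ⟨f, hf, hxf, k, b, hb⟩ := hM.exists_local_pow_smul_eq m hx
      have hu : IsUnit (resFun (le_top : X.basicOpen f ≤ ⊤) (f ^ k)) := by
        rw [map_pow]; exact (isUnit_resFun le_rfl).pow k
      obtain ⟨u, hu⟩ := hu
      refine ⟨_, hf, hxf, (↑u⁻¹ : Γ(X, X.basicOpen f)) • Modules.res G le_top (φ b), ?_⟩
      intro W hW b' c hc
      have hb' := congrArg (Modules.res M hW) hb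
      rw [res_smul, resFun_resFun, res_res] at hb'
      have hu' : resFun (le_top : W ≤ ⊤) (f ^ k) • (resFun hW (↑u⁻¹ : Γ(X, X.basicOpen f)) •
          Modules.res G (le_top : W ≤ ⊤) (φ b)) = Modules.res G (le_top : W ≤ ⊤) (φ b) := by
        rw [← resFun_resFun hW (le_top : X.basicOpen f ≤ ⊤), ← hu, smul_smul, ← map_mul,
          Units.mul_inv, map_one, one_smul]
      refine eq_of_resFun_pow_smul_eq hW k ?_
      rw [res_smul, res_res, smul_comm, hu']
      -- To compare with another presentation b' = c m, shrink to D(g), where c also has a numerator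
      -- c'. Then g^l f^k b' - c' b vanishes on D(g), so a power of g kills it globally and φ can be
      -- applied.
      refine eq_of_locally_eq G _ _ fun y hy => ?_
      obtain ⟨g, hg, hyg⟩ := exists_basicOpen_le hy
      obtain ⟨l, c', hc'⟩ := exists_pow_mul_eq g (resFun hg c)
      refine ⟨_, hg, hyg, eq_of_resFun_pow_smul_eq le_rfl l ?_⟩
      have h0 : Modules.res M (le_top : X.basicOpen g ≤ ⊤) ((g ^ l * f ^ k) • b' - c' • b) = 0 := by
        have h1 := congrArg (Modules.res M hg) hc
        have h2 := congrArg (Modules.res M hg) hb'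
        rw [res_smul, res_res] at h1 h2
        rw [map_sub, res_smul, res_smul, h1, h2, hc', sub_eq_zero, map_mul, ← map_pow,
          resFun_resFun, res_res, res_res, smul_smul, smul_smul]
        congr 1; ring
      obtain ⟨j, hj⟩ := hM.exists_pow_smul_eq_zero g _ h0
      have hj' := congrArg (Modules.res G (le_top : X.basicOpen g ≤ ⊤)) (congrArg φ hj)
      rw [_root_.map_smul, res_smul, map_sub, map_zero, map_zero, _root_.map_smul,
        _root_.map_smul] at hj'
      have hj'' := eq_of_resFun_pow_smul_eq le_rfl j (hj'.trans (smul_zero _).symm)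
      rw [map_sub, sub_eq_zero, res_smul, res_smul, hc', map_mul] at hj''
      rw [res_smul, res_smul, resFun_resFun, res_res, res_res, smul_smul, smul_smul, hj'', map_pow])
  refine ⟨n, fun W h b c hc => eq_of_locally_eq G _ _ fun x hx => ?_⟩
  obtain ⟨W', hW', hxW', hP⟩ := hn x (h hx)
  refine ⟨W' ⊓ W, inf_le_right, ⟨hxW', hx⟩, ?_⟩
  have h1 := congrArg (Modules.res M (inf_le_right : W' ⊓ W ≤ W)) hc
  rw [res_smul, res_res, res_res] at h1
  have := hP (W' ⊓ W) inf_le_left b (resFun inf_le_right c) (by rw [h1, res_res])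
  rw [res_smul, res_res, res_res, this, res_res]

/-- Nothing is asked of G, which need not be quasi-coherent. This allows morphisms from the ideal
sheaf to the terms of an injective resolution to be defined by formulas on global sections. -/
theorem IsLocalizing.exists_hom (hM : IsLocalizing M) :
    ∃ g : M ⟶ G, ∀ m, g.app ⊤ m = φ m := by
  choose n hn using fun (V : X.Opens) (m : Γ(M, V)) => IsLocalValue.exists φ hM m
  refine ⟨homMk (fun V =>
    { toFun := n V
      map_add' := fun a b => eq_of_locally_eq G _ _ fun x hx => ?_
      map_smul' := fun r a => eq_of_locally_eq G _ _ fun x hx => ?_ })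
    (fun V W h m => (hn W _).unique φ hM ((hn V m).res φ h)), fun m => ?_⟩
  · obtain ⟨f, hf, hxf⟩ := exists_basicOpen_le hx
    obtain ⟨k, a', ha⟩ := hM.exists_pow_smul_eq f (res M hf a)
    obtain ⟨l, b', hb⟩ := hM.exists_pow_smul_eq f (res M hf b)
    refine ⟨_, hf, hxf, eq_of_resFun_pow_smul_eq le_rfl (k + l) ?_⟩
    rw [← map_pow] at ha hb
    have h1 := hn V a _ hf a' _ ha
    have h2 := hn V b _ hf b' _ hb
    have h3 := hn V (a + b) _ hf (f ^ l • a' + f ^ k • b') (resFun le_top (f ^ (k + l))) (by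
      rw [map_add, map_add, res_smul, res_smul, ha, hb, smul_smul, smul_smul, ← map_mul, ← map_mul,
        ← pow_add, ← pow_add, smul_add, add_comm l k])
    rw [← h3, φ.map_add, φ.map_smul, φ.map_smul, map_add, map_add, res_smul, res_smul,
      h1, h2, smul_smul, smul_smul, ← map_mul, ← map_mul, ← pow_add, ← pow_add, smul_add,
      add_comm l k]
  · obtain ⟨f, hf, hxf⟩ := exists_basicOpen_le hx
    obtain ⟨k, a', ha⟩ := hM.exists_pow_smul_eq f (res M hf a)
    obtain ⟨l, r', hr⟩ := exists_pow_mul_eq f (resFun hf r)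
    refine ⟨_, hf, hxf, eq_of_resFun_pow_smul_eq le_rfl (l + k) ?_⟩
    rw [← map_pow] at ha hr
    have h1 := hn V a _ hf a' _ ha
    have h3 := hn V (r • a) _ hf (r' • a') (resFun le_top (f ^ (l + k))) (by
      rw [res_smul, res_smul, ha, hr, smul_smul, smul_smul, pow_add, map_mul]
      congr 1; ring)
    rw [← h3, _root_.map_smul, res_smul, h1, hr, RingHom.id_apply, res_smul, smul_smul, smul_smul,
      pow_add, map_mul]
    congr 1; ring
  · have := hn ⊤ m ⊤ le_rfl m 1 (by rw [one_smul])
    rw [one_smul, res_self, res_self] at this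
    exact this.symm

end Localizing

/-! ### The ideal sheaf, the conormal sheaf and normal vectors. -/

section NormalSheaf

variable {X Y : Scheme.{u}} (i : X ⟶ Y)

/-- The homomorphism on global functions induced by a morphism of schemes. -/
def globalMap : Γ(Y, ⊤) →+* Γ(X, ⊤) := i.appTop.hom

theorem toPushforward_app (V : Y.Opens) (b : Γ(Y, V)) :
    (toPushforward i).app V (ofFun b) = ofFun (i.app V b) := rfl

/-- Global sections of the ideal sheaf as elements of the kernel on global functions. -/
def idealSections : Γ(idealSheaf i, ⊤) →ₗ[Γ(Y, ⊤)] RingHom.ker (globalMap i) where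
  toFun k := ⟨toFun ((kernel.ι (toPushforward i)).app ⊤ k), RingHom.mem_ker.mpr
    (congrArg (fun g : idealSheaf i ⟶ _ => g.app ⊤ k) (kernel.condition (toPushforward i)))⟩
  map_add' a b := Subtype.ext (map_add ((kernel.ι (toPushforward i)).app ⊤).hom a b)
  map_smul' r a := Subtype.ext (Hom.app_smul (kernel.ι (toPushforward i)) r a)

theorem idealSections_bijective : Function.Bijective (idealSections i) := by
  constructor
  · intro a b e
    exact injective_app_of_mono (kernel.ι (toPushforward i)) ⊤ (congrArg Subtype.val e)
  · intro t
    obtain ⟨k, hk⟩ := exists_kernel_ι_app_eq (toPushforward i) (ofFun (t : Γ(Y, ⊤))) t.2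
    exact ⟨k, Subtype.ext hk⟩

/-- Global sections of the ideal sheaf are the elements of the kernel on global functions. -/
def idealEquiv : Γ(idealSheaf i, ⊤) ≃ₗ[Γ(Y, ⊤)] RingHom.ker (globalMap i) :=
  LinearEquiv.ofBijective _ (idealSections_bijective i)

theorem kernel_ι_idealEquiv_symm (t : RingHom.ker (globalMap i)) :
    (kernel.ι (toPushforward i)).app ⊤ ((idealEquiv i).symm t) = ofFun (t : Γ(Y, ⊤)) :=
  congrArg Subtype.val ((idealEquiv i).apply_symm_apply t)

/-- The canonical morphism from the ideal sheaf to the push-forward of the conormal sheaf. -/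
def conormalUnit : idealSheaf i ⟶ (pushforward i).obj (conormalSheaf i) :=
  (pullbackPushforwardAdjunction i).unit.app (idealSheaf i)

theorem conormalUnit_ext {M : X.Modules} {g g' : conormalSheaf i ⟶ M}
    (h : conormalUnit i ≫ (pushforward i).map g = conormalUnit i ≫ (pushforward i).map g') :
    g = g' := by
  apply ((pullbackPushforwardAdjunction i).homEquiv _ _).injective
  exact (Adjunction.homEquiv_unit _ _ _ _).trans (h.trans (Adjunction.homEquiv_unit _ _ _ _).symm)

theorem exists_conormalUnit_comp_eq {M : X.Modules} (g : idealSheaf i ⟶ (pushforward i).obj M) :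
    ∃ k : conormalSheaf i ⟶ M, conormalUnit i ≫ (pushforward i).map k = g := by
  refine ⟨((pullbackPushforwardAdjunction i).homEquiv _ _).symm g, ?_⟩
  refine Eq.trans ?_ (((pullbackPushforwardAdjunction i).homEquiv _ _).apply_symm_apply g)
  rw [Adjunction.homEquiv_unit]
  rfl

/-- The class in the conormal module of an element of the ideal. -/
def conormalClass : RingHom.ker (globalMap i) →ₛₗ[globalMap i] Γ(conormalSheaf i, ⊤) where
  toFun t := (conormalUnit i).app ⊤ ((idealEquiv i).symm t)
  map_add' a b := by
    rw [map_add]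
    exact map_add ((conormalUnit i).app ⊤).hom _ _
  map_smul' r a := by
    rw [_root_.map_smul]
    exact Hom.app_smul (conormalUnit i) r _

theorem conormalUnit_app (k : Γ(idealSheaf i, ⊤)) :
    (conormalUnit i).app ⊤ k = conormalClass i (idealEquiv i k) :=
  congrArg ((conormalUnit i).app ⊤) ((idealEquiv i).symm_apply_apply k).symm

/-- Evaluation of a section of `ℋom(M, 𝒪)`. -/
def evalSection {M : X.Modules} {U : X.Opens}
    (v : Γ((sheafHom M).obj (structureSheaf X), U)) {V : X.Opens} (h : V ≤ U) :
    Γ(M, V) →ₗ[Γ(X, V)] Γ(X, V) :=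
  sheafHomEval (N := structureSheaf X) v h

theorem evalSection_res {M : X.Modules} {U : X.Opens}
    (v : Γ((sheafHom M).obj (structureSheaf X), U)) {V W : X.Opens} (h : V ≤ U) (h' : W ≤ V)
    (m : Γ(M, V)) : evalSection v (h'.trans h) (res M h' m) = resFun h' (evalSection v h m) :=
  sheafHomEval_res (N := structureSheaf X) v h h' m

theorem evalSection_ext {M : X.Modules} {U : X.Opens}
    {v v' : Γ((sheafHom M).obj (structureSheaf X), U)}
    (h : ∀ V (h : V ≤ U) (m : Γ(M, V)), evalSection v h m = evalSection v' h m) : v = v' :=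
  sheafHomSections_ext' h

/-- The semilinear form on the ideal given by a global section of the normal sheaf. -/
def normalForm (v : Γ(normalSheaf i, ⊤)) : RingHom.ker (globalMap i) →ₛₗ[globalMap i] Γ(X, ⊤) :=
  (evalSection v le_rfl).comp (conormalClass i)

theorem normalForm_apply (v : Γ(normalSheaf i, ⊤)) (t : RingHom.ker (globalMap i)) :
    normalForm i v t = evalSection v le_rfl (conormalClass i t) := rfl

theorem idealToPushforward_eq (v : Γ(normalSheaf i, ⊤)) :
    idealToPushforward i v = conormalUnit i ≫ (pushforward i).map (homOfSheafHomSection v) :=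
  Adjunction.homEquiv_unit _ _ _ _

theorem idealToPushforward_app (v : Γ(normalSheaf i, ⊤)) (k : Γ(idealSheaf i, ⊤)) :
    (idealToPushforward i v).app ⊤ k = ofFun (U := i ⁻¹ᵁ ⊤) (normalForm i v (idealEquiv i k)) := by
  rw [idealToPushforward_eq]
  change (homOfSheafHomSection v).app (i ⁻¹ᵁ ⊤) ((conormalUnit i).app ⊤ k) = _
  rw [conormalUnit_app]
  rfl

theorem idealToPushforward_add (v v' : Γ(normalSheaf i, ⊤)) :
    idealToPushforward i (v + v') = idealToPushforward i v + idealToPushforward i v' := by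
  rw [idealToPushforward_eq, idealToPushforward_eq, idealToPushforward_eq, ← Preadditive.comp_add,
    ← Functor.map_add]
  rfl

/-- Multiplication by a global function on the push-forward of the structure sheaf. -/
def pushforwardSmul (a : Γ(X, ⊤)) :
    (pushforward i).obj (structureSheaf X) ⟶ (pushforward i).obj (structureSheaf X) :=
  (pushforward i).map (smulEnd a _)

theorem pushforwardSmul_globalMap (b : Γ(Y, ⊤)) :
    pushforwardSmul i (globalMap i b) = smulEnd b _ := by
  refine hom_ext' fun V m => ?_
  refine congrArg (fun r : Γ(X, i ⁻¹ᵁ V) => r • (show Γ(structureSheaf X, i ⁻¹ᵁ V) from m)) ?_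
  exact (ConcreteCategory.congr_hom (i.naturality (homOfLE (le_top : V ≤ ⊤)).op) b).symm

theorem smulEnd_one (M : X.Modules) : smulEnd 1 M = 𝟙 M :=
  hom_ext' fun V m => by
    rw [smulEnd_app, map_one, one_smul]
    rfl

theorem smulEnd_mul (a b : Γ(X, ⊤)) (M : X.Modules) :
    smulEnd (a * b) M = smulEnd b M ≫ smulEnd a M :=
  hom_ext' fun V m => by
    rw [smulEnd_app, map_mul, mul_smul]
    rfl

theorem smulEnd_add (a b : Γ(X, ⊤)) (M : X.Modules) :
    smulEnd (a + b) M = smulEnd a M + smulEnd b M :=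
  hom_ext' fun V m => by
    rw [smulEnd_app, map_add, add_smul]
    rfl

theorem smulEnd_zero (M : X.Modules) : smulEnd 0 M = 0 :=
  hom_ext' fun V m => by
    rw [smulEnd_app, map_zero, zero_smul]
    rfl

theorem pushforwardSmul_one : pushforwardSmul i 1 = 𝟙 _ := by
  rw [pushforwardSmul, smulEnd_one, CategoryTheory.Functor.map_id]

theorem pushforwardSmul_mul (a b : Γ(X, ⊤)) :
    pushforwardSmul i (a * b) = pushforwardSmul i b ≫ pushforwardSmul i a := by
  rw [pushforwardSmul, smulEnd_mul, Functor.map_comp]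
  rfl

theorem pushforwardSmul_add (a b : Γ(X, ⊤)) :
    pushforwardSmul i (a + b) = pushforwardSmul i a + pushforwardSmul i b := by
  rw [pushforwardSmul, smulEnd_add, Functor.map_add]
  rfl

theorem pushforwardSmul_zero : pushforwardSmul i 0 = 0 := by
  rw [pushforwardSmul, smulEnd_zero, Functor.map_zero]

theorem idealToPushforward_smul (a : Γ(X, ⊤)) (v : Γ(normalSheaf i, ⊤)) :
    idealToPushforward i (a • v) = idealToPushforward i v ≫ pushforwardSmul i a := by
  rw [idealToPushforward_eq, idealToPushforward_eq, pushforwardSmul, Category.assoc,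
    ← Functor.map_comp]
  rfl

variable [IsAffine X] [IsAffine Y]

/-- The form extends to a morphism from the ideal sheaf by `IsLocalizing.exists_hom`, then to the
conormal sheaf by adjunction. -/
theorem exists_normalForm_eq (m : RingHom.ker (globalMap i) →ₛₗ[globalMap i] Γ(X, ⊤)) :
    ∃ v : Γ(normalSheaf i, ⊤), normalForm i v = m := by
  let φ : Γ(idealSheaf i, ⊤) →ₗ[Γ(Y, ⊤)] Γ((pushforward i).obj (structureSheaf X), ⊤) :=
    { toFun := fun k => ofFun (U := i ⁻¹ᵁ ⊤) (m (idealEquiv i k))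
      map_add' := fun a b => by rw [map_add, map_add]; rfl
      map_smul' := fun r a => by rw [_root_.map_smul, map_smulₛₗ]; rfl }
  obtain ⟨g, hg⟩ := (isLocalizing_idealSheaf i).exists_hom φ
  obtain ⟨k, hk⟩ := exists_conormalUnit_comp_eq i g
  refine ⟨sheafHomOfHom k ⊤, LinearMap.ext fun t => ?_⟩
  have h1 := hg ((idealEquiv i).symm t)
  rw [← hk] at h1
  refine Eq.trans ?_ (h1.trans (congrArg m ((idealEquiv i).apply_symm_apply t)))
  rfl

theorem conormalSheaf_hom_ext {M : X.Modules} {g g' : conormalSheaf i ⟶ M}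
    (h : ∀ t, g.app ⊤ (conormalClass i t) = g'.app ⊤ (conormalClass i t)) : g = g' := by
  refine conormalUnit_ext i ((isLocalizing_idealSheaf i).hom_ext fun k => ?_)
  change g.app (i ⁻¹ᵁ ⊤) ((conormalUnit i).app ⊤ k) = g'.app (i ⁻¹ᵁ ⊤) ((conormalUnit i).app ⊤ k)
  rw [conormalUnit_app]
  exact h _

end NormalSheaf

/-- A finite dual basis of a sheaf of modules. -/
structure DualBasis {X : Scheme.{u}} (M : X.Modules) (ι : Type) [Fintype ι] where
  e : ι → Γ(M, ⊤)
  form : ι → (M ⟶ structureSheaf X)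
  sum_eq : ∀ (U : X.Opens) (m : Γ(M, U)),
    m = ∑ k, toFun ((form k).app U m) • res M (le_top : U ≤ ⊤) (e k)

/-! ### Dual bases of the conormal and normal sheaves. -/

section NormalSheaf

variable {X Y : Scheme.{u}} (i : X ⟶ Y)

theorem hom_sum_app {M N : X.Modules} {ι : Type*} (s : Finset ι) (g : ι → (M ⟶ N)) (U : X.Opens)
    (m : Γ(M, U)) : (∑ k ∈ s, g k).app U m = ∑ k ∈ s, (g k).app U m := by
  classical
  induction s using Finset.induction_on with
  | empty => rfl
  | insert a s ha ih =>
    rw [Finset.sum_insert ha, Finset.sum_insert ha, ← ih]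
    rfl

/-- Evaluation of sections of `ℋom(M, 𝒪)` at a global section of `M`. -/
def evalAt {M : X.Modules} (m : Γ(M, ⊤)) : (sheafHom M).obj (structureSheaf X) ⟶ structureSheaf X :=
  homMk (fun V =>
    { toFun := fun χ => ofFun (evalSection χ le_rfl (res M (le_top : V ≤ ⊤) m))
      map_add' := fun _ _ => rfl
      map_smul' := fun r χ => by
        refine congrArg (fun a : Γ(X, V) => ofFun (a * evalSection χ le_rfl (res M le_top m))) ?_
        exact resFun_self r }) fun V W h χ => by
          refine Eq.trans ?_ (evalSection_res χ le_rfl h _)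
          rw [res_res]
          rfl

theorem evalSection_restrict {M : X.Modules} {U V W : X.Opens}
    (v : Γ((sheafHom M).obj (structureSheaf X), U)) (h : V ≤ U) (h' : W ≤ V) (m : Γ(M, W)) :
    evalSection (res _ h v) h' m = evalSection v (h'.trans h) m := rfl

theorem evalSection_sum {M : X.Modules} {U V : X.Opens} (h : V ≤ U) (m : Γ(M, V)) {ι : Type*}
    (s : Finset ι) (v : ι → Γ((sheafHom M).obj (structureSheaf X), U)) :
    evalSection (∑ k ∈ s, v k) h m = ∑ k ∈ s, evalSection (v k) h m := by
  classical
  induction s using Finset.induction_on with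
  | empty => rfl
  | insert a s ha ih =>
    rw [Finset.sum_insert ha, Finset.sum_insert ha, ← ih]
    rfl

theorem evalSection_smul {M : X.Modules} {U V : X.Opens} (h : V ≤ U) (m : Γ(M, V))
    (r : Γ(X, U)) (v : Γ((sheafHom M).obj (structureSheaf X), U)) :
    evalSection (r • v) h m = resFun h r * evalSection v h m := rfl

/-- The dual of a dual basis. -/
def DualBasis.dual {M : X.Modules} {ι : Type} [Fintype ι] (b : DualBasis M ι) :
    DualBasis ((sheafHom M).obj (structureSheaf X)) ι where
  e k := sheafHomOfHom (b.form k) ⊤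
  form k := evalAt (b.e k)
  sum_eq U χ := evalSection_ext fun V h m => by
    rw [evalSection_sum]
    conv_lhs => rw [b.sum_eq V m]
    rw [map_sum]
    refine Finset.sum_congr rfl fun k _ => ?_
    rw [_root_.map_smul, smul_eq_mul, mul_comm, evalSection_smul]
    refine congrArg₂ (fun x y : Γ(X, V) => x * y) ?_ rfl
    rw [← res_res M h le_top]
    exact evalSection_res χ le_rfl h _

end NormalSheaf

section Smooth

variable {X Y : Scheme.{u}} {i : X ⟶ Y} {π : Y ⟶ X}

theorem globalMap_globalMap (h : i ≫ π = 𝟙 X) (a : Γ(X, ⊤)) :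
    globalMap i (globalMap π a) = a := by
  change (π.appTop ≫ i.appTop) a = a
  rw [← Scheme.Hom.comp_appTop, h]
  simp

theorem evalSection_eq_of_conormalClass {U : X.Opens} {χ χ' : Γ(normalSheaf i, U)}
    {ι : Type} [Fintype ι] (b : DualBasis (conormalSheaf i) ι) (hb : ∀ k, ∃ s, b.e k = conormalClass i s)
    (h : ∀ s, evalSection χ le_rfl (res _ le_top (conormalClass i s)) =
      evalSection χ' le_rfl (res _ le_top (conormalClass i s))) : χ = χ' := by
  refine evalSection_ext fun V hV m => ?_
  rw [b.sum_eq V m, map_sum, map_sum]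
  refine Finset.sum_congr rfl fun k _ => ?_
  obtain ⟨s, hs⟩ := hb k
  rw [_root_.map_smul, _root_.map_smul, hs, ← res_res _ hV le_top, evalSection_res χ le_rfl hV,
    evalSection_res χ' le_rfl hV, h]

variable [IsAffine X] [IsAffine Y]

/-- The algebraic identity w(s) = ∑ m_k(s) w(t_k), taken for w = `conormalClass i`, decomposes the
identity of the conormal sheaf, since morphisms out of that sheaf are determined on the classes of
global elements of the ideal. -/
theorem exists_dualBasis_conormalSheaf (h : i ≫ π = 𝟙 X)
    (hs : (globalMap π).FormallySmooth) (hp : (globalMap π).FinitePresentation) :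
    ∃ (n : ℕ) (b : DualBasis (conormalSheaf i) (Fin n)), ∀ k, ∃ s, b.e k = conormalClass i s := by
  algebraize [globalMap π]
  obtain ⟨n, t, m, ht⟩ := RingHom.exists_ker_dualBasis (ρ := globalMap i)
    (fun a => globalMap_globalMap h a)
  choose v hv using fun k => exists_normalForm_eq i (m k)
  have key : 𝟙 (conormalSheaf i) =
      ∑ k, homOfSheafHomSection (v k) ≫ homOfSection (conormalClass i (t k)) := by
    refine conormalSheaf_hom_ext i fun s => ?_
    rw [hom_sum_app]
    refine (ht _ (conormalClass i) s).trans (Finset.sum_congr rfl fun k _ => ?_)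
    rw [← hv]
    refine congrArg (fun c : Γ(conormalSheaf i, ⊤) => normalForm i (v k) s • c) ?_
    exact (res_self _ _).symm
  refine ⟨n, ⟨fun k => conormalClass i (t k), fun k => homOfSheafHomSection (v k), fun U c => ?_⟩,
    fun k => ⟨t k, rfl⟩⟩
  refine (congrArg (fun g : conormalSheaf i ⟶ _ => g.app U c) key).trans ?_
  rw [hom_sum_app]
  rfl

/-- The v_k are dual to the t_k up to g, so they span the normal sheaf where g is invertible. It is
enough to test on classes of elements s of the ideal: writing g s = ∑ r_k t_k and applying v_k
identifies g v_k(s) with g r_k on X. -/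
theorem smul_eq_sum_of_regularCoordinates (h : i ≫ π = 𝟙 X)
    (hs : (globalMap π).FormallySmooth) (hp : (globalMap π).FinitePresentation)
    {κ : Type u} [Fintype κ] (c : RingHom.RegularCoordinates (globalMap i) κ)
    (v : κ → Γ(normalSheaf i, ⊤)) (hv : ∀ k, normalForm i (v k) = c.v k) {U : X.Opens}
    (hU : IsUnit (resFun (le_top : U ≤ ⊤) (globalMap i c.g))) (χ : Γ(normalSheaf i, U)) :
    resFun (le_top : U ≤ ⊤) (globalMap i c.g) • χ =
      ∑ k, evalSection χ le_rfl (res _ (le_top : U ≤ ⊤) (conormalClass i (c.t k))) •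
        res _ (le_top : U ≤ ⊤) (v k) := by
  obtain ⟨n, b, hb⟩ := exists_dualBasis_conormalSheaf h hs hp
  refine evalSection_eq_of_conormalClass b hb fun s => hU.mul_left_cancel ?_
  obtain ⟨r, hr⟩ := (Ideal.mem_span_range_iff_exists_fun).mp (c.mul_mem_span s s.2)
  have e : c.g • s = ∑ k, r k • c.t k := Subtype.ext (hr.symm.trans (by
    simp))
  have e₁ := congrArg (conormalClass i) e
  rw [map_sum, map_smulₛₗ] at e₁
  simp only [map_smulₛₗ] at e₁
  have e₂ : ∀ k, globalMap i c.g * normalForm i (v k) s =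
      globalMap i c.g * globalMap i (r k) := fun k => by
    have e₂ := congrArg (normalForm i (v k)) e
    rw [map_sum, map_smulₛₗ] at e₂
    simp only [map_smulₛₗ] at e₂
    rw [Finset.sum_eq_single k] at e₂
    · rw [hv, c.v_self, smul_eq_mul, smul_eq_mul, mul_comm (globalMap i (r k))] at e₂
      rw [hv]
      exact e₂
    · intro j _ hj
      rw [hv, c.v_ne _ _ hj.symm, smul_zero]
    · simp
  have e₃ := congrArg (fun m => evalSection χ le_rfl (res _ (le_top : U ≤ ⊤) m)) e₁
  simp only [map_sum, res_smul, _root_.map_smul, smul_eq_mul] at e₃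
  rw [evalSection_smul, evalSection_sum, resFun_self, e₃, Finset.mul_sum, Finset.mul_sum]
  refine Finset.sum_congr rfl fun k _ => ?_
  rw [evalSection_smul, resFun_self, evalSection_restrict, evalSection_res (v k) le_rfl le_top,
    ← normalForm_apply, mul_left_comm _ (evalSection χ _ _), ← map_mul, e₂, map_mul]
  ring

theorem exists_dualBasis_normalSheaf (h : i ≫ π = 𝟙 X)
    (hs : (globalMap π).FormallySmooth) (hp : (globalMap π).FinitePresentation) :
    ∃ n, Nonempty (DualBasis (normalSheaf i) (Fin n)) := by
  obtain ⟨n, b, -⟩ := exists_dualBasis_conormalSheaf h hs hp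
  exact ⟨n, ⟨b.dual⟩⟩

end Smooth

/-! ### Exterior powers of modules with a dual basis, indexed by sublists. -/

section ExteriorPowerAlgebra

open Set

variable {R : Type*} [CommRing R] {M : Type*} [AddCommGroup M] [Module R M]

/-- The dual basis makes M a retract of Rⁿ, hence ⋀^q M a retract of ⋀^q Rⁿ, where the standard
basis is available. -/
theorem exteriorPower_eq_sum {n : ℕ} (e : Fin n → M) (l : Fin n → Module.Dual R M)
    (h : ∀ m, m = ∑ k, l k m • e k) (q : ℕ) (x : ⋀[R]^q M) :
    x = ∑ s : powersetCard (Fin n) q,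
      _root_.exteriorPower.pairingDual R M q (_root_.exteriorPower.ιMulti_family R q l s) x •
        _root_.exteriorPower.ιMulti_family R q e s := by
  let f : M →ₗ[R] Fin n → R := LinearMap.pi l
  let g : (Fin n → R) →ₗ[R] M := Fintype.linearCombination R e
  have hgf : g ∘ₗ f = LinearMap.id := LinearMap.ext fun m => (h m).symm
  let b := Pi.basisFun R (Fin n)
  have hx : _root_.exteriorPower.map q g (_root_.exteriorPower.map q f x) = x := by
    rw [← LinearMap.comp_apply, ← _root_.exteriorPower.map_comp, hgf, _root_.exteriorPower.map_id]
    rfl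
  conv_lhs => rw [← hx, ← (b.exteriorPower q).sum_repr (_root_.exteriorPower.map q f x)]
  rw [map_sum]
  refine Finset.sum_congr rfl fun s _ => ?_
  rw [_root_.map_smul, _root_.exteriorPower.basis_apply, _root_.exteriorPower.basis_repr_apply,
    _root_.exteriorPower.map_apply_ιMulti_family]
  congr 1
  · refine LinearMap.congr_fun (f := _root_.exteriorPower.ιMultiDual R q b s ∘ₗ
      _root_.exteriorPower.map q f) (_root_.exteriorPower.linearMap_ext ?_) x
    ext m
    simp [_root_.exteriorPower.ιMulti_family, _root_.exteriorPower.pairingDual_ιMulti_ιMulti, f, b]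
  · congr 1
    ext k
    simp [g, b]

theorem SublistIdx.length_toList {α : Type} : ∀ {l : List α} {q : ℤ} (j : SublistIdx l q),
    (j.toList.length : ℤ) = q
  | [], _, j => (show PLift _ from j).down.symm
  | _ :: _, _, .inl j => SublistIdx.length_toList j
  | a :: _, _, .inr j => by
    have := SublistIdx.length_toList j
    change ((a :: j.toList).length : ℤ) = _
    rw [List.length_cons]
    push_cast
    omega

theorem SublistIdx.exists_toList_eq {α : Type} {l L : List α} (h : L.Sublist l) :
    ∀ q : ℤ, L.length = q → ∃ j : SublistIdx l q, j.toList = L := by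
  induction h with
  | slnil => exact fun q hq => ⟨⟨by simpa using hq.symm⟩, rfl⟩
  | cons a _ ih =>
    intro q hq
    obtain ⟨j, hj⟩ := ih q hq
    exact ⟨.inl j, hj⟩
  | cons_cons a _ ih =>
    intro q hq
    obtain ⟨j, hj⟩ := ih (q - 1) (by rw [List.length_cons] at hq; push_cast at hq; omega)
    exact ⟨.inr j, congrArg (a :: ·) hj⟩

/-- The vector underlying an index for a sublist. -/
def SublistIdx.vec {α : Type} {l : List α} {q : ℕ} (j : SublistIdx l (q : ℤ)) : Fin q → α :=
  fun k => j.toList.get (k.cast (by exact_mod_cast j.length_toList.symm))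

theorem SublistIdx.ofFn_vec {α : Type} {l : List α} {q : ℕ} (j : SublistIdx l (q : ℤ)) :
    List.ofFn j.vec = j.toList := by
  have h : q = j.toList.length := by exact_mod_cast j.length_toList.symm
  refine List.ext_get (by rw [List.length_ofFn]; exact h) fun k _ _ => ?_
  simp [SublistIdx.vec]

/-- Increasing q-tuples are the sublists of length q of 0, …, n - 1. This matches the basis of the
exterior power with the indices of the Koszul cocycles. -/
theorem SublistIdx.exists_vec_eq {n q : ℕ} (J : Fin q ↪o Fin n) :
    ∃ j : SublistIdx (List.finRange n) (q : ℤ), j.vec = J := by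
  have h : (List.ofFn J).Sublist (List.finRange n) := by
    refine List.sublist_of_subperm_of_sortedLE
      (List.subperm_of_subset (List.nodup_ofFn.mpr J.injective) fun _ _ => List.mem_finRange _)
      ?_ ?_
    · exact List.sortedLE_ofFn_iff.mpr J.monotone
    · rw [← List.ofFn_id]
      exact List.sortedLE_ofFn_iff.mpr monotone_id
  obtain ⟨j, hj⟩ := exists_toList_eq h q (by simp)
  refine ⟨j, List.ofFn_injective ?_⟩
  rw [j.ofFn_vec, hj]

theorem exteriorPower_span_sublistIdx {n : ℕ} (v : Fin n → M) (hv : Submodule.span R (range v) = ⊤)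
    (q : ℕ) (x : ⋀[R]^q M) : ∃ r : SublistIdx (List.finRange n) (q : ℤ) → R,
      x = ∑ j, r j • _root_.exteriorPower.ιMulti R q (fun k => v (j.vec k)) := by
  have hx : x ∈ Submodule.span R (range fun j : SublistIdx (List.finRange n) (q : ℤ) =>
      _root_.exteriorPower.ιMulti R q (fun k => v (j.vec k))) := by
    have h := _root_.exteriorPower.ιMulti_family_span_of_span R (n := q) hv
    refine Submodule.span_mono ?_ (h.ge (Submodule.mem_top (x := x)))
    rintro _ ⟨s, rfl⟩
    obtain ⟨j, hj⟩ := SublistIdx.exists_vec_eq (powersetCard.ofFinEmbEquiv.symm s)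
    refine ⟨j, ?_⟩
    change _root_.exteriorPower.ιMulti R q (v ∘ j.vec) = _
    rw [hj]
    rfl
  obtain ⟨r, hr⟩ := (Submodule.mem_span_range_iff_exists_fun R).mp hx
  exact ⟨r, hr.symm⟩

end ExteriorPowerAlgebra

/-! ### Exterior powers of sheaves of modules. -/

section ExteriorPowerSheaf

variable {X : Scheme.{u}} {M N : X.Modules}

/-- The morphism from the associated sheaf induced by a morphism from a presheaf. -/
def assocDesc {P : X.PresheafOfModules} (f : P ⟶ N.val) : assocSheaf P ⟶ N :=
  ((PresheafOfModules.sheafificationAdjunction (𝟙 X.ringCatSheaf.obj)).homEquiv P N).symm f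

theorem toAssocSheaf_desc {P : X.PresheafOfModules} (f : P ⟶ N.val) :
    toAssocSheaf P ≫ (assocDesc f).val = f := by
  have := ((PresheafOfModules.sheafificationAdjunction
    (𝟙 X.ringCatSheaf.obj)).homEquiv P N).apply_symm_apply f
  exact (Adjunction.homEquiv_unit _ _ _ _).symm.trans this

theorem assocDesc_app {P : X.PresheafOfModules} (f : P ⟶ N.val) {U : X.Opens}
    (s : P.obj (.op U)) :
    (assocDesc f).app U ((toAssocSheaf P).app (.op U) s) = f.app (.op U) s :=
  congrArg (fun k : P ⟶ N.val => k.app (.op U) s) (toAssocSheaf_desc f)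

/-- The section of `⋀^q M` over an open subset given by an element of the exterior power of the
sections of `M`. -/
def exteriorSection (M : X.Modules) (q : ℕ) (U : X.Opens) :
    ⋀[Γ(X, U)]^q Γ(M, U) →ₗ[Γ(X, U)] Γ(exteriorPower M q, U) :=
  ((toAssocSheaf (exteriorPowerPresheaf M q)).app (.op U)).hom

theorem res_exteriorSection (q : ℕ) {U V : X.Opens} (h : V ≤ U) (x : ⋀[Γ(X, U)]^q Γ(M, U)) :
    res _ h (exteriorSection M q U x) =
      exteriorSection M q V (exteriorPowerRestrict M q (homOfLE h) x) :=
  (PresheafOfModules.naturality_apply (toAssocSheaf (exteriorPowerPresheaf M q))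
    (homOfLE h).op x).symm

theorem exists_local_exteriorSection_eq (q : ℕ) {U : X.Opens} (s : Γ(exteriorPower M q, U)) {x : X}
    (hx : x ∈ U) : ∃ (V : X.Opens) (h : V ≤ U), x ∈ V ∧ ∃ t, exteriorSection M q V t = res _ h s :=
  exists_local_toAssocSheaf_eq _ s hx

theorem res_exteriorSection_ιMulti (q : ℕ) {U V : X.Opens} (h : V ≤ U) (m : Fin q → Γ(M, U)) :
    res _ h (exteriorSection M q U (_root_.exteriorPower.ιMulti _ q m)) =
      exteriorSection M q V (_root_.exteriorPower.ιMulti _ q fun k => res M h (m k)) :=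
  (res_exteriorSection q h _).trans
    (congrArg (exteriorSection M q V) (exteriorPowerMap_ιMulti _ _ _ _))

theorem wedge_eq {q : ℕ} (s : Fin q → Γ(M, ⊤)) :
    wedge M s = exteriorSection M q ⊤ (_root_.exteriorPower.ιMulti _ q s) := rfl

theorem res_wedge {q : ℕ} (s : Fin q → Γ(M, ⊤)) (U : X.Opens) :
    res _ (le_top : U ≤ ⊤) (wedge M s) = exteriorSection M q U
      (_root_.exteriorPower.ιMulti _ q fun k => res M (le_top : U ≤ ⊤) (s k)) :=
  res_exteriorSection_ιMulti q le_top s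

/-- The linear form on sections given by a morphism to the structure sheaf. -/
def formAt (l : M ⟶ structureSheaf X) (U : X.Opens) : Module.Dual Γ(X, U) Γ(M, U) :=
  sheafHomEval (sheafHomOfHom l ⊤) le_top

theorem formAt_res (l : M ⟶ structureSheaf X) {U V : X.Opens} (h : V ≤ U) (m : Γ(M, U)) :
    formAt l V (res M h m) = resFun h (formAt l U m) := app_res l h m

/-- The linear form `m₁ ∧ ⋯ ∧ m_q ↦ det (l_j m_k)` on the exterior power of sections. -/
def exteriorFormAt {q : ℕ} (l : Fin q → (M ⟶ structureSheaf X)) (U : X.Opens) :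
    Module.Dual Γ(X, U) (⋀[Γ(X, U)]^q Γ(M, U)) :=
  _root_.exteriorPower.pairingDual _ _ q (_root_.exteriorPower.ιMulti _ q fun k => formAt (l k) U)

theorem exteriorFormAt_ιMulti {q : ℕ} (l : Fin q → (M ⟶ structureSheaf X)) (U : X.Opens)
    (m : Fin q → Γ(M, U)) : exteriorFormAt l U (_root_.exteriorPower.ιMulti _ q m) =
      (Matrix.of fun j k => formAt (l k) U (m j)).det :=
  _root_.exteriorPower.pairingDual_ιMulti_ιMulti _ _

theorem exteriorFormAt_restrict {q : ℕ} (l : Fin q → (M ⟶ structureSheaf X)) {U V : X.Opens}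
    (h : V ≤ U) (x : ⋀[Γ(X, U)]^q Γ(M, U)) :
    exteriorFormAt l V (exteriorPowerRestrict M q (homOfLE h) x) =
      resFun h (exteriorFormAt l U x) := by
  refine DFunLike.congr_fun (exteriorPower_addHom_ext
    ((exteriorFormAt l V).toAddMonoidHom.comp
      (exteriorPowerRestrict M q (homOfLE h)).toAddMonoidHom)
    ((resFun h).toAddMonoidHom.comp (exteriorFormAt l U).toAddMonoidHom) (fun m => ?_)
      fun r x e => ?_) x
  · change exteriorFormAt l V (exteriorPowerRestrict M q (homOfLE h)
      (_root_.exteriorPower.ιMulti _ q m)) = resFun h (exteriorFormAt l U _)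
    have e : exteriorPowerRestrict M q (homOfLE h) (_root_.exteriorPower.ιMulti _ q m) =
        _root_.exteriorPower.ιMulti _ q fun k => res M h (m k) := exteriorPowerMap_ιMulti _ _ _ _
    rw [e, exteriorFormAt_ιMulti, exteriorFormAt_ιMulti, RingHom.map_det]
    congr 1
    ext j k
    exact formAt_res (l k) h (m j)
  · change exteriorFormAt l V (exteriorPowerRestrict M q (homOfLE h) (r • x)) =
      resFun h (exteriorFormAt l U (r • x))
    change exteriorFormAt l V (exteriorPowerRestrict M q (homOfLE h) x) =
      resFun h (exteriorFormAt l U x) at e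
    rw [(exteriorFormAt l U).map_smul, smul_eq_mul, map_mul, ← e]
    exact (congrArg (exteriorFormAt l V)
      ((exteriorPowerRestrict M q (homOfLE h)).map_smulₛₗ r x)).trans
      ((exteriorFormAt l V).map_smul _ _)

/-- The morphism `⋀^q M ⟶ 𝒪`, `m₁ ∧ ⋯ ∧ m_q ↦ det (l_j m_k)`. -/
def exteriorForm {q : ℕ} (l : Fin q → (M ⟶ structureSheaf X)) :
    exteriorPower M q ⟶ structureSheaf X :=
  assocDesc (PresheafOfModules.homMk (M₁ := exteriorPowerPresheaf M q)
    (M₂ := (structureSheaf X).val)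
    { app := fun U => AddCommGrpCat.ofHom (exteriorFormAt l U.unop).toAddMonoidHom
      naturality := fun U V h => by
        ext x
        exact exteriorFormAt_restrict l h.unop.le x }
    fun U r x => (exteriorFormAt l U.unop).map_smul r x)

theorem exteriorForm_app {q : ℕ} (l : Fin q → (M ⟶ structureSheaf X)) {U : X.Opens}
    (x : ⋀[Γ(X, U)]^q Γ(M, U)) :
    (exteriorForm l).app U (exteriorSection M q U x) = ofFun (exteriorFormAt l U x) :=
  assocDesc_app _ _

theorem toFun_app_res (l : M ⟶ structureSheaf X) {U V : X.Opens} (h : V ≤ U) (m : Γ(M, U)) :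
    toFun (l.app V (res M h m)) = resFun h (toFun (l.app U m)) := app_res l h m

/-- The dual basis of the exterior powers. -/
def DualBasis.exteriorPower {n : ℕ} (b : DualBasis M (Fin n)) (q : ℕ) :
    DualBasis (exteriorPower M q) (Set.powersetCard (Fin n) q) where
  e s := wedge M (b.e ∘ Set.powersetCard.ofFinEmbEquiv.symm s)
  form s := exteriorForm (b.form ∘ Set.powersetCard.ofFinEmbEquiv.symm s)
  sum_eq U x := by
    refine eq_of_locally_eq _ _ _ fun y hy => ?_
    obtain ⟨V, h, hyV, t, ht⟩ := exists_local_exteriorSection_eq q x hy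
    refine ⟨V, h, hyV, ?_⟩
    rw [map_sum, ← ht]
    conv_lhs => rw [exteriorPower_eq_sum (fun k => res M (le_top : V ≤ ⊤) (b.e k))
      (fun k => formAt (b.form k) V) (b.sum_eq V) q t, map_sum]
    refine Finset.sum_congr rfl fun s _ => ?_
    rw [_root_.map_smul, res_smul, res_res, res_wedge, ← toFun_app_res, ← ht, exteriorForm_app]
    rfl

theorem exists_local_eq_sum_wedge {n : ℕ} (v : Fin n → Γ(M, ⊤)) {U : X.Opens}
    (hv : ∀ V ≤ U, Submodule.span Γ(X, V) (Set.range fun k => res M (le_top : V ≤ ⊤) (v k)) = ⊤)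
    (q : ℕ) (s : Γ(exteriorPower M q, U)) {x : X} (hx : x ∈ U) :
    ∃ (V : X.Opens) (h : V ≤ U), x ∈ V ∧
      ∃ r : SublistIdx (List.finRange n) (q : ℤ) → Γ(X, V),
        res _ h s = ∑ j, r j • res _ (le_top : V ≤ ⊤) (wedge M fun k => v (j.vec k)) := by
  obtain ⟨V, h, hxV, t, ht⟩ := exists_local_exteriorSection_eq q s hx
  obtain ⟨r, hr⟩ := exteriorPower_span_sublistIdx _ (hv V h) q t
  refine ⟨V, h, hxV, r, ?_⟩
  rw [← ht, hr, map_sum]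
  refine Finset.sum_congr rfl fun j _ => ?_
  rw [_root_.map_smul, res_wedge]

end ExteriorPowerSheaf

/-! ### Yoneda products at the level of cocycles. -/

section YonedaProduct

variable {C : Type*} [Category* C] [Abelian C] {S F : C} {p : S ⟶ F} {J : CochainComplex C ℤ}

/-- The cocycle `z` represents the Yoneda product of the class of the pushout along `v` of the
extension `0 ⟶ kernel p ⟶ S ⟶ F ⟶ 0` and the class of the cocycle `z'`. -/
def IsYonedaProduct (v : kernel p ⟶ F) {q' q : ℤ} (z' : F ⟶ J.X q') (z : F ⟶ J.X q) : Prop :=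
  -- ψ extends v ≫ z' from the kernel to S; its coboundary vanishes on the kernel when z' is a
  -- cocycle, and there it descends to z.
  ∃ ψ : S ⟶ J.X q', kernel.ι p ≫ ψ = v ≫ z' ∧ ψ ≫ J.d q' q = p ≫ z

theorem exists_epi_factor [Epi p] {N : C} (g : S ⟶ N) (h : kernel.ι p ≫ g = 0) :
    ∃ x : F ⟶ N, p ≫ x = g :=
  ⟨Abelian.epiDesc p g h, Abelian.comp_epiDesc p g h⟩

namespace IsYonedaProduct

variable {v w : kernel p ⟶ F} {q'' q' q : ℤ} {z' y' : F ⟶ J.X q'} {z y : F ⟶ J.X q}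

theorem comp_d [Epi p] (h : IsYonedaProduct v z' z) (r : ℤ) : z ≫ J.d q r = 0 := by
  obtain ⟨ψ, -, hψ⟩ := h
  rw [← cancel_epi p, ← Category.assoc, ← hψ]
  simp

theorem add (h : IsYonedaProduct v z' z) (h' : IsYonedaProduct v y' y) :
    IsYonedaProduct v (z' + y') (z + y) := by
  obtain ⟨ψ, h₁, h₂⟩ := h
  obtain ⟨φ, h₃, h₄⟩ := h'
  exact ⟨ψ + φ, by simp [h₁, h₃], by simp [h₂, h₄]⟩

theorem sub (h : IsYonedaProduct v z' z) (h' : IsYonedaProduct v y' y) :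
    IsYonedaProduct v (z' - y') (z - y) := by
  obtain ⟨ψ, h₁, h₂⟩ := h
  obtain ⟨φ, h₃, h₄⟩ := h'
  exact ⟨ψ - φ, by simp [h₁, h₃], by simp [h₂, h₄]⟩

theorem add_left (h : IsYonedaProduct v z' z) (h' : IsYonedaProduct w z' y) :
    IsYonedaProduct (v + w) z' (z + y) := by
  obtain ⟨ψ, h₁, h₂⟩ := h
  obtain ⟨φ, h₃, h₄⟩ := h'
  exact ⟨ψ + φ, by simp [h₁, h₃], by simp [h₂, h₄]⟩

theorem comp_left {a : F ⟶ F} (h : IsYonedaProduct v (a ≫ z') z) :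
    IsYonedaProduct (v ≫ a) z' z := by
  obtain ⟨ψ, h₁, h₂⟩ := h
  exact ⟨ψ, by rw [h₁, Category.assoc], h₂⟩

theorem comp {a : F ⟶ F} {b : S ⟶ S} {c : kernel p ⟶ kernel p} (hb : b ≫ p = p ≫ a)
    (hc : c ≫ kernel.ι p = kernel.ι p ≫ b) (hv : c ≫ v = v ≫ a) (h : IsYonedaProduct v z' z) :
    IsYonedaProduct v (a ≫ z') (a ≫ z) := by
  obtain ⟨ψ, h₁, h₂⟩ := h
  refine ⟨b ≫ ψ, ?_, ?_⟩
  · rw [← Category.assoc, ← hc, Category.assoc, h₁, ← Category.assoc, hv, Category.assoc]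
  · rw [Category.assoc, h₂, ← Category.assoc, hb, Category.assoc]

variable [Epi p] (hJ : ∀ n, CategoryTheory.Injective (J.X n))

include hJ

theorem exists_of_comp_d_eq_zero (v : kernel p ⟶ F) (z' : F ⟶ J.X q') (h : z' ≫ J.d q' q = 0) :
    ∃ z : F ⟶ J.X q, IsYonedaProduct v z' z := by
  have := hJ q'
  obtain ⟨z, hz⟩ := exists_epi_factor (p := p)
    (CategoryTheory.Injective.factorThru (v ≫ z') (kernel.ι p) ≫ J.d q' q) (by simp [h])
  exact ⟨z, _, CategoryTheory.Injective.comp_factorThru _ _, hz.symm⟩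

/-- If ψ restricts to a coboundary on the kernel, extend a primitive G of it to S. Subtracting the
coboundary of the extension from ψ gives a map which descends to F and has coboundary z. This yields
both the independence of representatives and the vanishing of squares. -/
theorem exists_eq_of_exists {H : kernel p ⟶ J.X q'} (hH : H ≫ J.d q' q = 0)
    {ψ : S ⟶ J.X q'} (hψ : ψ ≫ J.d q' q = p ≫ z) (h : kernel.ι p ≫ ψ = H)
    (hH' : ∃ G : kernel p ⟶ J.X q'', G ≫ J.d q'' q' = H) : ∃ x : F ⟶ J.X q', z = x ≫ J.d q' q := by
  obtain ⟨G, rfl⟩ := hH'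
  have := hJ q''
  let g := CategoryTheory.Injective.factorThru G (kernel.ι p)
  obtain ⟨x, hx⟩ := exists_epi_factor (p := p) (ψ - g ≫ J.d q'' q') (by
    rw [Preadditive.comp_sub, h, ← Category.assoc, CategoryTheory.Injective.comp_factorThru,
      sub_self])
  refine ⟨x, ?_⟩
  rw [← cancel_epi p, ← Category.assoc, hx, ← hψ]
  simp

theorem exists_eq_of_coboundary (h : IsYonedaProduct v z' z) (x' : F ⟶ J.X q'')
    (hx' : z' = x' ≫ J.d q'' q') : ∃ x : F ⟶ J.X q', z = x ≫ J.d q' q := by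
  obtain ⟨ψ, h₁, h₂⟩ := h
  exact exists_eq_of_exists hJ (by simp [hx']) h₂ h₁ ⟨v ≫ x', by simp [hx']⟩

end IsYonedaProduct

end YonedaProduct

/-! ### The square of the class of a normal vector vanishes. -/

section Square

variable {X Y : Scheme.{u}} [IsAffine X] [IsAffine Y] {i : X ⟶ Y} {π : Y ⟶ X}
  {J : CochainComplex Y.Modules ℤ}

/-- With m the form of v, the primitive is H(t) = ψ(π^* m(t)) + z'(D t). Its first term has
coboundary z(m(t)) because π^* is a section of the restriction to X. That term is not 𝒪_Y-linear: b
ψ(π^* m(t)) exceeds its value at bt by z'(m(b - π^* i^* b) m(t)), and this is exactly the cross term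
in D(bt). -/
theorem exists_comp_d_eq_of_isYonedaProduct (h : i ≫ π = 𝟙 X)
    (hs : (globalMap π).FormallySmooth) (v : Γ(normalSheaf i, ⊤)) {q' q : ℤ}
    {z' : (pushforward i).obj (structureSheaf X) ⟶ J.X q'} (hz' : z' ≫ J.d q' q = 0)
    {z : (pushforward i).obj (structureSheaf X) ⟶ J.X q}
    (hz : IsYonedaProduct (p := toPushforward i) (idealToPushforward i v) z' z) :
    ∃ H : idealSheaf i ⟶ J.X q', H ≫ J.d q' q = idealToPushforward i v ≫ z := by
  algebraize [globalMap π]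
  have hρ : ∀ a, globalMap i (algebraMap _ _ a) = a := fun a => globalMap_globalMap h a
  obtain ⟨D, hD⟩ := RingHom.exists_secondOrder hρ (normalForm i v)
  obtain ⟨ψ, h₁, h₂⟩ := hz
  let m := normalForm i v
  let ψ' : Γ(Y, ⊤) →+ Γ(J.X q', ⊤) := (ψ.app ⊤).hom
  let ζ : Γ(X, ⊤) →+ Γ(J.X q', ⊤) := (z'.app ⊤).hom
  have hψ (b c : Γ(Y, ⊤)) : ψ' (b * c) = b • ψ' c := Hom.app_smul ψ b (ofFun c)
  have hζ (b : Γ(Y, ⊤)) (a : Γ(X, ⊤)) : ζ (globalMap i b * a) = b • ζ a :=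
    Hom.app_smul z' b (show Γ((pushforward i).obj (structureSheaf X), ⊤) from a)
  have hψζ (t : RingHom.ker (globalMap i)) : ψ' t = ζ (m t) := by
    have e := congrArg (fun g : idealSheaf i ⟶ J.X q' => g.app ⊤ ((idealEquiv i).symm t)) h₁
    have e₁ : ψ.app ⊤ ((kernel.ι (toPushforward i)).app ⊤ ((idealEquiv i).symm t)) =
        z'.app ⊤ ((idealToPushforward i v).app ⊤ ((idealEquiv i).symm t)) := e
    rw [kernel_ι_idealEquiv_symm, idealToPushforward_app, LinearEquiv.apply_symm_apply] at e₁
    exact e₁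
  let φ : Γ(idealSheaf i, ⊤) →ₗ[Γ(Y, ⊤)] Γ(J.X q', ⊤) :=
    { toFun := fun k => ψ' (algebraMap _ _ (m (idealEquiv i k))) + ζ (D (idealEquiv i k))
      map_add' := fun a b => by
        rw [map_add, map_add, map_add, map_add, Submodule.coe_add, map_add, map_add]
        abel
      map_smul' := fun b k => by
        rw [_root_.map_smul, map_smulₛₗ, RingHom.id_apply, smul_eq_mul]
        generalize idealEquiv i k = t
        have ht : globalMap i t = 0 := t.2
        have ht' : RingHom.kerProj hρ t = t := Subtype.ext (by
          change (t : Γ(Y, ⊤)) - algebraMap _ _ (globalMap i t) = t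
          rw [ht, map_zero, sub_zero])
        have e₁ : D ((b • t : RingHom.ker (globalMap i)) : Γ(Y, ⊤)) =
            globalMap i b * D t + m (RingHom.kerProj hρ b) * m t := by
          refine (hD b t).trans ?_
          rw [ht, mul_zero, add_zero, ht']
        have e₂ : m (algebraMap Γ(X, ⊤) Γ(Y, ⊤) (m t) • RingHom.kerProj hρ b) =
            m (RingHom.kerProj hρ b) * m t := by
          rw [map_smulₛₗ, hρ, smul_eq_mul, mul_comm]
        have e₃ := hψζ (algebraMap Γ(X, ⊤) Γ(Y, ⊤) (m t) • RingHom.kerProj hρ b)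
        have e₄ : ((algebraMap Γ(X, ⊤) Γ(Y, ⊤) (m t) • RingHom.kerProj hρ b :
            RingHom.ker (globalMap i)) : Γ(Y, ⊤)) =
            b * algebraMap _ _ (m t) - algebraMap _ _ (globalMap i b) * algebraMap _ _ (m t) := by
          change algebraMap Γ(X, ⊤) Γ(Y, ⊤) (m t) *
            (b - algebraMap Γ(X, ⊤) Γ(Y, ⊤) (globalMap i b)) = _
          ring
        rw [e₁, map_add, hζ, ← e₂, ← e₃, e₄, map_sub, hψ b, map_mul, smul_add]
        abel }
  obtain ⟨H, hH⟩ := (isLocalizing_idealSheaf i).exists_hom φ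
  refine ⟨H, (isLocalizing_idealSheaf i).hom_ext fun k => ?_⟩
  change (J.d q' q).app ⊤ (H.app ⊤ k) = z.app ⊤ ((idealToPushforward i v).app ⊤ k)
  rw [hH, idealToPushforward_app]
  refine (map_add ((J.d q' q).app ⊤).hom _ _).trans ?_
  have e₁ : (J.d q' q).app ⊤ (ζ (D (idealEquiv i k))) = 0 :=
    congrArg (fun g : (pushforward i).obj (structureSheaf X) ⟶ J.X q =>
      g.app ⊤ (D (idealEquiv i k))) hz'
  have e₂ := congrArg (fun g : structureSheaf Y ⟶ J.X q =>
      g.app ⊤ (algebraMap Γ(X, ⊤) Γ(Y, ⊤) (m (idealEquiv i k)))) h₂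
  refine (congrArg₂ (fun a b : Γ(J.X q, ⊤) => a + b) e₂ e₁).trans ((add_zero _).trans ?_)
  change z.app ⊤ (globalMap i (algebraMap Γ(X, ⊤) Γ(Y, ⊤) (m (idealEquiv i k)))) = _
  rw [hρ]
  rfl

end Square

/-! ### Cohomology of Hom into the resolution, as a module over functions on X. -/

section CochainModule

variable {X Y : Scheme.{u}} (i : X ⟶ Y)

/-- The module of morphisms `i_* 𝒪_X ⟶ N` over the ring of global functions on `X`. -/
def CochainModule (N : Y.Modules) : Type u := (pushforward i).obj (structureSheaf X) ⟶ N

instance (N : Y.Modules) : AddCommGroup (CochainModule i N) :=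
  inferInstanceAs (AddCommGroup ((pushforward i).obj (structureSheaf X) ⟶ N))

instance (N : Y.Modules) : Module Γ(X, ⊤) (CochainModule i N) where
  smul a z := pushforwardSmul i a ≫ z
  one_smul := fun z : (pushforward i).obj (structureSheaf X) ⟶ N =>
    (congrArg (· ≫ z) (pushforwardSmul_one i)).trans (Category.id_comp z)
  mul_smul := fun a b (z : (pushforward i).obj (structureSheaf X) ⟶ N) =>
    (congrArg (· ≫ z) ((congrArg _ (mul_comm a b)).trans (pushforwardSmul_mul i b a))).trans
      (Category.assoc _ _ _)
  smul_zero _ := comp_zero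
  smul_add _ _ _ := Preadditive.comp_add _ _ _ _ _ _
  add_smul := fun a b (z : (pushforward i).obj (structureSheaf X) ⟶ N) =>
    (congrArg (· ≫ z) (pushforwardSmul_add i a b)).trans (Preadditive.add_comp _ _ _ _ _ _)
  zero_smul := fun z : (pushforward i).obj (structureSheaf X) ⟶ N =>
    (congrArg (· ≫ z) (pushforwardSmul_zero i)).trans zero_comp

variable (J : CochainComplex Y.Modules ℤ)

/-- The cocycles `i_* 𝒪_X ⟶ J q`. -/
def cocycles (q : ℤ) : Submodule Γ(X, ⊤) (CochainModule i (J.X q)) where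
  carrier := {z | ∀ r, (show (pushforward i).obj (structureSheaf X) ⟶ J.X q from z) ≫ J.d q r = 0}
  add_mem' ha hb r := (Preadditive.add_comp _ _ _ _ _ _).trans (by rw [ha r, hb r, add_zero])
  zero_mem' r := zero_comp
  smul_mem' a z hz r := (Category.assoc _ _ _).trans (by rw [hz r, comp_zero])

/-- The coboundaries `i_* 𝒪_X ⟶ J q`. -/
def coboundaries (q : ℤ) : Submodule Γ(X, ⊤) (CochainModule i (J.X q)) where
  carrier := {z | ∃ x : (pushforward i).obj (structureSheaf X) ⟶ J.X (q - 1), z = x ≫ J.d (q - 1) q}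
  add_mem' := by
    rintro _ _ ⟨x, rfl⟩ ⟨y, rfl⟩
    exact ⟨x + y, (Preadditive.add_comp _ _ _ _ _ _).symm⟩
  zero_mem' := ⟨0, zero_comp.symm⟩
  smul_mem' := by
    rintro a _ ⟨x, rfl⟩
    exact ⟨pushforwardSmul i a ≫ x, (Category.assoc _ _ _).symm⟩

variable {J} in
theorem mem_coboundaries {q' q : ℤ} (x : (pushforward i).obj (structureSheaf X) ⟶ J.X q') :
    (show CochainModule i (J.X q) from x ≫ J.d q' q) ∈ coboundaries i J q := by
  by_cases h : q' + 1 = q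
  · obtain rfl : q' = q - 1 := by omega
    exact ⟨x, rfl⟩
  · have h0 : J.d q' q = 0 := J.shape _ _ h
    refine ⟨0, ?_⟩
    rw [h0, comp_zero, zero_comp]

/-- The cohomology of the complex of morphisms `i_* 𝒪_X ⟶ J`. -/
abbrev CohomologyModule (q : ℤ) : Type u :=
  cocycles i J q ⧸ (coboundaries i J q).submoduleOf (cocycles i J q)

variable {i J}

/-- The class of a cocycle. -/
def cohomologyClass {q : ℤ} (z : (pushforward i).obj (structureSheaf X) ⟶ J.X q)
    (hz : ∀ r, z ≫ J.d q r = 0) : CohomologyModule i J q :=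
  Submodule.Quotient.mk ⟨z, hz⟩

theorem cohomologyClass_eq_iff {q : ℤ} {z y : (pushforward i).obj (structureSheaf X) ⟶ J.X q}
    (hz : ∀ r, z ≫ J.d q r = 0) (hy : ∀ r, y ≫ J.d q r = 0) :
    cohomologyClass z hz = cohomologyClass y hy ↔
      ∃ x : (pushforward i).obj (structureSheaf X) ⟶ J.X (q - 1), z - y = x ≫ J.d (q - 1) q :=
  Submodule.Quotient.eq _

theorem cohomologyClass_eq {q' q : ℤ} {z y : (pushforward i).obj (structureSheaf X) ⟶ J.X q}
    (hz : ∀ r, z ≫ J.d q r = 0) (hy : ∀ r, y ≫ J.d q r = 0)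
    (h : ∃ x : (pushforward i).obj (structureSheaf X) ⟶ J.X q', z - y = x ≫ J.d q' q) :
    cohomologyClass z hz = cohomologyClass y hy := by
  obtain ⟨x, hx⟩ := h
  refine (cohomologyClass_eq_iff hz hy).mpr ?_
  have := mem_coboundaries (q := q) i x
  rw [← hx] at this
  exact this

theorem exists_cohomologyClass_eq {q : ℤ} (x : CohomologyModule i J q) :
    ∃ (z : (pushforward i).obj (structureSheaf X) ⟶ J.X q) (hz : ∀ r, z ≫ J.d q r = 0),
      cohomologyClass z hz = x := by
  obtain ⟨z, rfl⟩ := Submodule.Quotient.mk_surjective _ x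
  exact ⟨z.1, z.2, rfl⟩

theorem cohomologyClass_add {q : ℤ} {z y : (pushforward i).obj (structureSheaf X) ⟶ J.X q}
    (hz : ∀ r, z ≫ J.d q r = 0) (hy : ∀ r, y ≫ J.d q r = 0) (hzy : ∀ r, (z + y) ≫ J.d q r = 0) :
    cohomologyClass (z + y) hzy = cohomologyClass z hz + cohomologyClass y hy := rfl

theorem cohomologyClass_smul {q : ℤ} (a : Γ(X, ⊤))
    {z : (pushforward i).obj (structureSheaf X) ⟶ J.X q} (hz : ∀ r, z ≫ J.d q r = 0)
    (haz : ∀ r, (pushforwardSmul i a ≫ z) ≫ J.d q r = 0) :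
    cohomologyClass (pushforwardSmul i a ≫ z) haz = a • cohomologyClass z hz := rfl

theorem cohomologyClass_sum {q : ℤ} {ι : Type*} (s : Finset ι) (a : ι → Γ(X, ⊤))
    (z : ι → ((pushforward i).obj (structureSheaf X) ⟶ J.X q)) (hz : ∀ k r, z k ≫ J.d q r = 0)
    (h : ∀ r, (∑ k ∈ s, pushforwardSmul i (a k) ≫ z k) ≫ J.d q r = 0) :
    cohomologyClass (∑ k ∈ s, pushforwardSmul i (a k) ≫ z k) h =
      ∑ k ∈ s, a k • cohomologyClass (z k) (hz k) := by
  classical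
  induction s using Finset.induction_on with
  | empty => exact (Submodule.Quotient.mk_eq_zero _).mpr (Submodule.zero_mem _)
  | insert k s hk ih =>
    have h₁ : ∀ r, (∑ k ∈ s, pushforwardSmul i (a k) ≫ z k) ≫ J.d q r = 0 := fun r => by
      rw [Preadditive.sum_comp]
      exact Finset.sum_eq_zero fun k _ => by rw [Category.assoc, hz, comp_zero]
    have h₂ : ∀ r, (pushforwardSmul i (a k) ≫ z k) ≫ J.d q r = 0 := fun r => by
      rw [Category.assoc, hz, comp_zero]
    refine Eq.trans ?_ (Finset.sum_insert hk).symm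
    rw [← ih h₁, ← cohomologyClass_smul (a k) (hz k) h₂,
      ← cohomologyClass_add h₂ h₁ (fun r => by rw [Preadditive.add_comp, h₁, h₂, add_zero])]
    congr 1
    exact Finset.sum_insert hk

theorem exists_lift_pushforwardSmul [IsAffine X] {π : Y ⟶ X} (h : i ≫ π = 𝟙 X) (a : Γ(X, ⊤)) :
    ∃ b : Γ(Y, ⊤), pushforwardSmul i a = smulEnd b _ :=
  ⟨globalMap π a, by rw [← pushforwardSmul_globalMap, globalMap_globalMap h]⟩

/-- The retraction lifts a to the function π^* a on Y, which acts compatibly on all three terms of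
the extension. -/
theorem IsYonedaProduct.pushforwardSmul_comp [IsAffine X] {π : Y ⟶ X} (h : i ≫ π = 𝟙 X)
    (a : Γ(X, ⊤)) {q' q : ℤ} {v : kernel (toPushforward i) ⟶ _}
    {z' : (pushforward i).obj (structureSheaf X) ⟶ J.X q'}
    {z : (pushforward i).obj (structureSheaf X) ⟶ J.X q} (hz : IsYonedaProduct v z' z) :
    IsYonedaProduct v (pushforwardSmul i a ≫ z') (pushforwardSmul i a ≫ z) := by
  obtain ⟨b, hb⟩ := exists_lift_pushforwardSmul h a
  rw [hb]
  exact hz.comp (smulEnd_comp b _) (smulEnd_comp b _) (smulEnd_comp b _)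

end CochainModule

/-! ### The exterior algebra of normal vectors acts on cohomology. -/

section YonedaAction

variable {X Y : Scheme.{u}} {i : X ⟶ Y} {J : CochainComplex Y.Modules ℤ}

/-- A cocycle which represents the Yoneda product of the class attached to `v` and the class of
`z'`. -/
def yonedaProduct (v : Γ(normalSheaf i, ⊤)) {q' : ℤ} (q : ℤ)
    (z' : (pushforward i).obj (structureSheaf X) ⟶ J.X q') :
    (pushforward i).obj (structureSheaf X) ⟶ J.X q :=
  open Classical in
  if h : ∃ z : (pushforward i).obj (structureSheaf X) ⟶ J.X q,
    IsYonedaProduct (p := toPushforward i) (idealToPushforward i v) z' z then h.choose else 0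

variable [IsClosedImmersion i] (hJ : ∀ n, CategoryTheory.Injective (J.X n))

include hJ in
theorem isYonedaProduct_yonedaProduct (v : Γ(normalSheaf i, ⊤)) {q' q : ℤ}
    (z' : (pushforward i).obj (structureSheaf X) ⟶ J.X q') (h : z' ≫ J.d q' q = 0) :
    IsYonedaProduct (p := toPushforward i) (idealToPushforward i v) z' (yonedaProduct v q z') := by
  have h' := IsYonedaProduct.exists_of_comp_d_eq_zero (p := toPushforward i) hJ
    (idealToPushforward i v) z' h
  rw [yonedaProduct, dif_pos h']
  exact h'.choose_spec

include hJ in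
theorem yonedaProduct_comp_d (v : Γ(normalSheaf i, ⊤)) {q' q : ℤ}
    (z' : (pushforward i).obj (structureSheaf X) ⟶ J.X q') (h : z' ≫ J.d q' q = 0) (r : ℤ) :
    yonedaProduct v q z' ≫ J.d q r = 0 :=
  (isYonedaProduct_yonedaProduct hJ v z' h).comp_d r

/-- The action of a section of the normal sheaf on cohomology classes. -/
def yonedaAction (v : Γ(normalSheaf i, ⊤)) (q : ℤ) (x : CohomologyModule i J (q - 1)) :
    CohomologyModule i J q :=
  cohomologyClass (yonedaProduct v q (exists_cohomologyClass_eq x).choose)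
    (yonedaProduct_comp_d hJ v _ ((exists_cohomologyClass_eq x).choose_spec.choose q))

theorem yonedaAction_eq (v : Γ(normalSheaf i, ⊤)) {q : ℤ}
    {z' : (pushforward i).obj (structureSheaf X) ⟶ J.X (q - 1)} (hz' : ∀ r, z' ≫ J.d (q - 1) r = 0)
    {z : (pushforward i).obj (structureSheaf X) ⟶ J.X q}
    (hz : IsYonedaProduct (p := toPushforward i) (idealToPushforward i v) z' z) :
    yonedaAction hJ v q (cohomologyClass z' hz') = cohomologyClass z hz.comp_d := by
  obtain ⟨hy, hy'⟩ := (exists_cohomologyClass_eq (cohomologyClass z' hz')).choose_spec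
  obtain ⟨x, hx⟩ := (cohomologyClass_eq_iff _ _).mp hy'
  exact cohomologyClass_eq _ _
    (((isYonedaProduct_yonedaProduct hJ v _ (hy q)).sub hz).exists_eq_of_coboundary hJ x hx)

theorem yonedaAction_add (v : Γ(normalSheaf i, ⊤)) (q : ℤ) (x y : CohomologyModule i J (q - 1)) :
    yonedaAction hJ v q (x + y) = yonedaAction hJ v q x + yonedaAction hJ v q y := by
  obtain ⟨z, hz, rfl⟩ := exists_cohomologyClass_eq x
  obtain ⟨z', hz', rfl⟩ := exists_cohomologyClass_eq y
  have h₁ := isYonedaProduct_yonedaProduct hJ v z (hz q)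
  have h₂ := isYonedaProduct_yonedaProduct hJ v z' (hz' q)
  rw [yonedaAction_eq hJ v hz h₁, yonedaAction_eq hJ v hz' h₂]
  exact yonedaAction_eq hJ v _ (h₁.add h₂)

theorem add_yonedaAction (v v' : Γ(normalSheaf i, ⊤)) (q : ℤ) (x : CohomologyModule i J (q - 1)) :
    yonedaAction hJ (v + v') q x = yonedaAction hJ v q x + yonedaAction hJ v' q x := by
  obtain ⟨z, hz, rfl⟩ := exists_cohomologyClass_eq x
  have h₁ := isYonedaProduct_yonedaProduct hJ v z (hz q)
  have h₂ := isYonedaProduct_yonedaProduct hJ v' z (hz q)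
  have h₃ : IsYonedaProduct (p := toPushforward i) (idealToPushforward i (v + v')) z _ :=
    (idealToPushforward_add i v v').symm ▸ h₁.add_left h₂
  rw [yonedaAction_eq hJ v hz h₁, yonedaAction_eq hJ v' hz h₂]
  exact yonedaAction_eq hJ _ hz h₃

variable [IsAffine X] {π : Y ⟶ X} (hi : i ≫ π = 𝟙 X)

include hi in
theorem yonedaAction_smul (v : Γ(normalSheaf i, ⊤)) (q : ℤ) (a : Γ(X, ⊤))
    (x : CohomologyModule i J (q - 1)) :
    yonedaAction hJ v q (a • x) = a • yonedaAction hJ v q x := by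
  obtain ⟨z, hz, rfl⟩ := exists_cohomologyClass_eq x
  have h₁ := isYonedaProduct_yonedaProduct hJ v z (hz q)
  rw [yonedaAction_eq hJ v hz h₁]
  exact yonedaAction_eq hJ v _ (h₁.pushforwardSmul_comp hi a)

include hi in
theorem smul_yonedaAction (v : Γ(normalSheaf i, ⊤)) (q : ℤ) (a : Γ(X, ⊤))
    (x : CohomologyModule i J (q - 1)) :
    yonedaAction hJ (a • v) q x = a • yonedaAction hJ v q x := by
  obtain ⟨z, hz, rfl⟩ := exists_cohomologyClass_eq x
  have h₁ := isYonedaProduct_yonedaProduct hJ v z (hz q)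
  have h₂ : IsYonedaProduct (p := toPushforward i) (idealToPushforward i (a • v)) z _ :=
    (idealToPushforward_smul i a v).symm ▸ (h₁.pushforwardSmul_comp hi a).comp_left
  rw [yonedaAction_eq hJ v hz h₁]
  exact yonedaAction_eq hJ _ hz h₂

-- This is the relation that extends the action to the exterior algebra. In characteristic 2 it says
-- more than anticommutativity.
include hi in
theorem yonedaAction_yonedaAction [IsAffine Y] (hs : (globalMap π).FormallySmooth)
    (v : Γ(normalSheaf i, ⊤)) (q : ℤ) (x : CohomologyModule i J (q - 1 - 1)) :
    yonedaAction hJ v q (yonedaAction hJ v (q - 1) x) = 0 := by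
  obtain ⟨z, hz, rfl⟩ := exists_cohomologyClass_eq x
  have h₁ := isYonedaProduct_yonedaProduct hJ v z (hz (q - 1))
  have h₂ := isYonedaProduct_yonedaProduct hJ v _ (h₁.comp_d q)
  rw [yonedaAction_eq hJ v hz h₁, yonedaAction_eq hJ v _ h₂]
  have h₃ : ∃ x, yonedaProduct v q (yonedaProduct v (q - 1) z) = x ≫ J.d (q - 1) q := by
    obtain ⟨ψ, e₁, e₂⟩ := h₂
    refine IsYonedaProduct.exists_eq_of_exists hJ ?_ e₂ e₁
      (exists_comp_d_eq_of_isYonedaProduct hi hs v (hz _) h₁)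
    exact (Category.assoc _ _ _).trans
      ((congrArg (idealToPushforward i v ≫ ·) (h₁.comp_d q)).trans comp_zero)
  obtain ⟨x, hx⟩ := h₃
  refine (cohomologyClass_eq (y := 0) _ (fun _ => zero_comp) ⟨x, ?_⟩).trans
    ((Submodule.Quotient.mk_eq_zero _).mpr (Submodule.zero_mem _))
  rw [hx, sub_zero]

/-- The action of sections of the normal sheaf on cohomology classes, as a linear map. -/
def yonedaActionHom : Γ(normalSheaf i, ⊤) →ₗ[Γ(X, ⊤)]
    Module.End Γ(X, ⊤) (∀ q : ℤ, CohomologyModule i J q) :=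
  -- All degrees are put into one product, so that each normal vector acts by an endomorphism and
  -- products are taken in a single algebra.
  LinearMap.mk₂ Γ(X, ⊤) (fun v x q => yonedaAction hJ v q (x (q - 1)))
    (fun _ _ _ => funext fun _ => add_yonedaAction hJ _ _ _ _)
    (fun _ _ _ => funext fun _ => smul_yonedaAction hJ hi _ _ _ _)
    (fun _ _ _ => funext fun _ => yonedaAction_add hJ _ _ _ _)
    (fun _ _ _ => funext fun _ => yonedaAction_smul hJ hi _ _ _ _)

variable (e₀ : ∀ q, (pushforward i).obj (structureSheaf X) ⟶ J.X q)

/-- Cocycles representing Yoneda products of the classes attached to the members of a list and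
a given class. -/
def productCocycle : List Γ(normalSheaf i, ⊤) →
    ∀ q, (pushforward i).obj (structureSheaf X) ⟶ J.X q
  -- In degree q the product along a list starts from `e₀` in degree q minus the length of the list.
  | [] => e₀
  | v :: L => fun q => yonedaProduct v q (productCocycle L (q - 1))

variable (he : ∀ q r, e₀ q ≫ J.d q r = 0)

include hJ he in
omit [IsAffine X] in
theorem productCocycle_comp_d : ∀ (L : List Γ(normalSheaf i, ⊤)) (q r : ℤ),
    productCocycle e₀ L q ≫ J.d q r = 0
  | [], _, _ => he _ _
  | v :: L, _, r => yonedaProduct_comp_d hJ v _ (productCocycle_comp_d L _ _) r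

theorem prod_yonedaActionHom (L : List Γ(normalSheaf i, ⊤)) :
    (L.map (yonedaActionHom hJ hi)).prod (fun q => cohomologyClass (e₀ q) (he q)) =
      fun q => cohomologyClass (productCocycle e₀ L q) (productCocycle_comp_d hJ e₀ he L q) := by
  induction L with
  | nil => rfl
  | cons v L ih =>
    rw [List.map_cons, List.prod_cons, Module.End.mul_apply, ih]
    funext q
    exact yonedaAction_eq hJ v _
      (isYonedaProduct_yonedaProduct hJ v _ (productCocycle_comp_d hJ e₀ he L _ _))

/-- The linear map which sends `v₁ ∧ ⋯ ∧ v_d` to the Yoneda product of the classes attached to the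
`v_k` and a given class. -/
def productHom [IsAffine Y] (hs : (globalMap π).FormallySmooth) (d : ℕ) (q : ℤ) :
    ⋀[Γ(X, ⊤)]^d Γ(normalSheaf i, ⊤) →ₗ[Γ(X, ⊤)] CohomologyModule i J q :=
  LinearMap.proj q ∘ₗ LinearMap.applyₗ (fun q => cohomologyClass (e₀ q) (he q)) ∘ₗ
    (ExteriorAlgebra.lift Γ(X, ⊤) ⟨yonedaActionHom hJ hi, fun v => LinearMap.ext fun _ =>
      funext fun q => yonedaAction_yonedaAction hJ hi hs v q _⟩).toLinearMap ∘ₗ Submodule.subtype _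

theorem productHom_ιMulti [IsAffine Y] (hs : (globalMap π).FormallySmooth) {d : ℕ} (q : ℤ)
    (m : Fin d → Γ(normalSheaf i, ⊤)) :
    productHom hJ hi e₀ he hs d q (_root_.exteriorPower.ιMulti _ d m) =
      cohomologyClass (productCocycle e₀ (List.ofFn m) q)
        (productCocycle_comp_d hJ e₀ he (List.ofFn m) q) := by
  refine Eq.trans ?_ (congrFun (prod_yonedaActionHom hJ hi e₀ he (List.ofFn m)) q)
  let f := ExteriorAlgebra.lift Γ(X, ⊤) ⟨yonedaActionHom hJ hi, fun v =>
    LinearMap.ext fun x => funext fun q => yonedaAction_yonedaAction hJ hi hs v q (x (q - 1 - 1))⟩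
  change f (ExteriorAlgebra.ιMulti Γ(X, ⊤) d m) _ q = _
  have e : List.ofFn (f ∘ fun k => ExteriorAlgebra.ι Γ(X, ⊤) (m k)) =
      List.ofFn (yonedaActionHom hJ hi ∘ m) :=
    congrArg _ (funext fun k => ExteriorAlgebra.lift_ι_apply _ _ _ _)
  rw [ExteriorAlgebra.ιMulti_apply, map_list_prod, List.map_ofFn, List.map_ofFn, e]

-- `productHom` is linear, so a relation between wedges holds between the classes of the product
-- cocycles, that is, up to a coboundary.
include hJ hi he in
theorem exists_productCocycle_sub_sum_eq_of_ιMulti_eq [IsAffine Y]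
    (hs : (globalMap π).FormallySmooth) {ι : Type*} [Fintype ι] {d : ℕ}
    (v : Fin d → Γ(normalSheaf i, ⊤)) (a : ι → Γ(X, ⊤)) (m : ι → Fin d → Γ(normalSheaf i, ⊤))
    (h : _root_.exteriorPower.ιMulti Γ(X, ⊤) d v =
      ∑ s, a s • _root_.exteriorPower.ιMulti Γ(X, ⊤) d (m s)) (q : ℤ) :
    ∃ x : (pushforward i).obj (structureSheaf X) ⟶ J.X (q - 1),
      productCocycle e₀ (List.ofFn v) q -
        ∑ s, pushforwardSmul i (a s) ≫ productCocycle e₀ (List.ofFn (m s)) q =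
      x ≫ J.d (q - 1) q := by
  have hd : ∀ r, (∑ s, pushforwardSmul i (a s) ≫ productCocycle e₀ (List.ofFn (m s)) q) ≫
      J.d q r = 0 := fun r => by
    rw [Preadditive.sum_comp]
    refine Finset.sum_eq_zero fun k _ => ?_
    rw [Category.assoc, productCocycle_comp_d hJ e₀ he, comp_zero]
  refine (cohomologyClass_eq_iff (productCocycle_comp_d hJ e₀ he _ q) hd).mp ?_
  refine Eq.trans ?_ (cohomologyClass_sum Finset.univ a _
    (fun s => productCocycle_comp_d hJ e₀ he _ q) hd).symm
  rw [← productHom_ιMulti hJ hi e₀ he hs, h, map_sum]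
  refine Finset.sum_congr rfl fun s _ => ?_
  rw [_root_.map_smul, productHom_ιMulti hJ hi e₀ he hs]

include hJ hi he in
theorem exists_productCocycle_sub_sum_eq [IsAffine Y] (hs : (globalMap π).FormallySmooth) {n : ℕ}
    (b : DualBasis (normalSheaf i) (Fin n)) {d : ℕ} (v : Fin d → Γ(normalSheaf i, ⊤)) (q : ℤ) :
    ∃ x : (pushforward i).obj (structureSheaf X) ⟶ J.X (q - 1),
      productCocycle e₀ (List.ofFn v) q - ∑ s : Set.powersetCard (Fin n) d,
        pushforwardSmul i (exteriorFormAt (b.form ∘ Set.powersetCard.ofFinEmbEquiv.symm s) ⊤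
          (_root_.exteriorPower.ιMulti _ d v)) ≫
        productCocycle e₀ (List.ofFn (b.e ∘ Set.powersetCard.ofFinEmbEquiv.symm s)) q =
      x ≫ J.d (q - 1) q :=
  exists_productCocycle_sub_sum_eq_of_ιMulti_eq hJ hi e₀ he hs v _ _
    (exteriorPower_eq_sum b.e (fun k => formAt (b.form k) ⊤) (fun m => by
      refine (b.sum_eq ⊤ m).trans (Finset.sum_congr rfl fun k _ => ?_)
      rw [res_self]
      rfl) d _) q

end YonedaAction

/-! ### Injective resolutions. -/

section Resolution

variable {X : Scheme.{u}} {F : X.Modules} {J : CochainComplex X.Modules ℤ}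

/-- `0 ⟶ F ⟶ J 0 ⟶ J 1 ⟶ ⋯` is an injective resolution. -/
structure IsResolution (e : F ⟶ J.X 0) : Prop where
  comp_d : e ≫ J.d 0 1 = 0
  mono : Mono e
  exact_zero : (ShortComplex.mk e (J.d 0 1) comp_d).Exact
  exactAt : ∀ q ≠ 0, J.ExactAt q
  isZero : ∀ q < 0, IsZero (J.X q)
  injective : ∀ q, CategoryTheory.Injective (J.X q)

/-- A morphism `F ⟶ J 0`, as a family of morphisms which vanish in degrees `≠ 0`. -/
def degreeZero (e : F ⟶ J.X 0) : ∀ q, F ⟶ J.X q := Pi.single 0 e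

theorem degreeZero_zero (e : F ⟶ J.X 0) : degreeZero e 0 = e := Pi.single_eq_same _ _

theorem degreeZero_of_ne (e : F ⟶ J.X 0) {q : ℤ} (h : q ≠ 0) : degreeZero e q = 0 :=
  Pi.single_eq_of_ne h _

theorem IsResolution.degreeZero_comp_d {e : F ⟶ J.X 0} (he : IsResolution e) (q r : ℤ) :
    degreeZero e q ≫ J.d q r = 0 := by
  rcases eq_or_ne q 0 with rfl | h
  · rw [degreeZero_zero]
    rcases eq_or_ne r 1 with rfl | h
    · exact he.comp_d
    · rw [J.shape 0 r (fun h' => h (by simpa using h'.symm)), comp_zero]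
  · rw [degreeZero_of_ne e h, zero_comp]

theorem IsResolution.exists_local {e : F ⟶ J.X 0} (he : IsResolution e) {q q' q'' : ℤ}
    (h : q + 1 = q') (h' : q' + 1 = q'') (hq : q' ≠ 0) {V : X.Opens}
    (s : Γ(J.X q', V)) (hs : (J.d q' q'').app V s = 0) {x : X} (hx : x ∈ V) :
    ∃ (W : X.Opens) (h : W ≤ V), x ∈ W ∧ ∃ r : Γ(J.X q, W), (J.d q q').app W r = res _ h s := by
  have hJ := he.exactAt q' hq
  rw [J.exactAt_iff' q q' q'' (by simp; omega) (by simp; omega)] at hJ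
  exact exists_local_preimage_of_exact hJ s hs hx

end Resolution

/-! ### Multiplication by elements of the ideal. -/

section Ideal

variable {X Y : Scheme.{u}} (i : X ⟶ Y)

theorem homOfSection_comp {M N : X.Modules} (s : Γ(M, ⊤)) (g : M ⟶ N) :
    homOfSection s ≫ g = homOfSection (g.app ⊤ s) :=
  hom_ext' fun _ a => (Hom.app_smul g (toFun a) (res M le_top s)).trans
    (congrArg (fun m => toFun a • m) (app_res g le_top s))

theorem homOfSection_ofFun_comp {N : X.Modules} (a : Γ(X, ⊤)) (g : structureSheaf X ⟶ N) :
    homOfSection (g.app ⊤ (ofFun a)) = smulEnd a _ ≫ g := by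
  rw [← homOfSection_comp]
  congr 1
  exact hom_ext' fun _ b => mul_comm (toFun b) (resFun le_top a)

theorem smulEnd_eq_homOfSection (t : RingHom.ker (globalMap i)) :
    smulEnd (t : Γ(Y, ⊤)) (structureSheaf Y) =
      homOfSection ((idealEquiv i).symm t) ≫ kernel.ι (toPushforward i) := by
  refine (Category.comp_id _).symm.trans ((homOfSection_ofFun_comp (t : Γ(Y, ⊤)) (𝟙 _)).symm.trans
    (Eq.trans ?_ (homOfSection_comp _ _).symm))
  exact congrArg homOfSection (kernel_ι_idealEquiv_symm i t).symm

/-- Multiplication by t factors through the ideal, where ψ is v followed by z. With v(t) equal to g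
or to 0 on X, this turns the definition of a Yoneda product into the Koszul rules. -/
theorem smulEnd_comp_of_kernel_ι_comp_eq {N : Y.Modules} {v : Γ(normalSheaf i, ⊤)}
    {z : (pushforward i).obj (structureSheaf X) ⟶ N} {ψ : structureSheaf Y ⟶ N}
    (h : kernel.ι (toPushforward i) ≫ ψ = idealToPushforward i v ≫ z)
    (t : RingHom.ker (globalMap i)) (b : Γ(Y, ⊤)) (hb : normalForm i v t = globalMap i b) :
    smulEnd (t : Γ(Y, ⊤)) _ ≫ ψ = smulEnd b _ ≫ toPushforward i ≫ z := by
  have h₁ : homOfSection ((idealEquiv i).symm t) ≫ idealToPushforward i v =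
      smulEnd b _ ≫ toPushforward i := by
    rw [homOfSection_comp, idealToPushforward_app, LinearEquiv.apply_symm_apply, hb]
    exact homOfSection_ofFun_comp b (toPushforward i)
  exact (congrArg (· ≫ ψ) (smulEnd_eq_homOfSection i t)).trans ((Category.assoc _ _ _).trans
    ((congrArg (homOfSection ((idealEquiv i).symm t) ≫ ·) h).trans
      ((Category.assoc _ _ _).symm.trans ((congrArg (· ≫ z) h₁).trans (Category.assoc _ _ _)))))

end Ideal

/-! ### Koszul cocycles from local coordinates. -/

section Koszul

variable {X Y : Scheme.{u}} {i : X ⟶ Y} [IsClosedImmersion i]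
  {J : CochainComplex Y.Modules ℤ} {e : (pushforward i).obj (structureSheaf X) ⟶ J.X 0}
  (he : IsResolution e)

include he in
theorem exists_isYonedaProduct_productCocycle (v : Γ(normalSheaf i, ⊤))
    (L : List Γ(normalSheaf i, ⊤)) (q q' : ℤ) (h : q + 1 = q') :
    IsYonedaProduct (p := toPushforward i) (idealToPushforward i v)
      (productCocycle (degreeZero e) L q) (productCocycle (degreeZero e) (v :: L) q') := by
  obtain rfl : q = q' - 1 := by omega
  exact isYonedaProduct_yonedaProduct he.injective v _
    (productCocycle_comp_d he.injective _ he.degreeZero_comp_d L _ _)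

/-- Local coordinates give Koszul cocycles. -/
def koszulCocycles {κ : Type u} (c : RingHom.RegularCoordinates (globalMap i) κ)
    (v : κ → Γ(normalSheaf i, ⊤)) (hv : ∀ k, normalForm i (v k) = c.v k) {α : Type} (σ : α ≃ κ) :
    KoszulCocycles (toPushforward i) J α where
  t a := c.t (σ a)
  g := c.g
  θ L q := productCocycle (degreeZero e) (L.map fun a => v (σ a)) q
  ψ a L q := (exists_isYonedaProduct_productCocycle he (v (σ a)) (L.map fun a => v (σ a)) q _
    rfl).choose
  θ_d L q q' _ := productCocycle_comp_d he.injective _ he.degreeZero_comp_d _ _ _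
  smulEnd_t a := by
    rw [← pushforwardSmul_globalMap, RingHom.mem_ker.mp (c.t (σ a)).2, pushforwardSmul_zero]
  ψ_self a L q := by
    refine smulEnd_comp_of_kernel_ι_comp_eq i
      (exists_isYonedaProduct_productCocycle he (v (σ a)) (L.map fun a => v (σ a)) q _
        rfl).choose_spec.1 (c.t (σ a)) c.g ?_
    rw [hv, c.v_self]
  ψ_ne a b L q h := by
    refine (smulEnd_comp_of_kernel_ι_comp_eq i
      (exists_isYonedaProduct_productCocycle he (v (σ a)) (L.map fun a => v (σ a)) q _
        rfl).choose_spec.1 (c.t (σ b)) 0 ?_).trans ?_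
    · rw [hv, c.v_ne _ _ (σ.injective.ne h), map_zero]
    · rw [smulEnd_zero, zero_comp]
  ψ_d a L q q' h := by
    subst h
    exact (exists_isYonedaProduct_productCocycle he (v (σ a)) (L.map fun a => v (σ a)) q _
        rfl).choose_spec.2
  zero_exact V s hs x hx := by
    obtain ⟨W, h, hxW, r, hr⟩ := exists_local_preimage_of_exact he.exact_zero s hs hx
    exact ⟨W, h, hxW, r, (congrArg (fun k : (pushforward i).obj (structureSheaf X) ⟶ J.X 0 =>
      k.app W r) (degreeZero_zero e)).trans hr⟩
  zero_injective V := by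
    have := he.mono
    have h := injective_app_of_mono e V
    rw [← degreeZero_zero e] at h
    exact h
  exact q q' q'' h h' hq V s hs x hx := he.exists_local h h' hq s hs hx
  isZero := he.isZero
  injective := he.injective

variable {κ : Type u} (c : RingHom.RegularCoordinates (globalMap i) κ)
  (v : κ → Γ(normalSheaf i, ⊤)) (hv : ∀ k, normalForm i (v k) = c.v k) {α : Type} (σ : α ≃ κ)

omit [IsClosedImmersion i] in
theorem ofList_coordinates (l : List α) {C : Type u} [CommRing C] (f : Γ(Y, ⊤) →+* C) :
    Ideal.ofList ((l.map fun a => (c.t (σ a) : Γ(Y, ⊤))).map f) =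
      Ideal.span (Set.range fun k : {k | σ.symm k ∈ l} => f (c.t k)) := by
  refine congrArg Ideal.span (Set.ext fun r => ?_)
  simp only [List.map_map, List.mem_map, Function.comp_apply, Set.mem_ofPred_eq, Set.mem_range]
  constructor
  · rintro ⟨a, ha, rfl⟩
    exact ⟨⟨σ a, by simpa using ha⟩, rfl⟩
  · rintro ⟨⟨k, hk⟩, rfl⟩
    exact ⟨σ.symm k, hk, by simp⟩

/-- If t_a s = 0 in the quotient, lift s to a function and shrink to a basic open subset on which
t_a times that function lies in the ideal of the list. The ring there is flat over the global
functions and g is invertible in it, so the algebraic regularity applies. -/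
theorem koszulCocycles_regular [IsAffine Y] {U : Y.Opens} (hU : U ≤ Y.basicOpen c.g) :
    ∀ (l : List α) (_ : l.Nodup), (koszulCocycles he c v hv σ).Regular U l
  | [], _ => trivial
  | a :: l, hl => by
    rw [List.nodup_cons] at hl
    refine ⟨fun V hV => (injective_iff_map_eq_zero _).mpr fun s hs =>
      eq_zero_of_locally_eq_zero _ _ fun x hx => ?_, koszulCocycles_regular hU l hl.2⟩
    let D := koszulCocycles he c v hv σ
    obtain ⟨W, hW, hxW, r, hr⟩ := exists_local_preimage (quotMap (l.map D.t)) s hx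
    have h₀ : (quotMap (l.map D.t)).app W (ofFun (resFun le_top (D.t a) * toFun r)) = 0 := by
      refine (Hom.app_smul (quotMap (l.map D.t)) (resFun le_top (D.t a)) r).trans ?_
      rw [hr, ← resFun_resFun hW le_top, ← res_smul]
      exact (congrArg (res _ hW) hs).trans (map_zero _)
    obtain ⟨W', hW', hxW', hmem⟩ := (quotMap_app_eq_zero_iff _ _).mp h₀ x hxW
    obtain ⟨f, hf, hxf⟩ := exists_basicOpen_le hxW'
    refine ⟨Y.basicOpen f, hf.trans (hW'.trans hW), hxf, ?_⟩
    have h₁ := Ideal.mem_map_of_mem (resFun hf) hmem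
    rw [Ideal.map_ofList, List.map_map, resFun_resFun, map_mul, resFun_resFun] at h₁
    have h₂ : resFun hf ∘ resFun (le_top : W' ≤ ⊤) = resFun (le_top : Y.basicOpen f ≤ ⊤) :=
      funext fun b => resFun_resFun _ _ _
    rw [h₂] at h₁
    have e := ofList_coordinates c σ l (resFun (le_top : Y.basicOpen f ≤ ⊤))
    have : IsLocalization.Away f Γ(Y, Y.basicOpen f) :=
      (isAffineOpen_top Y).isLocalization_basicOpen f
    have : Module.Flat Γ(Y, ⊤) Γ(Y, Y.basicOpen f) := IsLocalization.flat _ (Submonoid.powers f)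
    have h₃ := c.regular Γ(Y, Y.basicOpen f) (isUnit_resFun (hf.trans (hW'.trans (hW.trans
      (hV.trans hU))))) {k | σ.symm k ∈ l} (σ a) (by simpa using hl.1) _ (e.le h₁)
    replace h₃ := e.ge h₃
    rw [← res_res _ (hf.trans hW') hW, ← hr, ← app_res]
    exact (quotMap_app_eq_zero_iff _ _).mpr fun y hy => ⟨_, le_rfl, hy,
      (congrArg (· ∈ Ideal.ofList _) (resFun_self (resFun (hf.trans hW') (toFun r)))).mpr h₃⟩

/-- On D(f) a section of the ideal sheaf becomes, after multiplication by a power of f, an element m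
of the global ideal, and g m is a combination of the coordinates. Both f and g are units there. -/
theorem koszulCocycles_desc_injective [IsAffine X] [IsAffine Y] {U : Y.Opens}
    (hU : U ≤ Y.basicOpen c.g) (l : List α) (hl : ∀ a, a ∈ l) :
    ∀ V ≤ U, Function.Injective (((koszulCocycles he c v hv σ).desc l).app V) := by
  refine (koszulCocycles he c v hv σ).desc_injective l fun V hV r hr x hx => ?_
  obtain ⟨f, hf, hxf⟩ := exists_basicOpen_le hx
  obtain ⟨k, hk⟩ := exists_kernel_ι_app_eq (toPushforward i) (ofFun r) hr
  obtain ⟨n, m, hm⟩ := (isLocalizing_idealSheaf i).exists_pow_smul_eq f (res (idealSheaf i) hf k)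
  refine ⟨Y.basicOpen f, hf, hxf, ?_⟩
  have h₁ : resFun (le_top : Y.basicOpen f ≤ ⊤) (idealEquiv i m : Γ(Y, ⊤)) =
      resFun (le_top : Y.basicOpen f ≤ ⊤) f ^ n * resFun hf r := by
    have h₂ := congrArg ((kernel.ι (toPushforward i)).app (Y.basicOpen f)) hm
    refine ((app_res (kernel.ι (toPushforward i)) _ m).symm.trans h₂).trans ?_
    refine (Hom.app_smul (kernel.ι (toPushforward i)) _ _).trans (congrArg (_ • ·) ?_)
    exact (app_res (kernel.ι (toPushforward i)) hf k).trans (congrArg (res _ hf) hk)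
  have h₂ : resFun (le_top : Y.basicOpen f ≤ ⊤) (c.g * (idealEquiv i m : Γ(Y, ⊤))) ∈
      Ideal.ofList ((l.map fun a => (c.t (σ a) : Γ(Y, ⊤))).map
        (resFun (le_top : Y.basicOpen f ≤ ⊤))) := by
    have h₃ := Ideal.mem_map_of_mem (resFun (le_top : Y.basicOpen f ≤ ⊤))
      (c.mul_mem_span _ (idealEquiv i m).2)
    rw [Ideal.map_span] at h₃
    rw [ofList_coordinates]
    refine Ideal.span_mono ?_ h₃
    rintro _ ⟨_, ⟨k, rfl⟩, rfl⟩
    exact ⟨⟨k, hl _⟩, rfl⟩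
  rw [map_mul, h₁] at h₂
  have hg : IsUnit (resFun (le_top : Y.basicOpen f ≤ ⊤) c.g) :=
    isUnit_resFun (hf.trans (hV.trans hU))
  have hf' : IsUnit (resFun (le_top : Y.basicOpen f ≤ ⊤) f) := isUnit_resFun le_rfl
  exact (Ideal.unit_mul_mem_iff_mem _ (hf'.pow n)).mp ((Ideal.unit_mul_mem_iff_mem _ hg).mp h₂)

end Koszul

/-! ### A local criterion for quasi-isomorphisms. -/

section QuasiIso

variable {Y : Scheme.{u}}

/-- A morphism from a complex with zero differential is a quasi-isomorphism if each local cocycle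
is locally cohomologous to the image of a unique section. -/
theorem quasiIso_of_local {K L : CochainComplex Y.Modules ℤ} (φ : K ⟶ L) (hK : ∀ p q, K.d p q = 0)
    (hsurj : ∀ (q : ℤ) (V : Y.Opens) (s : Γ(L.X q, V)), (L.d q (q + 1)).app V s = 0 → ∀ x ∈ V,
      ∃ (W : Y.Opens) (h : W ≤ V), x ∈ W ∧ ∃ (n : Γ(K.X q, W)) (χ : Γ(L.X (q - 1), W)),
        res _ h s = (φ.f q).app W n + (L.d (q - 1) q).app W χ)
    (hinj : ∀ (q : ℤ) (V : Y.Opens) (n : Γ(K.X q, V)) (χ : Γ(L.X (q - 1), V)),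
      (φ.f q).app V n = (L.d (q - 1) q).app V χ → n = 0) : QuasiIso φ := by
  refine ⟨fun q => (quasiIsoAt_iff_isIso_homologyMap _ _).mpr ?_⟩
  have h₁ : Mono (HomologicalComplex.homologyMap φ q) := by
    rw [HomologicalComplex.mono_homologyMap_iff_up_to_refinements φ (q - 1) q (q + 1) (by simp)
      (by simp)]
    intro A x₂ _ y₁ h
    refine ⟨A, 𝟙 A, inferInstance, 0, ?_⟩
    rw [zero_comp, Category.id_comp]
    exact hom_ext' fun V a => hinj q V _ (y₁.app V a)
      (congrArg (fun k : A ⟶ L.X q => k.app V a) h)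
  have h₂ : Epi (HomologicalComplex.homologyMap φ q) := by
    rw [HomologicalComplex.epi_homologyMap_iff_up_to_refinements φ (q - 1) q (q + 1) (by simp)
      (by simp)]
    intro A y₂ hy₂
    have hf : φ.f q ≫ L.d q (q + 1) = 0 := by rw [φ.comm, hK, zero_comp]
    -- The hypothesis `hsurj` says that K^q ⊕ L^(q-1) maps onto the cocycles of L, which is
    -- surjectivity on cohomology after pulling back along this epimorphism.
    let g : K.X q ⊞ L.X (q - 1) ⟶ kernel (L.d q (q + 1)) :=
      biprod.desc (kernel.lift _ (φ.f q) hf) (kernel.lift _ (L.d (q - 1) q) (L.d_comp_d _ _ _))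
    have hg : Epi g := by
      refine epi_of_locally_surjective g fun V s x hx => ?_
      obtain ⟨W, h, hxW, n, χ, e⟩ := hsurj q V ((kernel.ι (L.d q (q + 1))).app V s)
        (congrArg (fun k : kernel (L.d q (q + 1)) ⟶ L.X (q + 1) => k.app V s)
          (kernel.condition _)) x hx
      refine ⟨W, h, hxW, (biprod.inl : K.X q ⟶ _ ⊞ L.X (q - 1)).app W n +
        (biprod.inr : L.X (q - 1) ⟶ K.X q ⊞ _).app W χ,
        injective_app_of_mono (kernel.ι (L.d q (q + 1))) W ?_⟩
      rw [app_res, e, map_add, map_add]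
      have e₁ : biprod.inl ≫ g ≫ kernel.ι _ = φ.f q := by simp [g]
      have e₂ : biprod.inr ≫ g ≫ kernel.ι _ = L.d (q - 1) q := by simp [g]
      exact congrArg₂ (· + ·) (congrArg (fun k : K.X q ⟶ L.X q => k.app W n) e₁)
        (congrArg (fun k : L.X (q - 1) ⟶ L.X q => k.app W χ) e₂)
    refine ⟨Limits.pullback g (kernel.lift _ y₂ hy₂), pullback.snd _ _, inferInstance,
      pullback.fst _ _ ≫ biprod.fst, by rw [hK, comp_zero], pullback.fst _ _ ≫ biprod.snd, ?_⟩
    have e := congrArg (· ≫ kernel.ι _) (pullback.condition (f := g) (g := kernel.lift _ y₂ hy₂))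
    simp only [Category.assoc, kernel.lift_ι] at e
    rw [← e]
    have e₁ : g ≫ kernel.ι _ = biprod.fst ≫ φ.f q + biprod.snd ≫ L.d (q - 1) q :=
      biprod.hom_ext' _ _ (by simp [g]) (by simp [g])
    rw [e₁]
    simp
  exact isIso_of_mono_of_epi _

end QuasiIso

/-! ### Points off the image, and coordinates at points of the image. -/

section Outside

variable {X Y : Scheme.{u}} {i : X ⟶ Y}

theorem eq_of_preimage_eq_bot {M : X.Modules} {W : Y.Opens} (h : i ⁻¹ᵁ W = ⊥)
    (m n : Γ((pushforward i).obj M, W)) : m = n :=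
  eq_of_locally_eq M (U := i ⁻¹ᵁ W) m n fun x hx => by
    rw [h] at hx
    exact hx.elim

theorem sheafHomSections_eq_of_preimage_eq_bot {M : X.Modules} {N : Y.Modules} {W : Y.Opens}
    (h : i ⁻¹ᵁ W = ⊥) (φ ψ : sheafHomSections ((pushforward i).obj M) N W) : φ = ψ :=
  sheafHomSections_ext' fun V hV m => by
    have h' : i ⁻¹ᵁ V = ⊥ := le_bot_iff.mp (h ▸ i.preimage_mono hV)
    rw [eq_of_preimage_eq_bot h' m 0, map_zero, map_zero]

theorem exists_preimage_eq_bot [IsClosedImmersion i] {V : Y.Opens} {y : Y} (hy : y ∈ V)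
    (h : y ∉ Set.range i) : ∃ W ≤ V, y ∈ W ∧ i ⁻¹ᵁ W = ⊥ := by
  refine ⟨V ⊓ ⟨(Set.range i)ᶜ, i.isClosedEmbedding.isClosed_range.isOpen_compl⟩, inf_le_left,
    ⟨hy, h⟩, ?_⟩
  refine le_bot_iff.mp fun x hx => ?_
  exact hx.2 ⟨x, rfl⟩

theorem exists_preimage_le [IsClosedImmersion i] {V : Y.Opens} {x : X} {U : X.Opens}
    (hx : i x ∈ V) (hxU : x ∈ U) : ∃ W ≤ V, i x ∈ W ∧ i ⁻¹ᵁ W ≤ U := by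
  obtain ⟨T, hT, e⟩ := i.isClosedEmbedding.isInducing.isOpen_iff.mp U.isOpen
  refine ⟨V ⊓ ⟨T, hT⟩, inf_le_left, ⟨hx, ?_⟩, fun z hz => ?_⟩
  · change x ∈ i ⁻¹' T
    rw [e]
    exact hxU
  · have : z ∈ i ⁻¹' T := hz.2
    rw [e] at this
    exact this

/-- There are local coordinates at each point of the image of a section. -/
theorem exists_regularCoordinates_at [IsAffine X] [IsAffine Y] {π : Y ⟶ X} (h : i ≫ π = 𝟙 X)
    (hs : (globalMap π).FormallySmooth) (hp : (globalMap π).FinitePresentation) (x : X) :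
    ∃ (κ : Type u) (_ : _root_.Finite κ) (c : RingHom.RegularCoordinates (globalMap i) κ),
      i x ∈ Y.basicOpen c.g := by
  algebraize [globalMap π]
  -- The prime of the point i x. It contains the kernel, since a function that vanishes on X
  -- vanishes at i x.
  let p := RingHom.ker (Y.evaluation ⊤ (i x) trivial).hom
  have hp' : RingHom.ker (globalMap i) ≤ p := by
    intro f hf
    by_contra hc
    have h₁ : i x ∈ Y.basicOpen f := by
      exact (Y.evaluation_ne_zero_iff_mem_basicOpen (U := ⊤) (i x) trivial f).mp hc
    have h₂ : x ∈ X.basicOpen (globalMap i f) := by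
      have := i.preimage_basicOpen (U := ⊤) f
      have h₃ : x ∈ i ⁻¹ᵁ Y.basicOpen f := h₁
      rw [this] at h₃
      exact h₃
    rw [RingHom.mem_ker.mp hf] at h₂
    simp at h₂
  have : p.IsPrime := RingHom.ker_isPrime _
  obtain ⟨κ, hκ, c, hc⟩ := RingHom.exists_regularCoordinates (ρ := globalMap i)
    (globalMap_globalMap h) p hp'
  refine ⟨κ, hκ, c, ?_⟩
  exact (Y.evaluation_ne_zero_iff_mem_basicOpen (U := ⊤) (i x) trivial c.g).mp hc

end Outside

/-! ### The multiplication map is a quasi-isomorphism. -/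

section Multiplication

theorem _root_.AddMonoidHom.eq_add_map_sub {A B : Type*} [AddCommGroup A] [AddCommGroup B]
    (f : A →+ B) {x y : A} {a b l : B} (h : a = l + f x) (h' : b = l + f y) :
    a = b + f (x - y) := by
  rw [h, h', map_sub, add_add_sub_cancel]

variable {X Y : Scheme.{u}} {i : X ⟶ Y} {J : CochainComplex Y.Modules ℤ}

/-- For `θ : i_* M ⟶ N`, the morphism `i_* M ⟶ ℋom(i_* 𝒪_X, N)` sending `n` to `a ↦ θ (a • n)`. -/
def mulHom {M : X.Modules} {N : Y.Modules} (θ : (pushforward i).obj M ⟶ N) :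
    (pushforward i).obj M ⟶ (sheafHom ((pushforward i).obj (structureSheaf X))).obj N :=
  (pushforwardToSheafHom i).app M ≫ (sheafHom _).map θ

/-- The values of `mulHom` on sections. -/
def mulHomSections {M : X.Modules} {N : Y.Modules} (θ : (pushforward i).obj M ⟶ N) (U : Y.Opens)
    (n : Γ((pushforward i).obj M, U)) :
    sheafHomSections ((pushforward i).obj (structureSheaf X)) N U :=
  (mulHom θ).app U n

/-- The restriction of a global section, as a section of the push-forward. -/
def pushforwardSection (i : X ⟶ Y) {M : X.Modules} (s : Γ(M, ⊤)) (U : Y.Opens) :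
    Γ((pushforward i).obj M, U) :=
  res M (le_top : i ⁻¹ᵁ U ≤ ⊤) s

theorem mulHomSections_pushforwardSection {M : X.Modules} {N : Y.Modules}
    (θ : (pushforward i).obj M ⟶ N) (s : Γ(M, ⊤)) (U : Y.Opens) :
    mulHomSections θ U (pushforwardSection i s U) =
      sheafHomOfHom ((pushforward i).map (homOfSection s) ≫ θ) U := by
  refine sheafHomSections_ext' fun V hV a => ?_
  change θ.app V ((show Γ(X, i ⁻¹ᵁ V) from a) • res M (i.preimage_mono hV) (res M le_top s)) =
    θ.app V ((show Γ(X, i ⁻¹ᵁ V) from a) • res M le_top s)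
  rw [res_res]
  rfl

theorem mulHomSections_sum {M : X.Modules} {N : Y.Modules} (θ : (pushforward i).obj M ⟶ N)
    {ι : Type*} [Fintype ι] (s : ι → Γ(M, ⊤)) {U : Y.Opens} (r : ι → Γ(Y, U)) :
    mulHomSections θ U (∑ j, r j • pushforwardSection i (s j) U) =
      linComb r fun j => (pushforward i).map (homOfSection (s j)) ≫ θ := by
  refine (map_sum ((mulHom θ).app U).hom _ _).trans (Finset.sum_congr rfl fun j _ => ?_)
  refine (Hom.app_smul (mulHom θ) (r j) _).trans ?_
  exact congrArg (fun φ : sheafHomSections _ N U => r j • φ)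
    (mulHomSections_pushforwardSection θ (s j) U)

theorem linComb_add {M N : X.Modules} {ι : Type*} [Fintype ι] {U : X.Opens} (r : ι → Γ(X, U))
    (θ θ' : ι → (M ⟶ N)) : linComb r (fun j => θ j + θ' j) = linComb r θ + linComb r θ' := by
  rw [linComb, linComb, linComb, ← Finset.sum_add_distrib]
  exact Finset.sum_congr rfl fun j _ => 
    smul_add (r j) (sheafHomOfHom (θ j) U) (sheafHomOfHom (θ' j) U)

theorem linComb_units_smul {M N : X.Modules} {ι : Type*} [Fintype ι] {U : X.Opens}
    (r : ι → Γ(X, U)) (ε : ℤˣ) (θ : ι → (M ⟶ N)) :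
    linComb r (fun j => ε • θ j) = linComb (fun j => ε • r j) θ := by
  rcases Int.units_eq_one_or ε with rfl | rfl
  · simp only [one_smul]
  · simp only [Units.neg_smul, one_smul, linComb_neg]
    exact (Finset.sum_congr rfl fun j _ => (congrArg _ (sheafHomOfHom_neg (θ j) U)).trans
      (smul_neg (A := sheafHomSections M N U) _ _)).trans (Finset.sum_neg_distrib _)

/-- `θ` sends `v₁ ∧ ⋯ ∧ v_q` to the Yoneda product of the classes attached to the `v_k`, up to the
sign `ε`. -/
def IsWedgeProduct (e : (pushforward i).obj (structureSheaf X) ⟶ J.X 0) (ε : ℤˣ) {q : ℕ}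
    (θ : (pushforward i).obj (exteriorPower (normalSheaf i) q) ⟶ J.X q) : Prop :=
  ∀ v : Fin q → Γ(normalSheaf i, ⊤), ∃ x : (pushforward i).obj (structureSheaf X) ⟶ J.X (q - 1),
    (pushforward i).map (homOfSection (wedge _ v)) ≫ θ =
      ε • productCocycle (degreeZero e) (List.ofFn v) q + x ≫ J.d (q - 1) q

variable {e : (pushforward i).obj (structureSheaf X) ⟶ J.X 0} {ε : ℤˣ} {q : ℕ}
  {θ : (pushforward i).obj (exteriorPower (normalSheaf i) q) ⟶ J.X q}

theorem IsWedgeProduct.exists_mulHomSections_sum (hθ : IsWedgeProduct e ε θ) {ι : Type*} [Fintype ι]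
    (v : ι → Fin q → Γ(normalSheaf i, ⊤)) {U : Y.Opens} (r : ι → Γ(Y, U)) :
    ∃ χ : sheafHomSections ((pushforward i).obj (structureSheaf X)) (J.X (q - 1)) U,
      mulHomSections θ U (∑ j, r j • pushforwardSection i (wedge _ (v j)) U) =
      linComb (fun j => ε • r j) (fun j => productCocycle (degreeZero e) (List.ofFn (v j)) q) +
        sheafHomPostcomp _ (J.d (q - 1) q) U χ := by
  choose x hx using fun j => hθ (v j)
  refine ⟨linComb r x, ?_⟩
  rw [mulHomSections_sum, sheafHomPostcomp_linComb, ← linComb_units_smul, ← linComb_add]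
  exact congrArg (linComb r) (funext hx)

variable [IsAffine X] [IsAffine Y] [IsClosedImmersion i] {π : Y ⟶ X} (h : i ≫ π = 𝟙 X)
  (hs : (globalMap π).FormallySmooth) (hp : (globalMap π).FinitePresentation)
  (he : IsResolution e)

include h hs hp he

-- Surjectivity on cohomology sheaves. Off X there is nothing to prove. Near X the Koszul cocycles
-- of local coordinates generate, and they are the product cocycles of the dual vectors, hence
-- images of wedges up to sign and coboundary.
set_option maxHeartbeats 800000 in
theorem IsWedgeProduct.exists_local_eq (hθ : IsWedgeProduct e ε θ) (V : Y.Opens)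
    (φ : sheafHomSections ((pushforward i).obj (structureSheaf X)) (J.X q) V)
    (hφ : sheafHomPostcomp _ (J.d q (q + 1)) V φ = 0) (y : Y) (hy : y ∈ V) :
    ∃ (W : Y.Opens) (hW : W ≤ V), y ∈ W ∧
      ∃ (n : Γ((pushforward i).obj (exteriorPower (normalSheaf i) q), W))
        (χ : sheafHomSections ((pushforward i).obj (structureSheaf X)) (J.X (q - 1)) W),
        sheafHomRestrict _ _ hW φ = mulHomSections θ W n +
          sheafHomPostcomp _ (J.d (q - 1) q) W χ := by
  by_cases hyi : y ∈ Set.range i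
  · obtain ⟨x, rfl⟩ := hyi
    obtain ⟨κ, hκ, c, hc⟩ := exists_regularCoordinates_at h hs hp x
    obtain ⟨n, ⟨σ⟩⟩ := Finite.exists_equiv_fin κ
    choose v hv using fun k => exists_normalForm_eq i (c.v k)
    let D := koszulCocycles he c v hv σ.symm
    have hu : ∀ V' ≤ V ⊓ Y.basicOpen c.g, IsUnit (resFun (le_top : V' ≤ ⊤) D.g) := fun V' hV' =>
      isUnit_resFun (hV'.trans inf_le_right)
    have hD := D.locallyGenerates_target (koszulCocycles_desc_injective he c v hv σ.symm
      inf_le_right (List.finRange n) List.mem_finRange) (D.locallyGenerates hu (List.finRange n)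
      (List.nodup_finRange n) (koszulCocycles_regular he c v hv σ.symm inf_le_right _
        (List.nodup_finRange n)) (q - 1) q (q + 1) (by omega) rfl)
    obtain ⟨W, hW, hxW, r, χ, e₁⟩ := hD _ le_rfl (sheafHomRestrict _ _ inf_le_left φ) (by
      rw [← sheafHomRestrict_postcomp, hφ, map_zero]) (i x) ⟨hy, hc⟩
    -- The coefficients are multiplied by ε in advance, so that the sign of the wedge product
    -- cancels by ε² = 1.
    obtain ⟨χ', e₂⟩ := hθ.exists_mulHomSections_sum (fun j : SublistIdx (List.finRange n) (q : ℤ) =>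
      fun k => v (σ.symm (j.vec k))) fun j => ε • r j
    have e₃ : (fun j : SublistIdx (List.finRange n) (q : ℤ) =>
        productCocycle (degreeZero e) (List.ofFn fun k => v (σ.symm (j.vec k))) q) =
        fun j => D.θ j.toList q := funext fun j => by
      rw [← j.ofFn_vec]
      exact congrArg (fun L => productCocycle (degreeZero e) L q)
        (List.map_ofFn (f := j.vec) (g := fun a => v (σ.symm a))).symm
    have e₄ : (fun j => ε • ε • r j) = r := funext fun j => by
      rw [smul_smul, Int.units_mul_self, one_smul]
    rw [e₃, e₄] at e₂
    exact ⟨W, hW.trans inf_le_left, hxW, ∑ j, (ε • r j) • pushforwardSection i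
      (wedge _ fun k => v (σ.symm (j.vec k))) W, χ - χ',
      (sheafHomPostcomp _ (J.d (q - 1) q) W).eq_add_map_sub e₁ e₂⟩
  · obtain ⟨W, hW, hyW, hW'⟩ := exists_preimage_eq_bot hy hyi
    exact ⟨W, hW, hyW, 0, 0, sheafHomSections_eq_of_preimage_eq_bot hW' _ _⟩

omit [IsClosedImmersion i] he in
theorem span_res_eq_top_of_regularCoordinates {κ : Type u} [Fintype κ]
    (c : RingHom.RegularCoordinates (globalMap i) κ) (v : κ → Γ(normalSheaf i, ⊤))
    (hv : ∀ k, normalForm i (v k) = c.v k) {U : X.Opens} (hU : U ≤ X.basicOpen (globalMap i c.g)) :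
    Submodule.span Γ(X, U) (Set.range fun k => res (normalSheaf i) (le_top : U ≤ ⊤) (v k)) = ⊤ := by
  refine eq_top_iff.mpr fun χ _ => ?_
  have hu : IsUnit (resFun (le_top : U ≤ ⊤) (globalMap i c.g)) := isUnit_resFun hU
  have e := smul_eq_sum_of_regularCoordinates h hs hp c v hv hu χ
  obtain ⟨b, hb⟩ := hu.exists_left_inv
  have e' : χ = b • resFun (le_top : U ≤ ⊤) (globalMap i c.g) • χ := by
    rw [smul_smul, hb, one_smul]
  rw [e', e]
  exact Submodule.smul_mem _ _ (Submodule.sum_mem _ fun k _ =>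
    Submodule.smul_mem _ _ (Submodule.subset_span ⟨k, rfl⟩))

/-- Injectivity on cohomology sheaves. Near X the section m is a combination of wedges of the dual
vectors, so its image is a combination of Koszul cocycles; if this is a coboundary, independence
makes the coefficients vanish on X. -/
theorem IsWedgeProduct.eq_zero (hθ : IsWedgeProduct e ε θ) (V : Y.Opens)
    (m : Γ((pushforward i).obj (exteriorPower (normalSheaf i) q), V))
    (χ : sheafHomSections ((pushforward i).obj (structureSheaf X)) (J.X (q - 1)) V)
    (hm : mulHomSections θ V m = sheafHomPostcomp _ (J.d (q - 1) q) V χ) : m = 0 := by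
  refine eq_zero_of_locally_eq_zero _ _ fun y hy => ?_
  by_cases hyi : y ∈ Set.range i
  · obtain ⟨x, rfl⟩ := hyi
    obtain ⟨κ, hκ, c, hc⟩ := exists_regularCoordinates_at h hs hp x
    obtain ⟨n, ⟨σ⟩⟩ := Finite.exists_equiv_fin κ
    have := Fintype.ofFinite κ
    choose v hv using fun k => exists_normalForm_eq i (c.v k)
    let D := koszulCocycles he c v hv σ.symm
    have hu : ∀ V' ≤ V ⊓ Y.basicOpen c.g, IsUnit (resFun (le_top : V' ≤ ⊤) D.g) := fun V' hV' =>
      isUnit_resFun (hV'.trans inf_le_right)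
    have hD := D.independentModulo_target (D.independentModulo hu (List.finRange n)
      (List.nodup_finRange n) (koszulCocycles_regular he c v hv σ.symm inf_le_right _
        (List.nodup_finRange n)) (q - 1) q (by omega))
    have hxV : x ∈ i ⁻¹ᵁ (V ⊓ Y.basicOpen c.g) := ⟨hy, hc⟩
    obtain ⟨V₁, hV₁, hxV₁, r, hr⟩ := exists_local_eq_sum_wedge (fun k => v (σ.symm k))
      (U := i ⁻¹ᵁ (V ⊓ Y.basicOpen c.g)) (fun V' hV' => by
        have e₁ := span_res_eq_top_of_regularCoordinates h hs hp c v hv (U := V') (by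
          have := i.preimage_basicOpen (U := ⊤) c.g
          exact (hV'.trans (i.preimage_mono inf_le_right)).trans this.le)
        rw [← e₁]
        congr 1
        exact σ.symm.surjective.range_comp fun k => res _ le_top (v k))
      q (res ((pushforward i).obj _) inf_le_left m) hxV
    obtain ⟨W₁, hW₁, hxW₁, hW₁'⟩ := exists_preimage_le (V := V ⊓ Y.basicOpen c.g) hxV hxV₁
    obtain ⟨f, hf, hxf⟩ := exists_basicOpen_le hxW₁
    -- The coefficients are functions on X. Over an affine open subset of Y they lift to Y because i
    -- is a closed immersion.
    choose r' hr' using fun j => i.app_surjective (Y.basicOpen f)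
      ((isAffineOpen_top Y).basicOpen f) (resFun ((i.preimage_mono hf).trans hW₁') (r j))
    have hfV := (hf.trans hW₁).trans inf_le_left
    refine ⟨Y.basicOpen f, hfV, hxf, ?_⟩
    have e₁ : res _ hfV m = ∑ j, r' j • pushforwardSection i
        (wedge (normalSheaf i) fun k => v (σ.symm (j.vec k))) (Y.basicOpen f) := by
      have e₂ := congrArg (res (exteriorPower (normalSheaf i) q)
        ((i.preimage_mono hf).trans hW₁')) hr
      rw [map_sum] at e₂
      refine (((res_res (exteriorPower (normalSheaf i) q) _ _ _).trans (res_res (exteriorPower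
        (normalSheaf i) q) _ (i.preimage_mono inf_le_left) m)).symm.trans e₂).trans
        (Finset.sum_congr rfl fun j _ => ?_)
      rw [res_smul, res_res, ← hr']
      rfl
    obtain ⟨χ', e₂⟩ := hθ.exists_mulHomSections_sum (fun j : SublistIdx (List.finRange n) (q : ℤ) =>
      fun k => v (σ.symm (j.vec k))) r'
    have e₃ : (fun j : SublistIdx (List.finRange n) (q : ℤ) =>
        productCocycle (degreeZero e) (List.ofFn fun k => v (σ.symm (j.vec k))) q) =
        fun j => D.θ j.toList q := funext fun j => by
      rw [← j.ofFn_vec]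
      exact congrArg (fun L => productCocycle (degreeZero e) L q)
        (List.map_ofFn (f := j.vec) (g := fun a => v (σ.symm a))).symm
    rw [e₃, ← e₁] at e₂
    have e₄ : mulHomSections θ _ (res _ hfV m) = sheafHomPostcomp _ (J.d (q - 1) q) _
        (sheafHomRestrict _ _ hfV χ) := by
      rw [← sheafHomRestrict_postcomp, ← hm]
      exact app_res (mulHom θ) hfV m
    have e₅ := hD _ (hf.trans hW₁) (fun j => ε • r' j) (sheafHomRestrict _ _ hfV χ - χ') (by
      rw [map_sub, ← e₄, e₂, add_sub_cancel_right])
    rw [e₁]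
    refine Finset.sum_eq_zero fun j _ => ?_
    have e₆ : i.app (Y.basicOpen f) (r' j) = 0 := by
      rcases Int.units_eq_one_or ε with rfl | rfl
      · have := e₅ j
        rw [one_smul] at this
        exact this
      · have := e₅ j
        rw [Units.neg_smul, one_smul, toPushforward_app, map_neg] at this
        exact neg_eq_zero.mp this
    refine (congrArg (fun a : Γ(X, i ⁻¹ᵁ Y.basicOpen f) => a • res (exteriorPower (normalSheaf i) q)
      (le_top : i ⁻¹ᵁ Y.basicOpen f ≤ ⊤) (wedge (normalSheaf i) fun k => v (σ.symm (j.vec k))))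
      e₆).trans (zero_smul _ _)
  · obtain ⟨W, hW, hyW, hW'⟩ := exists_preimage_eq_bot hy hyi
    exact ⟨W, hW, hyW, eq_of_preimage_eq_bot hW' _ _⟩

omit h hs hp he [IsAffine X] [IsAffine Y] [IsClosedImmersion i] in
theorem pushforwardExteriorComplex_d (p r : ℤ) :
    (pushforwardExteriorComplex i (normalSheaf i)).obj.d p r = 0 :=
  (pushforward i).map_zero _ _

/-- The morphism of complexes `E ⟶ ℋom(i_* 𝒪_X, J)` sending `n` to `a ↦ Θ (a • n)`. -/
def mulHomComplex (i : X ⟶ Y) {J : CochainComplex Y.Modules ℤ}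
    (Θ : (pushforwardExteriorComplex i (normalSheaf i)).obj ⟶ J) :
    (pushforwardExteriorComplex i (normalSheaf i)).obj ⟶
      ((sheafHom ((pushforward i).obj (structureSheaf X))).mapHomologicalComplex
        (ComplexShape.up ℤ)).obj J :=
  (NatTrans.mapHomologicalComplex (pushforwardToSheafHom i) (ComplexShape.up ℤ)).app
    (exteriorComplex (normalSheaf i)).obj ≫
  ((sheafHom ((pushforward i).obj (structureSheaf X))).mapHomologicalComplex
    (ComplexShape.up ℤ)).map Θ

theorem quasiIso_mulHomComplex (Θ : (pushforwardExteriorComplex i (normalSheaf i)).obj ⟶ J)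
    (ε : ℕ → ℤˣ) (hΘ : ∀ q : ℕ, IsWedgeProduct e (ε q) (q := q) (Θ.f (q : ℤ))) :
    QuasiIso (mulHomComplex i Θ) := by
  refine quasiIso_of_local _ pushforwardExteriorComplex_d ?_ ?_
  · rintro (q | q) V s hs' y hy
    · exact (hΘ q).exists_local_eq h hs hp he V s hs' y hy
    · have h₁ : IsZero ((sheafHom ((pushforward i).obj (structureSheaf X))).obj
          (J.X (Int.negSucc q))) := Functor.map_isZero _ (he.isZero _ (Int.negSucc_lt_zero q))
      have h₂ : ∀ W (t : Γ((sheafHom ((pushforward i).obj (structureSheaf X))).obj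
          (J.X (Int.negSucc q)), W)), t = 0 := fun W t =>
        congrArg (fun k : _ ⟶ _ => Hom.app k W t) (h₁.eq_of_src (𝟙 _) 0)
      exact ⟨V, le_rfl, hy, 0, 0, (h₂ _ _).trans (h₂ _ _).symm⟩
  · rintro (q | q) V n χ hn
    · exact (hΘ q).eq_zero h hs hp he V n χ hn
    · have h₁ : IsZero ((pushforward i).obj (0 : X.Modules)) := Functor.map_isZero _ (isZero_zero _)
      exact congrArg (fun k : (pushforward i).obj (0 : X.Modules) ⟶ _ => Hom.app k V n)
        (h₁.eq_of_src (𝟙 _) 0)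

end Multiplication

/-! ### Chain maps and homotopies from a dual basis. -/

section Chain

theorem DualBasis.sum_form_comp_homOfSection {X : Scheme.{u}} {M : X.Modules} {ι : Type} [Fintype ι]
    (b : DualBasis M ι) : ∑ k, b.form k ≫ homOfSection (b.e k) = 𝟙 M :=
  hom_ext' fun U m => (hom_sum_app _ _ U m).trans (b.sum_eq U m).symm

variable {X Y : Scheme.{u}} [IsAffine X] [IsAffine Y] {i : X ⟶ Y} [IsClosedImmersion i]
  {π : Y ⟶ X} (h : i ≫ π = 𝟙 X) (hs : (globalMap π).FormallySmooth)
  {J : CochainComplex Y.Modules ℤ} {e : (pushforward i).obj (structureSheaf X) ⟶ J.X 0}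
  (he : IsResolution e) {n : ℕ} (b : DualBasis (normalSheaf i) (Fin n))

/-- The morphism which sends `v₁ ∧ ⋯ ∧ v_q` to the Yoneda product of the classes attached to the
`v_k`, up to the sign `ε`, defined by means of a dual basis. -/
def wedgeProductHom (e : (pushforward i).obj (structureSheaf X) ⟶ J.X 0)
    (he : IsResolution e) (b : DualBasis (normalSheaf i) (Fin n)) (ε : ℤˣ) (q : ℕ) :
    (pushforward i).obj (exteriorPower (normalSheaf i) q) ⟶ J.X q :=
  have := he.injective
  ε • ∑ s, (pushforward i).map ((b.exteriorPower q).form s) ≫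
    productCocycle (degreeZero e)
      (List.ofFn (b.e ∘ Set.powersetCard.ofFinEmbEquiv.symm s)) (q : ℤ)

omit [IsAffine X] [IsAffine Y] in
theorem wedgeProductHom_comp_d (ε : ℤˣ) (q : ℕ) (r : ℤ) :
    wedgeProductHom e he b ε q ≫ J.d q r = 0 := by
  rw [wedgeProductHom, Linear.units_smul_comp, Preadditive.sum_comp, Finset.sum_eq_zero,
    smul_zero]
  intro s _
  rw [Category.assoc, productCocycle_comp_d he.injective _ he.degreeZero_comp_d, comp_zero]

omit [IsAffine X] [IsAffine Y] [IsClosedImmersion i] in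
theorem map_homOfSection_wedge_comp {q : ℕ} (v : Fin q → Γ(normalSheaf i, ⊤))
    (l : Fin q → (normalSheaf i ⟶ structureSheaf X)) :
    (pushforward i).map (homOfSection (wedge _ v)) ≫ (pushforward i).map (exteriorForm l) =
      pushforwardSmul i (exteriorFormAt l ⊤ (_root_.exteriorPower.ιMulti _ q v)) := by
  refine ((pushforward i).map_comp _ _).symm.trans (congrArg (pushforward i).map ?_)
  refine (homOfSection_comp _ _).trans ?_
  rw [wedge_eq, exteriorForm_app]
  refine (homOfSection_ofFun_comp _ (𝟙 _)).trans (Category.comp_id _)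

-- An arbitrary wedge is a combination of basis wedges with determinants as coefficients. The
-- product cocycles satisfy the same relation up to a coboundary.
include h hs in
theorem isWedgeProduct_wedgeProductHom (ε : ℤˣ) (q : ℕ) :
    IsWedgeProduct e ε (wedgeProductHom e he b ε q) := fun v => by
  obtain ⟨x, hx⟩ := exists_productCocycle_sub_sum_eq he.injective h (degreeZero e)
    he.degreeZero_comp_d hs b v (q : ℤ)
  refine ⟨-(ε • x), ?_⟩
  rw [wedgeProductHom, Linear.comp_units_smul, Preadditive.neg_comp,
    Linear.units_smul_comp, ← hx, ← sub_eq_add_neg, ← smul_sub, sub_sub_cancel,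
    Preadditive.comp_sum]
  congr 1
  refine Finset.sum_congr rfl fun s _ => ?_
  exact (Category.assoc _ _ _).symm.trans (congrArg (· ≫ _) (map_homOfSection_wedge_comp v _))

/-- The morphism of complexes with components `wedgeProductHom`. -/
def wedgeProductComplexHom (e : (pushforward i).obj (structureSheaf X) ⟶ J.X 0)
    (he : IsResolution e) (b : DualBasis (normalSheaf i) (Fin n)) (ε : ℕ → ℤˣ) :
    (pushforwardExteriorComplex i (normalSheaf i)).obj ⟶ J where
  f
    | Int.ofNat q => wedgeProductHom e he b (ε q) q
    | Int.negSucc _ => 0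
  comm' := by
    rintro (q | q) r -
    · rw [pushforwardExteriorComplex_d, zero_comp]
      exact wedgeProductHom_comp_d he b (ε q) q r
    · rw [pushforwardExteriorComplex_d, zero_comp]
      exact (Limits.zero_comp (C := Y.Modules)).symm

-- Insert the decomposition of the identity of ⋀^q by its dual basis. Only basis wedges are used, so
-- the primitives `x v` need not depend linearly on v.
omit [IsAffine X] [IsAffine Y] [IsClosedImmersion i] in
theorem eq_comp_of_wedge_comp_eq {q : ℕ} {N N' : Y.Modules} (d : N' ⟶ N)
    (θ : (pushforward i).obj (exteriorPower (normalSheaf i) q) ⟶ N)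
    (x : (Fin q → Γ(normalSheaf i, ⊤)) → ((pushforward i).obj (structureSheaf X) ⟶ N'))
    (hx : ∀ v, (pushforward i).map (homOfSection (wedge _ v)) ≫ θ = x v ≫ d) :
    θ = (∑ s, (pushforward i).map ((b.exteriorPower q).form s) ≫
      x (b.e ∘ Set.powersetCard.ofFinEmbEquiv.symm s)) ≫ d := by
  have h₁ := congrArg (pushforward i).map (b.exteriorPower q).sum_form_comp_homOfSection
  rw [CategoryTheory.Functor.map_id, Functor.map_sum] at h₁
  refine (Category.id_comp θ).symm.trans ((congrArg (· ≫ θ) h₁.symm).trans ?_)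
  rw [Preadditive.sum_comp, Preadditive.sum_comp]
  refine Finset.sum_congr rfl fun s _ => ?_
  rw [Functor.map_comp, Category.assoc, Category.assoc]
  exact congrArg (_ ≫ ·) (hx _)

omit [IsAffine X] [IsAffine Y] [IsClosedImmersion i] in
/-- A morphism from `E`, the differential of which is zero, is null-homotopic if its restrictions
along all `v₁ ∧ ⋯ ∧ v_q` are coboundaries. -/
theorem nonempty_homotopy_zero (b : DualBasis (normalSheaf i) (Fin n))
    (δ : (pushforwardExteriorComplex i (normalSheaf i)).obj ⟶ J)
    (hδ : ∀ (q : ℕ) (v : Fin q → Γ(normalSheaf i, ⊤)),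
      ∃ x : (pushforward i).obj (structureSheaf X) ⟶ J.X (q - 1),
        (pushforward i).map (homOfSection (wedge _ v)) ≫ δ.f (q : ℤ) = x ≫ J.d (q - 1) q) :
    Nonempty (Homotopy δ 0) := by
  have h₁ : ∀ q p : ℤ, ∃ y : (pushforwardExteriorComplex i (normalSheaf i)).obj.X q ⟶ J.X p,
      p + 1 = q → δ.f q = y ≫ J.d p q := by
    intro q p
    by_cases h : p + 1 = q
    · obtain rfl : p = q - 1 := by omega
      obtain q | q := q
      · choose x hx using hδ q
        exact ⟨_, fun _ => eq_comp_of_wedge_comp_eq b (J.d ((q : ℤ) - 1) q) (δ.f (q : ℤ)) x hx⟩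
      · have h₁ : IsZero ((pushforward i).obj (0 : X.Modules)) :=
          Functor.map_isZero _ (isZero_zero _)
        exact ⟨0, fun _ => h₁.eq_of_src _ _⟩
    · exact ⟨0, fun h' => absurd h' h⟩
  choose y hy using h₁
  -- The differential of the source is zero, so only the term y ≫ d of the homotopy formula
  -- survives.
  refine ⟨⟨fun q p => if p + 1 = q then y q p else 0, fun q p h => if_neg h, fun q => ?_⟩⟩
  rw [dNext_eq _ (i' := q + 1) rfl, prevD_eq _ (j' := q - 1) (by simp),
    pushforwardExteriorComplex_d, zero_comp, zero_add, if_pos (by omega), hy q (q - 1) (by omega)]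
  exact (add_zero _).symm

end Chain

/-! ### Cocycles as morphisms in the derived category. -/

section Cocycles

open CochainComplex HomComplex

universe v₁ u₁

variable {C : Type u₁} [Category.{v₁} C] [Abelian C] {K L M : CochainComplex C ℤ} {n m k : ℤ}

theorem _root_.CochainComplex.HomComplex.Cocycle.equivHomShift_comp_eq
    (f : ShiftedHom K L n) (g : ShiftedHom L M m) (h : m + n = k) :
    (Cocycle.equivHomShift (f.comp g h)).1 =
      (Cocycle.equivHomShift f).1.comp (Cocycle.equivHomShift g).1 (by omega) := by
  ext p q hpq
  rw [Cochain.comp_v _ _ (show n + m = k by omega) p (p + n) q rfl (by omega)]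
  simp only [Cocycle.equivHomShift_apply]
  simp [Cochain.rightUnshift_v _ _ _ _ _ _ _ (add_zero _), ShiftedHom.comp,
    CochainComplex.shiftFunctorAdd'_inv_app_f']
  refine (Category.assoc _ _ _).trans (Eq.trans ?_
    (congrArg (· ≫ g.f (p + n) ≫ (M.XIsoOfEq _).hom) (Category.comp_id (f.f p))).symm)
  refine congrArg (f.f p ≫ ·) ((Category.assoc _ _ _).trans (congrArg (g.f (p + n) ≫ ·) ?_))
  exact HomologicalComplex.XIsoOfEq_hom_comp_XIsoOfEq_hom _ _ _

variable [HasDerivedCategory.{w} C]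

/-- The morphism in the derived category given by a cocycle. -/
def _root_.DerivedCategory.ofCocycle :
    Cocycle K L n →+ ShiftedHom (DerivedCategory.Q.obj K) (DerivedCategory.Q.obj L) n where
  toFun z := ShiftedHom.map (Cocycle.equivHomShift.symm z) DerivedCategory.Q
  map_zero' := by rw [map_zero, ShiftedHom.map_zero]
  map_add' _ _ := by rw [map_add, ShiftedHom.map_add]

open DerivedCategory

theorem _root_.DerivedCategory.ofCocycle_apply (z : Cocycle K L n) :
    ofCocycle z = ShiftedHom.map (Cocycle.equivHomShift.symm z) DerivedCategory.Q := rfl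

theorem _root_.DerivedCategory.Q_map_eq_zero_of_homotopy {f : K ⟶ L} (h : Homotopy f 0) :
    Q.map f = 0 := by
  have h₁ := (quotientCompQhIso C).hom.naturality f
  have h₂ : (HomotopyCategory.quotient C (ComplexShape.up ℤ)).map f = 0 :=
    (HomotopyCategory.quotient_map_eq_zero_iff f).mpr ⟨h⟩
  rw [Functor.comp_map, h₂, Functor.map_zero, zero_comp] at h₁
  exact (cancel_epi _).mp (h₁.symm.trans comp_zero.symm)

theorem _root_.DerivedCategory.ofCocycle_eq_zero (z : Cocycle K L n) (β : Cochain K L m)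
    (h : δ m n β = z.1) (hm : m + 1 = n) : ofCocycle z = 0 := by
  have h₁ := (CohomologyClass.toHom_mk_eq_zero_iff z).mpr ⟨m, hm, β, h⟩
  rw [CohomologyClass.toHom_mk, HomotopyCategory.quotient_map_eq_zero_iff] at h₁
  rw [ofCocycle_apply, ShiftedHom.map, Q_map_eq_zero_of_homotopy h₁.some, zero_comp]

theorem _root_.DerivedCategory.Q_map_comp_ofCocycle (g : M ⟶ K) (z : Cocycle K L n) :
    Q.map g ≫ ofCocycle z = ofCocycle (z.precomp g) := by
  rw [ofCocycle_apply, ofCocycle_apply, Cocycle.equivHomShift_symm_precomp, ShiftedHom.map,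
    ShiftedHom.map, Functor.map_comp, Category.assoc]

/-- The composition of cocycles. -/
def _root_.CochainComplex.HomComplex.Cocycle.comp (a : Cocycle K L n) (b : Cocycle L M m)
    (h : n + m = k) : Cocycle K M k :=
  Cocycle.mk (a.1.comp b.1 h) (k + 1) rfl (by
    rw [δ_comp a.1 b.1 h (n + 1) (m + 1) (k + 1) rfl rfl rfl]
    simp)

theorem _root_.DerivedCategory.ofCocycle_comp (a : Cocycle K L n) (b : Cocycle L M m)
    (h : m + n = k) :
    ShiftedHom.comp (ofCocycle a) (ofCocycle b) h = ofCocycle (a.comp b (by omega)) := by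
  rw [ofCocycle_apply, ofCocycle_apply, ofCocycle_apply, ← ShiftedHom.map_comp]
  congr 1
  apply Cocycle.equivHomShift.injective
  ext1
  rw [Cocycle.equivHomShift_comp_eq, AddEquiv.apply_symm_apply, AddEquiv.apply_symm_apply,
    AddEquiv.apply_symm_apply]
  rfl

/-- The class of `z`, up to sign, is the product of the connecting homomorphism with a class given
by a lifting of `z`. -/
theorem _root_.DerivedCategory.triangleOfSESδ_comp_ofCocycle
    {S : ShortComplex (CochainComplex C ℤ)} (hS : S.ShortExact) {q' q : ℤ} (h : q' + 1 = q)
    (Ψ : Cochain S.X₂ L q') (w : Cocycle S.X₁ L q') (z : Cocycle S.X₃ L q)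
    (hw : (Cochain.ofHom S.f).comp Ψ (zero_add _) = w.1)
    (hz : δ q' q Ψ = (Cochain.ofHom S.g).comp z.1 (zero_add _)) :
    ShiftedHom.comp (triangleOfSESδ hS) (ofCocycle w) h =
      q.negOnePow • ofCocycle z := by
  have := CochainComplex.mappingCone.quasiIso_descShortComplex hS
  -- Compare on the mapping cone of S.f, which is quasi-isomorphic to S.X₃; there the connecting
  -- homomorphism is -`fst`.
  rw [← cancel_epi (Q.map (CochainComplex.mappingCone.descShortComplex S))]
  have h₁ : Q.map (CochainComplex.mappingCone.descShortComplex S) ≫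
      ShiftedHom.comp (triangleOfSESδ hS) (ofCocycle w) h =
      ShiftedHom.comp (ofCocycle (-(mappingCone.fst S.f))) (ofCocycle w) h := by
    rw [ShiftedHom.comp, ShiftedHom.comp, ← Category.assoc]
    congr 1
    exact descShortComplex_triangleOfSESδ hS
  rw [h₁, ofCocycle_comp, Linear.comp_units_smul, Q_map_comp_ofCocycle, Units.smul_def,
    ← map_zsmul, ← sub_eq_zero, ← map_sub]
  -- The primitive is Ψ on the second component of the cone. Its coboundary has one term from δ Ψ,
  -- which gives z, and one from δ `snd` = -`fst` ≫ S.f, which gives w; the sign makes the second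
  -- term enter with coefficient one.
  refine ofCocycle_eq_zero _ (q'.negOnePow • (mappingCone.snd S.f).comp Ψ (zero_add _)) ?_ h
  rw [δ_units_smul, δ_zero_cochain_comp _ _ _ h, hz, mappingCone.δ_snd]
  have h₂ : (q.negOnePow : ℤ) = -(q'.negOnePow : ℤ) := by
    rw [← h, Int.negOnePow_succ]; rfl
  rw [h₂, neg_smul, sub_neg_eq_add]
  have h₃ : (Cochain.ofHom (mappingCone.descShortComplex S)).comp z.1 (zero_add _) =
      (mappingCone.snd S.f).comp ((Cochain.ofHom S.g).comp z.1 (zero_add _)) (zero_add _) := by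
    rw [mappingCone.descShortComplex, mappingCone.ofHom_desc, mappingCone.descCochain]
    simp [Cochain.comp_assoc_of_first_is_zero_cochain]
  change _ = (-(mappingCone.fst S.f).1).comp w.1 (show 1 + q' = q by omega) +
    (q'.negOnePow : ℤ) • (Cochain.ofHom (mappingCone.descShortComplex S)).comp z.1 (zero_add _)
  rw [h₃, smul_add, smul_smul, Int.units_mul_self, one_smul, ← hw, add_comm, Cochain.neg_comp,
    Cochain.neg_comp, Cochain.comp_assoc_of_second_is_zero_cochain]
  rfl

/-- The cochain recipe for the Yoneda product agrees with composition with the class of the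
extension, at the price of (-1)^q in target degree q. -/
theorem _root_.CategoryTheory.ShortComplex.ShortExact.singleδ_comp_ofCocycle
    {S : ShortComplex C} (hS : S.ShortExact) {q' q : ℤ} (h : q' + 1 = q)
    (ψ : S.X₂ ⟶ L.X q') (w : S.X₁ ⟶ L.X q') (z : S.X₃ ⟶ L.X q) (hψ : S.f ≫ ψ = w)
    (hψ' : ψ ≫ L.d q' q = S.g ≫ z) (hw : w ≫ L.d q' (q' + 1) = 0) (hz : z ≫ L.d q (q + 1) = 0) :
    ShiftedHom.comp hS.singleδ
      (ofCocycle (Cocycle.fromSingleMk w (zero_add _) (q' + 1) rfl hw)) h =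
      q.negOnePow • ofCocycle (Cocycle.fromSingleMk z (zero_add _) (q + 1) rfl hz) := by
  have h₁ : hS.singleδ =
      triangleOfSESδ (hS.map_of_exact (HomologicalComplex.single C (ComplexShape.up ℤ) 0)) := by
    have e₁ := NatTrans.congr_app (singleFunctorsPostcompQIso_hom_hom C 0) S.X₃
    have e₂ := NatTrans.congr_app (singleFunctorsPostcompQIso_inv_hom C 0) S.X₁
    refine (congrArg₂ (fun f g => f ≫
      triangleOfSESδ (hS.map_of_exact (HomologicalComplex.single C (ComplexShape.up ℤ) 0)) ≫
      g⟦(1 : ℤ)⟧') e₁ e₂).trans ?_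
    refine (Category.id_comp _).trans ((congrArg (_ ≫ ·) (CategoryTheory.Functor.map_id _ _)).trans
      (Category.comp_id _))
  rw [h₁]
  refine triangleOfSESδ_comp_ofCocycle
    (hS.map_of_exact (HomologicalComplex.single C (ComplexShape.up ℤ) 0)) h
    (Cochain.fromSingleMk ψ (zero_add _))
    (Cocycle.fromSingleMk w (zero_add _) (q' + 1) rfl hw)
    (Cocycle.fromSingleMk z (zero_add _) (q + 1) rfl hz) ?_ ?_
  · exact (Cochain.fromSingleMk_precomp _ _ _).symm.trans
      (congrArg (fun f => Cochain.fromSingleMk f (zero_add q')) hψ)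
  · exact (Cochain.δ_fromSingleMk ψ (zero_add _) q q (zero_add _)).trans
      ((congrArg (fun f => Cochain.fromSingleMk f (zero_add q)) hψ').trans
        (Cochain.fromSingleMk_precomp _ _ _))

omit [HasDerivedCategory C] in
theorem _root_.CochainComplex.HomComplex.Cocycle.equivHomShift_symm_fromSingleMk {F : C} {q : ℤ}
    (z : F ⟶ L.X q) (hz : z ≫ L.d q (q + 1) = 0)
    (hz' : ∀ k, (ComplexShape.up ℤ).Rel q k → z ≫ L.d q k = 0) :
    Cocycle.equivHomShift.symm (Cocycle.fromSingleMk z (zero_add q) (q + 1) rfl hz) =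
      ((CochainComplex.singleFunctors C).shiftIso q 0 q (add_zero q)).inv.app F ≫
        (CategoryTheory.shiftFunctor (CochainComplex C ℤ) q).map
          (HomologicalComplex.mkHomFromSingle z hz') := by
  refine HomologicalComplex.from_single_hom_ext ?_
  have h₁ : (Cocycle.equivHomShift.symm
      (Cocycle.fromSingleMk z (zero_add q) (q + 1) rfl hz)).f 0 =
      (HomologicalComplex.singleObjXSelf (.up ℤ) 0 F).hom ≫ z ≫
        (L.shiftFunctorObjXIso q 0 q (zero_add q).symm).inv := by
    rw [Cocycle.equivHomShift_symm_apply]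
    refine (Cochain.rightShift_v _ q 0 (zero_add q) 0 0 (zero_add 0) q (zero_add q)).trans ?_
    exact (congrArg (· ≫ _) (Cochain.fromSingleMk_v z (zero_add q))).trans (Category.assoc _ _ _)
  rw [h₁]
  have h₂ : (HomologicalComplex.mkHomFromSingle z hz').f (0 + q) =
    (HomologicalComplex.singleObjXIsoOfEq (.up ℤ) q F (0 + q) (zero_add q)).hom ≫ z ≫
      (L.XIsoOfEq (zero_add q)).inv := dif_pos (zero_add q)
  refine Eq.trans ?_ (congrArg ((((CochainComplex.singleFunctors C).shiftIso q 0 q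
    (add_zero q)).inv.app F).f 0 ≫ ·) h₂).symm
  refine Eq.trans ?_ (Category.assoc _ _ _)
  refine congrArg₂ (fun f g => f ≫ z ≫ g) ?_ rfl
  have h₃ : ∀ {A B D : C} (h : A = B) (h' : B = D),
      eqToHom (h.trans h') = eqToHom h ≫ eqToHom h' := fun h h' => (eqToHom_trans h h').symm
  have h₄ : ((HomologicalComplex.single C (.up ℤ) 0).obj F).X 0 =
      ((HomologicalComplex.single C (.up ℤ) q).obj F).X (0 + q) := by
    simp [HomologicalComplex.single]
  have h₅ : ((HomologicalComplex.single C (.up ℤ) q).obj F).X (0 + q) = F := by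
    simp [HomologicalComplex.single]
  exact h₃ h₄ h₅

/-- Two descriptions of the class of z : F → L^q agree: the q-fold shift of a chain map from F
placed in degree q, as in `IsHKR`, and a degree q cocycle on F placed in degree 0. -/
theorem _root_.DerivedCategory.shiftIso_inv_app_comp {F : C} {q : ℤ}
    (z : F ⟶ L.X q) (hz : z ≫ L.d q (q + 1) = 0)
    (hz' : ∀ k, (ComplexShape.up ℤ).Rel q k → z ≫ L.d q k = 0) :
    ((DerivedCategory.singleFunctors C).shiftIso q 0 q (add_zero q)).inv.app F ≫
      (Q.map (HomologicalComplex.mkHomFromSingle z hz'))⟦q⟧' =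
    ofCocycle (Cocycle.fromSingleMk z (zero_add q) (q + 1) rfl hz) := by
  have h₁ : ((DerivedCategory.singleFunctors C).shiftIso q 0 q (add_zero q)).inv.app F =
      Q.map (((CochainComplex.singleFunctors C).shiftIso q 0 q (add_zero q)).inv.app F) ≫
        (Q.commShiftIso q).hom.app _ := by
    have e₁ := NatTrans.congr_app ((singleFunctorsPostcompQIso C).hom.comm q 0 q (add_zero q)) F
    rw [singleFunctorsPostcompQIso_hom_hom, singleFunctorsPostcompQIso_hom_hom] at e₁
    have e₂ : ((DerivedCategory.singleFunctors C).shiftIso q 0 q (add_zero q)).app F =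
        (((CochainComplex.singleFunctors C).postcomp Q).shiftIso q 0 q (add_zero q)).app F := by
      ext1
      exact (Category.comp_id _).symm.trans (e₁.trans ((congrArg (· ≫ _)
        (CategoryTheory.Functor.map_id _ _)).trans (Category.id_comp _)))
    exact (congrArg Iso.inv e₂).trans (SingleFunctors.postcomp_shiftIso_inv_app _ _ _ _ _ _ _)
  rw [ofCocycle_apply, Cocycle.equivHomShift_symm_fromSingleMk z hz hz', ShiftedHom.map,
    Functor.map_comp, Category.assoc]
  refine (congrArg (· ≫ _) h₁).trans ((Category.assoc _ _ _).trans ?_)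
  exact congrArg (_ ≫ ·) ((Q.commShiftIso q).hom.naturality _).symm

end Cocycles

/-! ### Product cocycles represent Yoneda products. -/

section ExtProduct

open CochainComplex.HomComplex DerivedCategory

/-- The sign of the class of `productCocycle` with respect to the Yoneda product. -/
def productSign : ℕ → ℤˣ
  | 0 => 1
  -- Each connecting homomorphism contributes (-1) to the degree reached, so the total sign is
  -- (-1)^(q(q+1)/2).
  | q + 1 => ((q + 1 : ℕ) : ℤ).negOnePow * productSign q

theorem _root_.CochainComplex.HomComplex.Cocycle.equivHomShift_symm_fromSingleMk_zero
    {C : Type*} [Category* C] [Abelian C] {J : CochainComplex C ℤ} {F : C}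
    (ι : (CochainComplex.singleFunctor C 0).obj F ⟶ J) (n : ℤ) (hn : n = 0)
    (e : F ⟶ J.X n)
    (he : ∀ h : n = 0, e =
      ((HomologicalComplex.singleObjXSelf (.up ℤ) 0 F).inv ≫ ι.f 0 ≫ (J.XIsoOfEq h).inv))
    (hd : e ≫ J.d n (n + 1) = 0) :
    Cocycle.equivHomShift.symm (Cocycle.fromSingleMk e (zero_add n) (n + 1) rfl hd) =
      ShiftedHom.mk₀ n hn ι := by
  subst hn
  refine HomologicalComplex.from_single_hom_ext ?_
  rw [Cocycle.equivHomShift_symm_apply]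
  refine (Cochain.rightShift_v _ 0 0 (zero_add 0) 0 0 (zero_add 0) 0 (zero_add 0)).trans ?_
  refine (congrArg (· ≫ _) (Cochain.fromSingleMk_v e (zero_add 0))).trans ?_
  have h₁ : (ShiftedHom.mk₀ (0 : ℤ) rfl ι).f 0 = ι.f 0 ≫ (J.XIsoOfEq (add_zero 0)).inv := by
    refine congrArg (ι.f 0 ≫ ·) ?_
    rw [shiftFunctorZero', eqToIso_refl, Iso.refl_trans]
    exact CochainComplex.shiftFunctorZero_inv_app_f J 0
  rw [h₁, he rfl]
  refine (Category.assoc _ _ _).trans ?_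
  refine (congrArg (_ ≫ ·) ((Category.assoc _ _ _).trans
    (congrArg (_ ≫ ·) (Category.comp_id _)))).trans ?_
  exact Iso.hom_inv_id_assoc _ _

theorem _root_.CategoryTheory.ShiftedHom.comp_comp_map_eq {D : Type*} [Category* D] [Preadditive D]
    [HasShift D ℤ] [∀ n : ℤ, (shiftFunctor D n).Additive] {P I Z : D} (δ : ShiftedHom P I (1 : ℤ))
    (φ : I ⟶ P) {q q' : ℤ} (x : ShiftedHom P P q) (ι : P ⟶ Z) (h : q + 1 = q')
    {a : ShiftedHom P Z q} {a' : ShiftedHom I Z q} {b : ShiftedHom P Z q'} {ε ε' : ℤˣ}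
    (ha : x ≫ ι⟦q⟧' = ε • a) (ha' : φ ≫ a = a') (hb : ShiftedHom.comp δ a' h = ε' • b) :
    ShiftedHom.comp (show ShiftedHom P P (1 : ℤ) from δ ≫ φ⟦(1 : ℤ)⟧') x h ≫ ι⟦q'⟧' =
      (ε' * ε) • b := by
  rw [← ShiftedHom.comp_mk₀ _ 0 rfl] at ha ⊢
  rw [← ShiftedHom.comp_mk₀ _ 0 rfl, ShiftedHom.comp_assoc _ _ _ _ (zero_add q) (by omega), ha,
    ShiftedHom.comp_assoc _ _ _ (zero_add 1) (add_zero q) (by omega), ShiftedHom.mk₀_comp,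
    Linear.comp_units_smul, ha', mul_comm, mul_smul, ← hb, Units.smul_def, Units.smul_def]
  exact ShiftedHom.comp_smul _ _ _ _

variable {X Y : Scheme.{u}} {i : X ⟶ Y} [IsClosedImmersion i]
  {J : CochainComplex Y.Modules ℤ}
  (ι : (CochainComplex.singleFunctor Y.Modules 0).obj ((pushforward i).obj (structureSheaf X)) ⟶ J)
  {e : (pushforward i).obj (structureSheaf X) ⟶ J.X 0} (he : IsResolution e)
  (hι : ι.f 0 = (HomologicalComplex.singleObjXSelf (.up ℤ) 0 _).hom ≫ e)
  [HasDerivedCategory.{w} Y.Modules]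

-- Induction on q: the factor `v 0` is applied first and is the head of the list in
-- `productCocycle`, so each step is one use of `singleδ_comp_ofCocycle`.
include hι he in
theorem extProduct_comp_map (q : ℕ) (v : Fin q → Γ(normalSheaf i, ⊤))
    (h : productCocycle (degreeZero e) (List.ofFn v) (q : ℤ) ≫ J.d (q : ℤ) ((q : ℤ) + 1) = 0) :
    extProduct i q v ≫ (Q.map ι)⟦(q : ℤ)⟧' = productSign q •
      ofCocycle (Cocycle.fromSingleMk (productCocycle (degreeZero e) (List.ofFn v) (q : ℤ))
        (zero_add (q : ℤ)) _ rfl h) := by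
  induction q with
  | zero =>
    have h₁ := Cocycle.equivHomShift_symm_fromSingleMk_zero ι ((0 : ℕ) : ℤ) rfl
      (degreeZero e 0) (fun _ => by
        refine (degreeZero_zero e).trans ?_
        rw [hι]
        exact ((congrArg (_ ≫ ·) (Category.comp_id _)).trans
          (Iso.inv_hom_id_assoc _ _)).symm) h
    refine Eq.trans ?_ (one_smul _ _).symm
    refine Eq.trans ?_ (congrArg (fun f => ShiftedHom.map f Q) h₁).symm
    rw [ShiftedHom.map_mk₀]
    refine (ShiftedHom.comp_mk₀ _ 0 rfl _).symm.trans ?_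
    exact ShiftedHom.mk₀_id_comp _ _ _
  | succ q ih =>
    have hq := productCocycle_comp_d he.injective _ he.degreeZero_comp_d
      (List.ofFn (Fin.tail v)) (q : ℤ)
    specialize ih (Fin.tail v) (hq _)
    have h₂ : (DerivedCategory.singleFunctor Y.Modules 0).map (idealToPushforward i (v 0)) ≫
        ofCocycle (Cocycle.fromSingleMk (productCocycle (degreeZero e)
          (List.ofFn (Fin.tail v)) (q : ℤ)) (zero_add (q : ℤ)) _ rfl (hq _)) =
        ofCocycle (Cocycle.fromSingleMk (idealToPushforward i (v 0) ≫ productCocycle (degreeZero e)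
          (List.ofFn (Fin.tail v)) (q : ℤ)) (zero_add (q : ℤ)) _ rfl
          (by rw [Category.assoc, hq, comp_zero])) := by
      refine (Q_map_comp_ofCocycle _ _).trans (congrArg ofCocycle ?_)
      exact (Cocycle.fromSingleMk_precomp _ _ _ _ _ _).symm
    obtain ⟨ψ, hψ, hψ'⟩ := exists_isYonedaProduct_productCocycle he (v 0)
      (List.ofFn (Fin.tail v)) (q : ℤ) ((q + 1 : ℕ) : ℤ) rfl
    have hL : List.ofFn v = v 0 :: List.ofFn (Fin.tail v) := List.ofFn_succ
    have hL' := productCocycle_comp_d he.injective _ he.degreeZero_comp_d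
      (v 0 :: List.ofFn (Fin.tail v)) ((q + 1 : ℕ) : ℤ)
    have h₃ := (idealSequence_shortExact i).singleδ_comp_ofCocycle (L := J)
      (q' := (q : ℤ)) (q := ((q + 1 : ℕ) : ℤ)) rfl ψ _ _ hψ hψ'
        ((Category.assoc _ _ _).trans ((congrArg (_ ≫ ·) (hq _)).trans comp_zero)) (hL' _)
    refine CategoryTheory.ShiftedHom.comp_comp_map_eq
      (idealSequence_shortExact i).singleδ _ (extProduct i q (Fin.tail v)) (Q.map ι)
      (by push_cast; rfl) ih h₂ ?_
    simp only [hL]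
    exact h₃

end ExtProduct

/-! ### Existence and uniqueness of HKR morphisms. -/

section HKR

open CochainComplex.HomComplex DerivedCategory

theorem _root_.DerivedCategory.exists_Q_map_eq {C : Type*} [Category* C] [Abelian C]
    [HasDerivedCategory.{w} C] {K L : CochainComplex C ℤ} [L.IsKInjective] (f : Q.obj K ⟶ Q.obj L) :
    ∃ g : K ⟶ L, Q.map g = f := by
  obtain ⟨g, hg⟩ := (CochainComplex.IsKInjective.Qh_map_bijective
    ((HomotopyCategory.quotient C _).obj K) L).surjective
    ((quotientCompQhIso C).hom.app K ≫ f ≫ (quotientCompQhIso C).inv.app L)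
  obtain ⟨g, rfl⟩ := (HomotopyCategory.quotient C _).map_surjective g
  refine ⟨g, ?_⟩
  rw [← cancel_epi ((quotientCompQhIso C).hom.app K)]
  refine ((quotientCompQhIso C).hom.naturality g).symm.trans
    ((congrArg (· ≫ (quotientCompQhIso C).hom.app L) hg).trans ?_)
  rw [Category.assoc, Category.assoc]
  exact congrArg (_ ≫ ·) ((congrArg (f ≫ ·) ((quotientCompQhIso C).inv_hom_id_app L)).trans
    (Category.comp_id _))

theorem _root_.DerivedCategory.quotient_map_eq_zero {C : Type*} [Category* C]
    [Abelian C] [HasDerivedCategory.{w} C] {K L : CochainComplex C ℤ} [L.IsKInjective] (f : K ⟶ L)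
    (h : Q.map f = 0) : (HomotopyCategory.quotient C (ComplexShape.up ℤ)).map f = 0 := by
  apply (CochainComplex.IsKInjective.Qh_map_bijective
    ((HomotopyCategory.quotient C _).obj K) L).injective
  rw [Functor.map_zero, ← cancel_mono ((quotientCompQhIso C).hom.app L), zero_comp]
  refine ((quotientCompQhIso C).hom.naturality f).trans ?_
  rw [h, comp_zero]

theorem _root_.DerivedCategory.ofCocycle_eq_zero_iff {C : Type*} [Category* C]
    [Abelian C] [HasDerivedCategory.{w} C] {K L : CochainComplex C ℤ} [L.IsKInjective] {n : ℤ}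
    (z : Cocycle K L n) : ofCocycle z = 0 ↔ z ∈ CochainComplex.HomComplex.coboundaries K L n := by
  refine ⟨fun h => ?_, fun ⟨m, hm, β, h⟩ => ofCocycle_eq_zero z β h hm⟩
  rw [← CohomologyClass.toHom_mk_eq_zero_iff, CohomologyClass.toHom_mk]
  apply quotient_map_eq_zero
  rw [ofCocycle_apply, ShiftedHom.map] at h
  exact (cancel_mono ((Q.commShiftIso n).hom.app L)).mp (h.trans zero_comp.symm)

theorem _root_.DerivedCategory.ofCocycle_fromSingleMk_eq_smul_iff {C : Type*} [Category* C]
    [Abelian C] [HasDerivedCategory.{w} C] {L : CochainComplex C ℤ} [L.IsKInjective] {F : C} {q : ℤ}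
    (ε : ℤˣ) (z z' : F ⟶ L.X q) (hz : z ≫ L.d q (q + 1) = 0) (hz' : z' ≫ L.d q (q + 1) = 0) :
    ofCocycle (Cocycle.fromSingleMk z (zero_add q) _ rfl hz) =
      ε • ofCocycle (Cocycle.fromSingleMk z' (zero_add q) _ rfl hz') ↔
      ∃ x : F ⟶ L.X (q - 1), z = ε • z' + x ≫ L.d (q - 1) q := by
  have h₁ : ∀ y (hy : y ≫ L.d q (q + 1) = 0),
      ofCocycle (Cocycle.fromSingleMk y (zero_add q) _ rfl hy) = 0 ↔
      ∃ x : F ⟶ L.X (q - 1), x ≫ L.d (q - 1) q = y := fun y hy =>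
    (ofCocycle_eq_zero_iff _).trans
      (Cocycle.fromSingleMk_mem_coboundaries_iff y (zero_add q) _ rfl hy (q - 1) (by omega))
  rcases Int.units_eq_one_or ε with rfl | rfl
  · rw [one_smul, one_smul, ← sub_eq_zero, ← map_sub, ← Cocycle.fromSingleMk_sub, h₁]
    exact exists_congr fun x => ⟨fun h => by rw [h]; abel, fun h => by rw [h]; abel⟩
  · rw [Units.neg_smul, one_smul, Units.neg_smul, one_smul, ← sub_eq_zero, sub_neg_eq_add,
      ← map_add, ← Cocycle.fromSingleMk_add, h₁]
    exact exists_congr fun x => ⟨fun h => by rw [h]; abel, fun h => by rw [h]; abel⟩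

theorem _root_.CategoryTheory.eq_comp_shift_map_iff {D : Type*} [Category* D] [HasShift D ℤ] {q : ℤ}
    {P W E Z : D} (x : P ⟶ P⟦q⟧) (s : P ⟶ W⟦q⟧) {a : W ⟶ E} {Θ : E ⟶ P} (ι : P ⟶ Z) [IsIso ι]
    {m : W ⟶ Z} (h : a ≫ Θ ≫ ι = m) :
    x = s ≫ (a ≫ Θ)⟦q⟧' ↔ s ≫ m⟦q⟧' = x ≫ ι⟦q⟧' := by
  rw [← h, ← cancel_mono (ι⟦q⟧'), Category.assoc, ← Functor.map_comp, Category.assoc, eq_comm]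

variable {X Y : Scheme.{u}} {i : X ⟶ Y} [IsClosedImmersion i]
  {J : CochainComplex Y.Modules ℤ} [J.IsKInjective]
  (ι : (CochainComplex.singleFunctor Y.Modules 0).obj ((pushforward i).obj (structureSheaf X)) ⟶ J)
  [QuasiIso ι]
  {e : (pushforward i).obj (structureSheaf X) ⟶ J.X 0} (he : IsResolution e)
  (hι : ι.f 0 = (HomologicalComplex.singleObjXSelf (.up ℤ) 0 _).hom ≫ e)
  [HasDerivedCategory.{w} Y.Modules]

-- After composition with the isomorphism from F to J, both sides of the HKR condition are classes
-- of cocycles F → J^q. As J is K-injective, equality of classes means equality up to a coboundary.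
include hι he in
theorem isHKR_iff {Θ : DerivedCategory.Plus.Q.obj (pushforwardExteriorComplex i
        (normalSheaf i)) ⟶
      (DerivedCategory.Plus.singleFunctor Y.Modules 0).obj
        ((pushforward i).obj (structureSheaf X))}
    {θ : (pushforwardExteriorComplex i (normalSheaf i)).obj ⟶ J}
    (h : DerivedCategory.Plus.ι.map Θ ≫ Q.map ι = Q.map θ) :
    IsHKR i Θ ↔ ∀ q : ℕ, IsWedgeProduct e (productSign q) (q := q) (θ.f (q : ℤ)) := by
  have hd : ∀ (q : ℕ) (r : ℤ), θ.f (q : ℤ) ≫ J.d q r = 0 := fun q r => by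
    rw [θ.comm, pushforwardExteriorComplex_d, zero_comp]
  have hd' : ∀ (q : ℕ) (v : Fin q → Γ(normalSheaf i, ⊤)) (r : ℤ),
      ((pushforward i).map (homOfSection (wedge _ v)) ≫ θ.f (q : ℤ)) ≫ J.d q r = 0 :=
    fun q v r => (Category.assoc _ _ _).trans ((congrArg (_ ≫ ·) (hd q r)).trans comp_zero)
  refine forall_congr' fun q => forall_congr' fun v => ?_
  have hz := productCocycle_comp_d he.injective _ he.degreeZero_comp_d (List.ofFn v) (q : ℤ)
  rw [← ofCocycle_fromSingleMk_eq_smul_iff (productSign q) _ _ (hd' q v _) (hz _)]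
  have : IsIso (Q.map ι) := (isIso_Q_map_iff_quasiIso _ ι).mpr inferInstance
  have h₁ : inclusionOfWedge i (normalSheaf i) v ≫ DerivedCategory.Plus.ι.map Θ ≫ Q.map ι =
      Q.map (HomologicalComplex.mkHomFromSingle (K := J) (j := (q : ℤ))
        ((pushforward i).map (homOfSection (wedge _ v)) ≫ θ.f (q : ℤ)) fun k _ => hd' q v k) := by
    rw [h]
    refine (Q.map_comp _ _).symm.trans (congrArg Q.map (HomologicalComplex.from_single_hom_ext ?_))
    refine (congrArg (· ≫ θ.f (q : ℤ)) (HomologicalComplex.mkHomFromSingle_f _ _)).trans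
      ((Category.assoc _ _ _).trans ?_)
    exact (HomologicalComplex.mkHomFromSingle_f _ _).symm
  exact (@CategoryTheory.eq_comp_shift_map_iff _ _ _ _ _ _ _ _ _ _ _ _ _ this _ h₁).trans (Eq.congr
    (shiftIso_inv_app_comp _ (hd' q v _) fun k _ => hd' q v k)
    (extProduct_comp_map ι he hι q v (hz _)))

include hι he in
theorem exists_isWedgeProduct {Θ : DerivedCategory.Plus.Q.obj (pushforwardExteriorComplex i
        (normalSheaf i)) ⟶
      (DerivedCategory.Plus.singleFunctor Y.Modules 0).obj
        ((pushforward i).obj (structureSheaf X))} (hΘ : IsHKR i Θ) :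
    ∃ θ : (pushforwardExteriorComplex i (normalSheaf i)).obj ⟶ J,
      DerivedCategory.Plus.ι.map Θ ≫ Q.map ι = Q.map θ ∧
      ∀ q : ℕ, IsWedgeProduct e (productSign q) (q := q) (θ.f (q : ℤ)) := by
  obtain ⟨θ, hθ⟩ := exists_Q_map_eq (DerivedCategory.Plus.ι.map Θ ≫ Q.map ι :
    Q.obj (pushforwardExteriorComplex i (normalSheaf i)).obj ⟶ Q.obj J)
  exact ⟨θ, hθ.symm, (isHKR_iff ι he hι hθ.symm).mp hΘ⟩

-- The difference of two representing chain maps is a coboundary along every wedge, so it is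
-- null-homotopic by the dual basis.
include hι he in
theorem IsHKR.eq {n : ℕ} (b : DualBasis (normalSheaf i) (Fin n))
    {Θ Θ' : DerivedCategory.Plus.Q.obj (pushforwardExteriorComplex i (normalSheaf i)) ⟶
      (DerivedCategory.Plus.singleFunctor Y.Modules 0).obj
        ((pushforward i).obj (structureSheaf X))} (hΘ : IsHKR i Θ) (hΘ' : IsHKR i Θ') : Θ = Θ' := by
  obtain ⟨θ, h₁, h₂⟩ := exists_isWedgeProduct ι he hι hΘ
  obtain ⟨θ', h₁', h₂'⟩ := exists_isWedgeProduct ι he hι hΘ'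
  have : IsIso (Q.map ι) := (isIso_Q_map_iff_quasiIso _ ι).mpr inferInstance
  have h₃ : Q.map θ = Q.map θ' := by
    obtain ⟨H⟩ := nonempty_homotopy_zero b (θ - θ') fun q v => by
      obtain ⟨x, hx⟩ := h₂ q v
      obtain ⟨x', hx'⟩ := h₂' q v
      refine ⟨x - x', ?_⟩
      refine (Preadditive.comp_sub (C := Y.Modules)
        (f := (pushforward i).map (homOfSection (wedge _ v))) _ _).trans ?_
      rw [hx, hx', Preadditive.sub_comp]
      abel
    exact sub_eq_zero.mp ((Q.map_sub).symm.trans (Q_map_eq_zero_of_homotopy H))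
  apply DerivedCategory.Plus.ι.map_injective
  exact (@cancel_mono _ _ _ _ _ (Q.map ι) (@IsIso.mono_of_iso _ _ _ _ _ this) _ _).mp
    (h₁.trans (h₃.trans h₁'.symm))

include hι he in
theorem exists_isHKR [IsAffine X] [IsAffine Y] {π : Y ⟶ X} (h : i ≫ π = 𝟙 X)
    (hs : (globalMap π).FormallySmooth) {n : ℕ} (b : DualBasis (normalSheaf i) (Fin n)) :
    ∃ Θ : DerivedCategory.Plus.Q.obj (pushforwardExteriorComplex i (normalSheaf i)) ⟶
      (DerivedCategory.Plus.singleFunctor Y.Modules 0).obj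
        ((pushforward i).obj (structureSheaf X)), IsHKR i Θ := by
  have : IsIso (Q.map ι) := (isIso_Q_map_iff_quasiIso _ ι).mpr inferInstance
  refine ⟨DerivedCategory.Plus.ι.preimage
    (Q.map (wedgeProductComplexHom e he b productSign) ≫ @inv _ _ _ _ (Q.map ι) this), ?_⟩
  refine (isHKR_iff ι he hι (θ := wedgeProductComplexHom e he b productSign) ?_).mpr fun q =>
    isWedgeProduct_wedgeProductHom h hs he b (productSign q) q
  rw [Functor.map_preimage]
  refine (Category.assoc _ _ _).trans ?_
  exact (congrArg (_ ≫ ·) (@IsIso.inv_hom_id _ _ _ _ (Q.map ι) this)).trans (Category.comp_id _)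

end HKR

theorem _root_.CategoryTheory.isIso_comp_comp_of_comp_eq {C : Type*} [Category* C]
    {A B E P Q P' : C} {a : A ⟶ B} {u : B ⟶ E} {r : E ⟶ P} {j : P ⟶ Q} {rj : E ⟶ Q}
    {t : B ⟶ P'} {u' : P' ⟶ Q} (h₁ : r ≫ j = rj) (h₂ : u ≫ rj = t ≫ u')
    (hat : IsIso (a ≫ t)) (hu' : IsIso u') (hj : IsIso j) : IsIso (a ≫ u ≫ r) := by
  have h : (a ≫ u ≫ r) ≫ j = (a ≫ t) ≫ u' := by
    simp only [Category.assoc, h₁, h₂]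
  have : IsIso ((a ≫ u ≫ r) ≫ j) := by rw [h]; infer_instance
  exact IsIso.of_isIso_comp_right _ j

/-- Naturality of the unit at θ moves the question to the injective complex, where the unit is
invertible. What remains is the underived map G followed by F(θ). -/
theorem _root_.CategoryTheory.Functor.isIso_comp_rightDerivedFunctorPlusUnit
    {C D : Type*} [Category* C] [Category* D] [Abelian C] [Abelian D]
    [HasDerivedCategory C] [HasDerivedCategory D]
    (F : C ⥤ D) [F.Additive] [EnoughInjectives C] {E : CochainComplex.Plus C}
    {J : CochainComplex.Plus (InjectiveObject C)} {P : DerivedCategory.Plus C}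
    {E' : CochainComplex.Plus D} (G : E' ⟶ F.mapCochainComplexPlus.obj E)
    (Θ : DerivedCategory.Plus.Q.obj E ⟶ P)
    (ι : P ⟶ DerivedCategory.Plus.Q.obj ((InjectiveObject.ι C).mapCochainComplexPlus.obj J))
    [IsIso ι] (θ : E ⟶ (InjectiveObject.ι C).mapCochainComplexPlus.obj J)
    (h : Θ ≫ ι = DerivedCategory.Plus.Q.map θ)
    (hθ : IsIso (DerivedCategory.Plus.Q.map (G ≫ F.mapCochainComplexPlus.map θ))) :
    IsIso (DerivedCategory.Plus.Q.map G ≫ F.rightDerivedFunctorPlusUnit.app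
      ((HomotopyCategory.Plus.quotient C).obj E) ≫ F.rightDerivedFunctorPlus.map Θ) := by
  have h₁ : IsIso (F.rightDerivedFunctorPlusUnit.app ((HomotopyCategory.Plus.quotient C).obj
      ((InjectiveObject.ι C).mapCochainComplexPlus.obj J))) :=
    inferInstanceAs (IsIso (F.rightDerivedFunctorPlusUnit.app
      ((InjectiveObject.ι C).mapHomotopyCategoryPlus.obj
        ((HomotopyCategory.Plus.quotient _).obj J))))
  have h₂ := F.rightDerivedFunctorPlusUnit.naturality ((HomotopyCategory.Plus.quotient C).map θ)
  have h₃ : F.rightDerivedFunctorPlus.map Θ ≫ F.rightDerivedFunctorPlus.map ι =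
      F.rightDerivedFunctorPlus.map (DerivedCategory.Plus.Q.map θ) :=
    (F.rightDerivedFunctorPlus.map_comp Θ ι).symm.trans (congrArg _ h)
  have h₄ : IsIso (DerivedCategory.Plus.Q.map G ≫
      DerivedCategory.Plus.Q.map (F.mapCochainComplexPlus.map θ)) := by
    rw [← Functor.map_comp]
    exact hθ
  exact isIso_comp_comp_of_comp_eq h₃ h₂.symm h₄ h₁ inferInstance
-- Assembly: the canonical map is an isomorphism.
section Main

open DerivedCategory

/-- The existence of an injective resolution, as a complex of injective objects. -/
theorem exists_quasiIso_injectiveObject {C : Type*} [Category* C] [Abelian C] [EnoughInjectives C]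
    (F : C) :
    ∃ (J : CochainComplex.Plus (InjectiveObject C)) (ι : (CochainComplex.singleFunctor C 0).obj F ⟶
      ((InjectiveObject.ι C).mapCochainComplexPlus.obj J).obj), QuasiIso ι ∧ J.obj.IsStrictlyGE 0 := by
  have : ((CochainComplex.singleFunctor C 0).obj F).IsStrictlyGE 0 := inferInstance
  obtain ⟨J, hJ, ι, hι⟩ := CochainComplex.Plus.exists_quasiIso_injective
    ⟨(CochainComplex.singleFunctor C 0).obj F, 0, this⟩ 0
  exact ⟨J, ι.hom, hι, hJ⟩

theorem isResolution_of_quasiIso {Y : Scheme.{u}} {F : Y.Modules} {J : CochainComplex Y.Modules ℤ}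
    [J.IsStrictlyGE 0] (hJ : ∀ q, CategoryTheory.Injective (J.X q))
    (ι : (CochainComplex.singleFunctor Y.Modules 0).obj F ⟶ J) [QuasiIso ι] :
    IsResolution ((HomologicalComplex.singleObjXSelf (.up ℤ) 0 F).inv ≫ ι.f 0) := by
  have hexact : ∀ q ≠ 0, J.ExactAt q := fun q hq =>
    (exactAt_iff_of_quasiIsoAt ι q).1 (HomologicalComplex.exactAt_single_obj (.up ℤ) 0 F q hq)
  have hd : ((HomologicalComplex.singleObjXSelf (.up ℤ) 0 F).inv ≫ ι.f 0) ≫ J.d 0 1 = 0 := by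
    refine (Category.assoc _ _ _).trans ((congrArg (_ ≫ ·) ((ι.comm 0 1).trans ?_)).trans comp_zero)
    exact zero_comp
  have hqi : QuasiIsoAt ι 0 := inferInstance
  rw [quasiIsoAt_iff' ι (-1) 0 1 (by simp) (by simp)] at hqi
  obtain ⟨h₁, h₂⟩ := (ShortComplex.quasiIso_iff_of_zeros _ rfl rfl
    ((J.isZero_of_isStrictlyGE 0 (-1)).eq_of_src _ _)).1 hqi
  refine ⟨hd, @mono_comp _ _ _ _ _ _ _ _ h₂, ?_, hexact,
    fun q hq => J.isZero_of_isStrictlyGE 0 q hq, hJ⟩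
  exact (ShortComplex.exact_iff_of_iso (ShortComplex.isoMk
    (HomologicalComplex.singleObjXSelf (.up ℤ) 0 F).symm (Iso.refl _) (Iso.refl _)
    (Category.comp_id _).symm ((Category.id_comp _).trans (Category.comp_id _).symm))).2 h₁

theorem isIso_plus_Q_map {C : Type*} [Category* C] [Abelian C] [HasDerivedCategory C]
    {K L : CochainComplex.Plus C} (f : K ⟶ L) (hf : QuasiIso f.hom) : IsIso (Plus.Q.map f) := by
  have : IsIso (Plus.ι.map (Plus.Q.map f)) := (isIso_Q_map_iff_quasiIso _ f.hom).2 hf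
  exact isIso_of_reflects_iso _ Plus.ι

variable {X Y : Scheme.{u}} {i : X ⟶ Y} [HasDerivedCategory.{w} Y.Modules]

theorem isIso_canonicalMap_of_comp_eq
    {Θ : Plus.Q.obj (pushforwardExteriorComplex i (normalSheaf i)) ⟶
      (Plus.singleFunctor Y.Modules 0).obj ((pushforward i).obj (structureSheaf X))}
    {J : CochainComplex.Plus (InjectiveObject Y.Modules)}
    (ι : (CochainComplex.singleFunctor Y.Modules 0).obj ((pushforward i).obj (structureSheaf X)) ⟶
      ((InjectiveObject.ι Y.Modules).mapCochainComplexPlus.obj J).obj) (hι : QuasiIso ι)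
    (θ : (pushforwardExteriorComplex i (normalSheaf i)).obj ⟶
      ((InjectiveObject.ι Y.Modules).mapCochainComplexPlus.obj J).obj)
    (hθ : Plus.ι.map Θ ≫ Q.map ι = Q.map θ) (hm : QuasiIso (mulHomComplex i θ)) :
    IsIso (canonicalMap i (normalSheaf i) Θ) := by
  let K : CochainComplex.Plus Y.Modules := ⟨(CochainComplex.singleFunctor Y.Modules 0).obj
      ((pushforward i).obj (structureSheaf X)), 0, inferInstance⟩
  let ι' : K ⟶ (InjectiveObject.ι Y.Modules).mapCochainComplexPlus.obj J := ⟨ι⟩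
  let θ' : pushforwardExteriorComplex i (normalSheaf i) ⟶
    (InjectiveObject.ι Y.Modules).mapCochainComplexPlus.obj J := ⟨θ⟩
  have hι₁ : IsIso (Plus.Q.map ι') := isIso_plus_Q_map _ hι
  let Θ' : Plus.Q.obj (pushforwardExteriorComplex i (normalSheaf i)) ⟶ Plus.Q.obj K := Θ
  have h₁ : Θ' ≫ Plus.Q.map ι' = Plus.Q.map θ' :=
    Plus.ι.map_injective ((Plus.ι.map_comp _ _).trans hθ)
  let F := sheafHom ((pushforward i).obj (structureSheaf X))
  let G : pushforwardExteriorComplex i (normalSheaf i) ⟶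
      F.mapCochainComplexPlus.obj (pushforwardExteriorComplex i (normalSheaf i)) :=
    ⟨(NatTrans.mapHomologicalComplex (pushforwardToSheafHom i) (ComplexShape.up ℤ)).app
      (exteriorComplex (normalSheaf i)).obj⟩
  have h₂ : IsIso (Plus.Q.map (G ≫ F.mapCochainComplexPlus.map θ')) := isIso_plus_Q_map _ hm
  exact Functor.isIso_comp_rightDerivedFunctorPlusUnit F G Θ' (Plus.Q.map ι') θ' h₁ h₂

/-- One bounded below complex of injectives serves twice: being K-injective, it represents morphisms
to F by chain maps, and its image under ℋom(F, -) computes RℋHom. -/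
theorem exists_isHKR_and_isIso_canonicalMap [IsAffine X] [IsAffine Y] [IsClosedImmersion i]
    {π : Y ⟶ X} (h : i ≫ π = 𝟙 X) (hs : (globalMap π).FormallySmooth)
    (hp : (globalMap π).FinitePresentation) :
    ∃ Θ, IsHKR i Θ ∧ IsIso (canonicalMap i (normalSheaf i) Θ) ∧ ∀ Θ', IsHKR i Θ' → Θ' = Θ := by
  obtain ⟨J, ι, hι, hJ⟩ := exists_quasiIso_injectiveObject
    ((pushforward i).obj (structureSheaf X))
  obtain ⟨n, ⟨b⟩⟩ := exists_dualBasis_normalSheaf h hs hp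
  have : ((InjectiveObject.ι Y.Modules).mapCochainComplexPlus.obj J).obj.IsStrictlyGE 0 :=
    (CochainComplex.isStrictlyGE_mapHomologicalComplex_obj_iff _ (InjectiveObject.ι _) _).2 hJ
  have hinj : ∀ q, CategoryTheory.Injective
      (((InjectiveObject.ι Y.Modules).mapCochainComplexPlus.obj J).obj.X q) := fun q =>
    (J.obj.X q).property
  have he := isResolution_of_quasiIso hinj ι
  have hK : ((InjectiveObject.ι Y.Modules).mapCochainComplexPlus.obj J).obj.IsKInjective :=
    CochainComplex.isKInjective_of_injective _ 0
  have hι₀ : ι.f 0 = (HomologicalComplex.singleObjXSelf (.up ℤ) 0 _).hom ≫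
      ((HomologicalComplex.singleObjXSelf (.up ℤ) 0 _).inv ≫ ι.f 0) :=
    ((Category.assoc _ _ _).symm.trans ((congrArg (· ≫ ι.f 0) (Iso.hom_inv_id _)).trans
      (Category.id_comp _))).symm
  obtain ⟨Θ, hΘ⟩ := exists_isHKR ι he hι₀ h hs b
  refine ⟨Θ, hΘ, ?_, fun Θ' hΘ' => IsHKR.eq ι he hι₀ b hΘ' hΘ⟩
  obtain ⟨θ, hθ, hw⟩ := exists_isWedgeProduct ι he hι₀ hΘ
  exact isIso_canonicalMap_of_comp_eq ι hι θ hθ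
    (quasiIso_mulHomComplex h hs hp he θ productSign hw)

end Main

end
end AlgebraicGeometry.Scheme.Modules

theorem proposition3p3 {K : Type u} [CommRing K] [IsNoetherianRing K] {X : Scheme.{u}} [IsAffine X]
    (f : X ⟶ Spec (CommRingCat.of K)) [Smooth f]
    [HasDerivedCategory.{w} (Limits.pullback f f).Modules] :
    ∃! e : Scheme.Modules.RSheafHomDiagonal f ≅ Scheme.Modules.polyvectorSum f,
      Scheme.Modules.IsHKRDecomposition f e := by
  -- The retraction of the diagonal is the first projection, which is smooth by base change.
  have hs : (Limits.pullback.fst f f).appTop.hom.Smooth := by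
    have : Smooth (Limits.pullback.fst f f) := inferInstance
    exact (HasRingHomProperty.iff_of_isAffine (P := @Smooth)).1 this
  obtain ⟨Θ, hΘ, hiso, huniq⟩ := Scheme.Modules.exists_isHKR_and_isIso_canonicalMap
    (i := Limits.pullback.diagonal f) (Limits.pullback.diagonal_fst f) hs.1 hs.2
  refine ⟨(DerivedCategory.Plus.ι.mapIso (@asIso _ _ _ _ _ hiso)).symm, ⟨Θ, hΘ, rfl⟩, ?_⟩
  -- The inverse of e is determined by Θ', and there is only one HKR morphism.
  rintro e ⟨Θ', hΘ', h⟩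
  obtain rfl := huniq Θ' hΘ'
  exact Iso.ext_inv h
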